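/- **Setting.** Let $\mathcal U=\bigoplus_{1\le i,j\le r}\mathcal U_{ij}$ be a finite-dimensional real T-algebra of rank $r$ (in the sense of Vinberg) with involution $x\mapsto x^\star$: $\mathcal U_{ij}\mathcal U_{jk}\subset\mathcal U_{ik}$, $\mathcal U_{ij}\mathcal U_{lk}=\{0\}$ for $j\ne l$, $\mathcal U_{ij}^\star\subset\mathcal U_{ji}$, $\mathcal U_{ii}=\mathbb R c_i$ with $c_i^2=c_i$, $\rho(\lambda c_i)=\lambda$, unit $\mathbf e=\sum_i c_i$, and $\mathrm{tr}\,x=\sum_i\rho(x_{ii})$. Let $H$ be the group of upper triangular elements with positive diagonal, $V=\{x: x^\star=x\}$ with inner product $(x|y)=\mathrm{tr}(xy^\star)$, $n=\dim V$, and let $\Omega=\{ss^\star: s\in H\}\subset V$. Assume that $\Omega$ is a symmetric cone, i.e. that it equals its dual cone $\Omega^*=\{\xi:(x|\xi)>0\ \forall x\in\overline\Omega\setminus\{0\}\}=\{t^\star t:t\in H\}$ (every symmetric cone in a Euclidean Jordan algebra $V$ is realized in this way). Put $n_{ij}=\dim\mathcal U_{ij}$, $n_i=\sum_{j<i}n_{ji}$,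 $m_i=\sum_{j>i}n_{ij}$, $\tau_i=1+\frac12(m_i+n_i)$, and for $t\in H$ put $Q_j(tt^\star)=\rho(t_{jj})^2$, $Q_j^*(t^\star t)=\rho(t_{jj})^2$; for $\alpha\in\mathbb R^r$ put $Q^\alpha=\prod_jQ_j^{\alpha_j}$, $(Q^*)^\alpha=\prod_j(Q_j^*)^{\alpha_j}$. Let $T$ be the triangular group of linear maps $u^\star u\mapsto(w^\star u^\star)(uw)$, $w\in H$, acting simply transitively on $\Omega$; let $d$ be the invariant Riemannian distance on $\Omega$, given by the metric $\langle v,w\rangle_{g\mathbf e}=(g^{-1}v|g^{-1}w)$, $g\in T$, and $B_R(\xi)$ its balls. Let $\{\xi_j\}_{j\in\mathbb N}$ be a $(\frac12,2)$-lattice in $\Omega$ (the balls $B_{1/2}(\xi_j)$ are pairwise disjoint and the balls $B_1(\xi_j)$ cover $\Omega$), $\xi_j=g_j\mathbf e$ with $g_j\in T$. Let $\varphi_0\in C_c^\infty(B_2(\mathbf e))$ with $0\le\varphi_0\le1$ and $\varphi_0=1$ on $B_1(\mathbf e)$, let $\varphi_j(\xi)=\varphi_0(g_j^{-1}\xi)$,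 and define $\psi_j$ by $\widehat{\psi_j}=\varphi_j/\sum_k\varphi_k$, where $\widehat f(\xi)=(2\pi)^{-n}\int_Ve^{-i(x|\xi)}f(x)\,dx$ (for $f\in L^p(V)$, $\widehat f$ is understood in the sense of distributions). Put $$\|f\|_{B^{p,q}_\nu}=\Big[\sum_j(Q^*)^{-\nu}(\xi_j)\|f*\psi_j\|_p^q\Big]^{1/q},$$ let $\mathcal S_\Omega$ be the space of Schwartz functions $f$ on $V$ with $\mathrm{Supp}\,\widehat f\subset\overline\Omega$, and $$\mathcal Cf(z)=(2\pi)^{-n/2}\int_\Omega e^{i(z|\xi)}\widehat f(\xi)\,d\xi,\qquad z\in T_\Omega=V+i\Omega .$$ Let $A^{p,q}_\nu(T_\Omega)$ be the space of holomorphic $F$ on $T_\Omega$ with $$\|F\|_{A^{p,q}_\nu}=\Big(\int_\Omega\Big(\int_V|F(x+iy)|^p\,dx\Big)^{q/p}Q^{\nu-\tau}(y)\,dy\Big)^{1/q}<\infty .$$ Finally, with $\frac1{p'}=1-\frac1p$ and $a_+=\max(a,0)$, put $$\widetilde q_{\nu,p}=\min_j\frac{\nu_j+\frac{n_j}2}{\big(\frac{n_j}{2p'}-(1+\frac{m_j}2)\big)_+},$$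 a quotient with denominator $0$ being $\infty$. **Theorem.** Let $\nu\in\mathbb R^r$ with $\nu_j>\frac{m_j}2$ for $j=1,\dots,r$, and let $1\le p,s<\infty$. Assume that there exist $\delta>0$, a vector $\mu\in\mathbb R^r$ with $\mu_j>0$ for all $j$, and a constant $C$ such that $$\Big\|\sum_jf_j\Big\|_p\le C\Big[\sum_j(Q^*)^{-\mu}(\xi_j)\,e^{\delta(\xi_j|\mathbf e)}\|f_j\|_p^s\Big]^{1/s}$$ for every finite sequence $\{f_j\}\subset L^p(V)$ with $\mathrm{Supp}\,\widehat{f_j}\subset B_2(\xi_j)$. Assume that $q$ satisfies one of the following conditions: (i) $1\le q\le s$ and $q<s\min_{j}\dfrac{\nu_j-\frac{m_j}2}{\mu_j}$; (ii) $s<q<\min\Big\{s\min_{j}\dfrac{\nu_j-\frac{m_j}2+\frac{n_j}2}{\mu_j+\frac{n_j}2},\ \widetilde q_{\nu,p}\Big\}$. Then for every $f\in\mathcal S_\Omega$ the function $F=\mathcal Cf$ belongs to $A^{p,q}_\nu(T_\Omega)$, and there is a constant $K$, independent of $f$, such that $$\|\mathcal Cf\|_{A^{p,q}_\nu}\le K\,\|f\|_{B^{p,q}_\nu}\qquad\text{for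 all } f\in\mathcal S_\Omega.$$ -/

import Mathlib

open MeasureTheory Set
open scoped ENNReal NNReal SchwartzMap

noncomputable section

/-- A real matrix algebra of rank `r` with involution: a bigraded algebra `U = ⊕ U i j`, with
`U i j * U j k ⊆ U i k`, `U i j * U l k = 0` for `j ≠ l`, with `U i i = ℝ c i`, and with an
involution `x ↦ x⋆`. The product need not be associative. -/
structure StarMatrixAlgebra (r : ℕ) (U : Type*) [AddCommGroup U] [Module ℝ U] where
  /-- the (bilinear) product -/
  mul : U →ₗ[ℝ] U →ₗ[ℝ] U
  /-- the involution -/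
  star : U →ₗ[ℝ] U
  /-- the subspace `U i j` -/
  comp : Fin r → Fin r → Submodule ℝ U
  /-- the idempotent spanning `U i i` -/
  c : Fin r → U
  /-- `diag i x` is the real number `ρ (x i i)`, i.e. the `(i, i)`-component of `x`
  is `diag i x • c i` -/
  diag : Fin r → U →ₗ[ℝ] ℝ
  isInternal : DirectSum.IsInternal (fun ij : Fin r × Fin r => comp ij.1 ij.2)
  mul_mem : ∀ {i j k : Fin r} {x y : U}, x ∈ comp i j → y ∈ comp j k → mul x y ∈ comp i k
  mul_eq_zero : ∀ {i j l k : Fin r} {x y : U}, j ≠ l → x ∈ comp i j → y ∈ comp l k → mul x y = 0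
  star_mem : ∀ {i j : Fin r} {x : U}, x ∈ comp i j → star x ∈ comp j i
  star_star : ∀ x : U, star (star x) = x
  star_mul : ∀ x y : U, star (mul x y) = mul (star y) (star x)
  c_mem : ∀ i, c i ∈ comp i i
  c_mul_c : ∀ i, mul (c i) (c i) = c i
  diag_c : ∀ i, diag i (c i) = 1
  eq_diag_smul : ∀ {i : Fin r} {x : U}, x ∈ comp i i → x = diag i x • c i
  diag_eq_zero : ∀ {i k l : Fin r} {x : U}, (k, l) ≠ (i, i) → x ∈ comp k l → diag i x = 0

namespace StarMatrixAlgebra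

variable {r : ℕ} {U : Type*} [AddCommGroup U] [Module ℝ U]

/-- The trace `∑ ρ (x i i)`. -/
def tr (A : StarMatrixAlgebra r U) (x : U) : ℝ := ∑ i, A.diag i x

/-- The upper triangular elements `⊕_{i ≤ j} U i j`. -/
def upper (A : StarMatrixAlgebra r U) : Submodule ℝ U :=
  ⨆ (i : Fin r) (j : Fin r) (_ : i ≤ j), A.comp i j

theorem star_c (A : StarMatrixAlgebra r U) (i : Fin r) : A.star (A.c i) = A.c i := by
  obtain ⟨a, ha⟩ : ∃ a : ℝ, A.star (A.c i) = a • A.c i :=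
    ⟨_, A.eq_diag_smul (A.star_mem (A.c_mem i))⟩
  have h1 : A.star (A.star (A.c i)) = (a * a) • A.c i := by
    rw [ha, map_smul, ha, smul_smul]
  have h2 := A.star_mul (A.c i) (A.c i)
  rw [A.c_mul_c, ha, LinearMap.map_smul₂, map_smul, A.c_mul_c, smul_smul] at h2
  rw [A.star_star] at h1
  rw [ha, h2, ← h1]

end StarMatrixAlgebra

/-- A T-algebra of rank `r` (in the sense of Vinberg). The ambient inner product
is `(x|y) = tr (x y⋆)`; in particular `tr (x x⋆) > 0` for `x ≠ 0`. -/
structure TAlgebra (r : ℕ) (U : Type*) [NormedAddCommGroup U] [InnerProductSpace ℝ U]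
    extends StarMatrixAlgebra r U where
  c_mul : ∀ {i j : Fin r} {x : U}, x ∈ comp i j → mul (c i) x = x
  mul_c : ∀ {i j : Fin r} {x : U}, x ∈ comp i j → mul x (c j) = x
  tr_mul_comm : ∀ x y : U,
    toStarMatrixAlgebra.tr (mul x y) = toStarMatrixAlgebra.tr (mul y x)
  tr_mul_assoc : ∀ x y z : U,
    toStarMatrixAlgebra.tr (mul x (mul y z)) = toStarMatrixAlgebra.tr (mul (mul x y) z)
  inner_eq : ∀ x y : U, inner ℝ x y = toStarMatrixAlgebra.tr (mul x (star y))
  upper_assoc : ∀ t ∈ toStarMatrixAlgebra.upper, ∀ u ∈ toStarMatrixAlgebra.upper,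
    ∀ w ∈ toStarMatrixAlgebra.upper, mul t (mul u w) = mul (mul t u) w
  upper_mul_star : ∀ t ∈ toStarMatrixAlgebra.upper, ∀ u ∈ toStarMatrixAlgebra.upper,
    mul t (mul u (star u)) = mul (mul t u) (star u)

namespace TAlgebra

variable {r : ℕ} {U : Type*} [NormedAddCommGroup U] [InnerProductSpace ℝ U]

/-- The subspace `{x | x⋆ = x}` of `U`. -/
def herm (A : TAlgebra r U) : Submodule ℝ U := LinearMap.eqLocus A.star LinearMap.id

/-- The Euclidean space `V` of Hermitian elements, with the inner product `tr (x y⋆)`. -/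
def V (A : TAlgebra r U) : Type _ := A.herm

instance (A : TAlgebra r U) : NormedAddCommGroup A.V := inferInstanceAs (NormedAddCommGroup A.herm)
instance (A : TAlgebra r U) : InnerProductSpace ℝ A.V :=
  inferInstanceAs (InnerProductSpace ℝ A.herm)
instance (A : TAlgebra r U) [FiniteDimensional ℝ U] : FiniteDimensional ℝ A.V :=
  inferInstanceAs (FiniteDimensional ℝ A.herm)
instance (A : TAlgebra r U) : MeasurableSpace A.V := borel A.V
instance (A : TAlgebra r U) : BorelSpace A.V := ⟨rfl⟩

/-- The inclusion of `V` in `U`. -/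
def incl (A : TAlgebra r U) : A.V →ₗ[ℝ] U := A.herm.subtype

/-- The unit element `e = ∑ c i`, as an element of `V`. -/
def e (A : TAlgebra r U) : A.V :=
  (⟨∑ i, A.c i, by
    simp only [herm, LinearMap.mem_eqLocus, map_sum, A.star_c, LinearMap.id_apply]⟩ : A.herm)

/-- The group `H` of upper triangular elements with positive diagonal. -/
def H (A : TAlgebra r U) : Set U := {t | t ∈ A.upper ∧ ∀ i, 0 < A.diag i t}

/-- The homogeneous cone `Ω = {s s⋆ : s ∈ H}`. -/
def cone (A : TAlgebra r U) : Set A.V := {y | ∃ s ∈ A.H, A.incl y = A.mul s (A.star s)}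

/-- The dual cone `Ω* = {ξ : (x|ξ) > 0 for all x ∈ closure Ω, x ≠ 0}`. -/
def dualCone (A : TAlgebra r U) : Set A.V :=
  {ξ | ∀ x ∈ closure A.cone, x ≠ 0 → 0 < inner ℝ x ξ}

/-- The homogeneous cone `Ω` is symmetric when it is self-dual; equivalently, when `Ω` is the cone
of squares of the Euclidean Jordan algebra `V` with Jordan product `(x y + y x) / 2`. -/
def IsSymmetric (A : TAlgebra r U) : Prop := A.dualCone = A.cone

/-- `n_{ij} = dim U i j`. -/
def nij (A : TAlgebra r U) (i j : Fin r) : ℕ := Module.finrank ℝ (A.comp i j)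

/-- `n_i = ∑_{j < i} n_{ji}`. -/
def nn (A : TAlgebra r U) (i : Fin r) : ℝ := ∑ j with j < i, (A.nij j i : ℝ)

/-- `m_i = ∑_{j > i} n_{ij}`. -/
def mm (A : TAlgebra r U) (i : Fin r) : ℝ := ∑ j with i < j, (A.nij i j : ℝ)

/-- `τ_i = 1 + (m_i + n_i) / 2`. -/
def tau (A : TAlgebra r U) (i : Fin r) : ℝ := 1 + (A.mm i + A.nn i) / 2

open Classical in
/-- `Q_j (y) = ρ (t j j) ^ 2` for `y = t t⋆ ∈ Ω` with `t ∈ H` (`t` is unique), and `0` off `Ω`. -/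
def Q (A : TAlgebra r U) (j : Fin r) (y : A.V) : ℝ :=
  if h : ∃ t ∈ A.H, A.incl y = A.mul t (A.star t) then A.diag j h.choose ^ 2 else 0

open Classical in
/-- `Q*_j (ξ) = ρ (t j j) ^ 2` for `ξ = t⋆ t ∈ Ω*` with `t ∈ H` (`t` is unique),
and `0` off `Ω*`. -/
def Qstar (A : TAlgebra r U) (j : Fin r) (ξ : A.V) : ℝ :=
  if h : ∃ t ∈ A.H, A.incl ξ = A.mul (A.star t) t then A.diag j h.choose ^ 2 else 0

/-- The compound function `Q ^ α = ∏ Q_j ^ α_j`. -/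
def Qpow (A : TAlgebra r U) (α : Fin r → ℝ) (y : A.V) : ℝ := ∏ j, A.Q j y ^ α j

/-- The compound function `(Q*) ^ α = ∏ (Q*_j) ^ α_j`. -/
def Qstarpow (A : TAlgebra r U) (α : Fin r → ℝ) (ξ : A.V) : ℝ := ∏ j, A.Qstar j ξ ^ α j

/-- `g` is the linear transformation `π(w⋆) : u⋆ u ↦ (w⋆ u⋆) (u w)` of `V`, for some `w ∈ H`.
These transformations form the triangular group acting simply transitively on `Ω*`. -/
def IsTriangular (A : TAlgebra r U) (g : A.V ≃L[ℝ] A.V) : Prop :=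
  ∃ w ∈ A.H, ∀ u ∈ A.H, ∀ x : A.V, A.incl x = A.mul (A.star u) u →
    A.incl (g x) = A.mul (A.mul (A.star w) (A.star u)) (A.mul u w)

open Classical in
/-- The norm of a tangent vector `v` at `ξ` for the invariant Riemannian metric
`⟨v, w⟩_ξ = (g⁻¹ v | g⁻¹ w)`, where `g` is the (unique) triangular transformation with
`g e = ξ`. -/
def tangentNorm (A : TAlgebra r U) (ξ v : A.V) : ℝ≥0∞ :=
  if h : ∃ g : A.V ≃L[ℝ] A.V, A.IsTriangular g ∧ g A.e = ξ then ‖h.choose.symm v‖ₑ else 0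

/-- The length of a curve `γ : [0, 1] → Ω` for the invariant metric. -/
def curveLength (A : TAlgebra r U) (γ : ℝ → A.V) : ℝ≥0∞ :=
  ∫⁻ t in Icc (0 : ℝ) 1, A.tangentNorm (γ t) (deriv γ t)

/-- The invariant distance of the symmetric cone `Ω`: the infimum of the lengths of
`C¹` curves in `Ω`. -/
def invDist (A : TAlgebra r U) (ξ η : A.V) : ℝ≥0∞ :=
  ⨅ (γ : ℝ → A.V) (_ : ContDiff ℝ 1 γ ∧ γ 0 = ξ ∧ γ 1 = η ∧ ∀ t ∈ Icc (0 : ℝ) 1, γ t ∈ A.cone),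
    A.curveLength γ

/-- The ball `B_R (ξ)` of `Ω` for the invariant distance. -/
def dBall (A : TAlgebra r U) (ξ : A.V) (R : ℝ) : Set A.V :=
  {η | η ∈ A.cone ∧ A.invDist ξ η < ENNReal.ofReal R}

/-- The data of a Littlewood-Paley decomposition adapted to `Ω`: a `(1/2, 2)`-lattice `ξ_j` of
`Ω`, triangular transformations `g_j` with `ξ_j = g_j e`, and a bump function `φ₀`. -/
structure LittlewoodPaley (A : TAlgebra r U) where
  /-- the points `ξ_j` of the lattice -/
  pt : ℕ → A.V
  pt_mem : ∀ j, pt j ∈ A.cone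
  disjoint : ∀ j k, j ≠ k → Disjoint (A.dBall (pt j) (1 / 2)) (A.dBall (pt k) (1 / 2))
  cover : A.cone ⊆ ⋃ j, A.dBall (pt j) 1
  /-- the transformations `g_j` -/
  g : ℕ → A.V ≃L[ℝ] A.V
  g_triangular : ∀ j, A.IsTriangular (g j)
  g_e : ∀ j, g j A.e = pt j
  /-- the bump function `φ₀` -/
  bump : A.V → ℝ
  bump_contDiff : ContDiff ℝ (⊤ : ℕ∞) bump
  bump_compact : HasCompactSupport bump
  bump_tsupport : tsupport bump ⊆ A.dBall A.e 2
  bump_nonneg : ∀ ξ, 0 ≤ bump ξ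
  bump_le_one : ∀ ξ, bump ξ ≤ 1
  bump_eq_one : ∀ ξ ∈ A.dBall A.e 1, bump ξ = 1

section Analysis

variable [FiniteDimensional ℝ U]

/-- The Fourier transform `(2π)^{-n} ∫ e^{-i(x|ξ)} f(x) dx`. -/
def fourier (A : TAlgebra r U) (f : A.V → ℂ) (ξ : A.V) : ℂ :=
  (((2 * Real.pi) ^ Module.finrank ℝ A.V)⁻¹ : ℝ) *
    ∫ x, Complex.exp (-Complex.I * (inner ℝ x ξ : ℝ)) * f x

/-- The inverse Fourier transform `∫ e^{i(x|ξ)} h(ξ) dξ`. -/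
def fourierInv (A : TAlgebra r U) (h : A.V → ℂ) (x : A.V) : ℂ :=
  ∫ ξ, Complex.exp (Complex.I * (inner ℝ x ξ : ℝ)) * h ξ

/-- The support of the distributional Fourier transform `φ ↦ ∫ f φ^` of a function
`f ∈ L^p`: a point is off the support when the distribution vanishes on a neighbourhood of it. -/
def fourierSupport (A : TAlgebra r U) (f : A.V → ℂ) : Set A.V :=
  {ξ | ∀ N ∈ nhds ξ, ∃ φ : 𝓢(A.V, ℂ), tsupport φ ⊆ N ∧ ∫ x, f x * A.fourier φ x ≠ 0}

/-- The space `S_Ω` of Schwartz functions whose Fourier transform is supported in `closure Ω`. -/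
def schwartzCone (A : TAlgebra r U) : Set 𝓢(A.V, ℂ) :=
  {f | tsupport (A.fourier f) ⊆ closure A.cone}

/-- `φ_j (ξ) = φ₀ (g_j⁻¹ ξ)`. -/
def LittlewoodPaley.phi {A : TAlgebra r U} (L : A.LittlewoodPaley) (j : ℕ) (ξ : A.V) : ℝ :=
  L.bump ((L.g j).symm ξ)

/-- The function `ψ_j` with Fourier transform `φ_j / ∑ φ_k` (which is `0` off `Ω`). -/
def LittlewoodPaley.psi {A : TAlgebra r U} (L : A.LittlewoodPaley) (j : ℕ) : A.V → ℂ :=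
  A.fourierInv fun ξ => ((L.phi j ξ / ∑' k, L.phi k ξ : ℝ) : ℂ)

/-- The Besov norm `[∑_j (Q*)^{-ν}(ξ_j) ‖f * ψ_j‖_p^q]^{1/q}`. -/
def LittlewoodPaley.besovNorm {A : TAlgebra r U} (L : A.LittlewoodPaley) (ν : Fin r → ℝ)
    (p q : ℝ) (f : A.V → ℂ) : ℝ≥0∞ :=
  (∑' j, ENNReal.ofReal (A.Qstarpow (fun i => -ν i) (L.pt j)) *
    eLpNorm (convolution f (L.psi j) (ContinuousLinearMap.mul ℝ ℂ) volume)
      (ENNReal.ofReal p) volume ^ q) ^ (1 / q)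

/-- The operator `C f = 𝓛 (f^)`, where
`𝓛 h (x + i y) = (2π)^{-n/2} ∫_Ω e^{i (x + i y | ξ)} h(ξ) dξ`. -/
def opC (A : TAlgebra r U) (f : A.V → ℂ) (x y : A.V) : ℂ :=
  ((2 * Real.pi) ^ (-(Module.finrank ℝ A.V : ℝ) / 2) : ℝ) *
    ∫ ξ in A.cone, Complex.exp (Complex.I *
      ((inner ℝ x ξ : ℝ) + Complex.I * (inner ℝ y ξ : ℝ))) * A.fourier f ξ

/-- Functions on the tube domain `T_Ω = V + i Ω` are written as functions of `x ∈ V`, `y ∈ Ω`.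
Holomorphic: real differentiable, with Cauchy-Riemann equations
`dF (i v) = i dF (v)`. -/
def HolomorphicOnTube (A : TAlgebra r U) (F : A.V → A.V → ℂ) : Prop :=
  ∀ x, ∀ y ∈ A.cone, ∃ D : A.V × A.V →L[ℝ] ℂ,
    HasFDerivAt (fun z : A.V × A.V => F z.1 z.2) D (x, y) ∧
      ∀ v, D (0, v) = Complex.I * D (v, 0)

/-- The mixed norm
`[∫_Ω (∫_V |F(x + i y)|^p dx)^{q/p} Q^{ν - τ}(y) dy]^{1/q}`. -/
def mixedNorm (A : TAlgebra r U) (ν : Fin r → ℝ) (p q : ℝ) (F : A.V → A.V → ℂ) : ℝ≥0∞ :=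
  (∫⁻ y in A.cone, eLpNorm (fun x => F x y) (ENNReal.ofReal p) volume ^ q *
    ENNReal.ofReal (A.Qpow (fun i => ν i - A.tau i) y)) ^ (1 / q)

/-- Membership in the mixed norm Bergman space `A^{p,q}_ν (T_Ω)`. -/
def MemBergman (A : TAlgebra r U) (ν : Fin r → ℝ) (p q : ℝ) (F : A.V → A.V → ℂ) : Prop :=
  A.HolomorphicOnTube F ∧ A.mixedNorm ν p q F < ∞

/-- The estimate
`‖∑ f_j‖_p ≤ C [∑ (Q*)^{-μ}(ξ_j) e^{δ (ξ_j|e)} ‖f_j‖_p^s]^{1/s}` for all finite sequences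
`f_j ∈ L^p (V)` with `supp f_j^ ⊆ B_2 (ξ_j)`. -/
def LittlewoodPaley.Decoupling {A : TAlgebra r U} (L : A.LittlewoodPaley) (p s : ℝ)
    (μ : Fin r → ℝ) (δ : ℝ) (C : ℝ≥0) : Prop :=
  ∀ (J : Finset ℕ) (f : ℕ → A.V → ℂ),
    (∀ j ∈ J, MemLp (f j) (ENNReal.ofReal p) volume ∧
      A.fourierSupport (f j) ⊆ A.dBall (L.pt j) 2) →
    eLpNorm (∑ j ∈ J, f j) (ENNReal.ofReal p) volume ≤
      C * (∑ j ∈ J, ENNReal.ofReal (A.Qstarpow (fun i => -μ i) (L.pt j) *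
        Real.exp (δ * inner ℝ (L.pt j) A.e)) *
          eLpNorm (f j) (ENNReal.ofReal p) volume ^ s) ^ (1 / s)

end Analysis

/-- The index `min_j (ν_j + n_j/2) / (n_j/(2p') - (1 + m_j/2))₊`, with `1/p' = 1 - 1/p`
(the quotient is `∞` when the positive part vanishes). -/
def qTilde (A : TAlgebra r U) (ν : Fin r → ℝ) (p : ℝ) : ℝ≥0∞ :=
  ⨅ j, ENNReal.ofReal (ν j + A.nn j / 2) /
    ENNReal.ofReal (A.nn j / 2 * (1 - 1 / p) - (1 + A.mm j / 2))

end TAlgebra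

end

open MeasureTheory Set
open scoped ENNReal NNReal SchwartzMap

noncomputable section

namespace TAlgebra

variable {r : ℕ} {U : Type*} [NormedAddCommGroup U] [InnerProductSpace ℝ U] (A : TAlgebra r U)

/-! ### Peirce components -/

/-! Everything is transported to the triangular group H. The upper triangular elements form an
associative algebra `Up`, and Ω is the image of H under t ↦ t t⋆ (`sq`) and, by self-duality, also
under t ↦ t⋆ t (`sqs`, see `IsSymmetric.cone_eq`). The pairing becomes a norm, (s s⋆ | t⋆ t) = ‖t
s‖² (`inner_sq_sqs`). A height is written y = t t⋆ and a lattice point ξ_j = w_j⋆ w_j, so that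
e^{-(y|ξ_j)} is the Gaussian e^{-‖w_j t‖²}. Compound functions become monomials `mon` in the
diagonal coefficients, and the Jacobians come from determinants of left and right multiplications.

The heart is an estimate at a fixed height, `Decoupling.exists_eLpNorm_laplaceInt_le`: ‖F(· + i t
t⋆)‖_p ≤ C (∑_j mon(-2μ)(w_j t) e^{-γ‖w_j t‖²} ‖f * ψ_j‖_p^s)^{1/s}, uniformly in t. The transform
of f is cut by the symbols φ_j / ∑ φ_k and, once more, by a finite smooth partition θ_a on the
support of φ₀ (`exists_partition`). At height t t⋆ a piece is f * ψ_j convolved with a rescaled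
Schwartz kernel of L¹ norm at most a constant times e^{-γ‖w_j t‖²} (`eLpNorm_part_le`,
`exists_lintegral_enorm_laplaceInt_le`). The decoupling hypothesis is then applied not to the pieces
but to their dilates by W = c t. A dilation multiplies all L^p norms by one common factor, so it
costs nothing. It moves the j-th frequency near some ξ_k with w_k comparable to c w_j t, so the
weight (Q*)^{-μ}(ξ_k) turns into mon(-2μ)(w_j t). The growth e^{δ(ξ_k|e)} = e^{δ‖w_k‖²} is absorbed
by the Gaussian once c is small. The second partition makes each dilated piece small enough to lie
in a single ball B_2(ξ_k) (`exists_near`).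

It remains to raise this to the power q and integrate in t. For q ≤ s the power q/s is subadditive;
for q > s Hölder's inequality is used with a weight just above the summability threshold α_i > n_i
(`exists_rpow_tsum_le`, `exists_tsum_mon_exp_le`). The integral of each term over H is a constant
multiple of mon(-2ν)(w_j) = (Q*)^{-ν}(ξ_j) by left translation (`exists_lintegral_mon_exp_le`), and
these are the weights of the Besov norm.

The invariant distance enters only through two facts: points at bounded distance differ by a bounded
element of H (`mul_inv_mem_bddH_of_invDist_lt`), and elements of H close to 1 move points by a small
distance (`exists_ball_radius`). Membership in the Bergman space follows separately, from the rapid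
decay of Laplace integrals of Schwartz functions (`mixedNorm_opC_lt_top`). -/

/-- The projection of `U` onto the component `U i j`. -/
def pr (i j : Fin r) : U →ₗ[ℝ] U := A.mul (A.c i) ∘ₗ A.mul.flip (A.c j)

theorem pr_apply (i j : Fin r) (x : U) : A.pr i j x = A.mul (A.c i) (A.mul x (A.c j)) := rfl

theorem linearMap_ext {W : Type*} [AddCommGroup W] [Module ℝ W] {f g : U →ₗ[ℝ] W}
    (h : ∀ i j, ∀ x ∈ A.comp i j, f x = g x) : f = g := by
  have htop := A.isInternal.submodule_iSup_eq_top
  ext x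
  have hx : x ∈ ⨆ ij : Fin r × Fin r, A.comp ij.1 ij.2 := by rw [htop]; trivial
  induction hx using Submodule.iSup_induction' with
  | mem ij x hx => exact h _ _ x hx
  | zero => simp
  | add x y _ _ hx hy => simp [hx, hy]

theorem c_mul_ite {i k l : Fin r} {x : U} (hx : x ∈ A.comp k l) :
    A.mul (A.c i) x = if k = i then x else 0 := by
  split_ifs with h
  · subst h; exact A.c_mul hx
  · exact A.mul_eq_zero (fun h' => h h'.symm) (A.c_mem i) hx

theorem mul_c_ite {i k l : Fin r} {x : U} (hx : x ∈ A.comp k l) :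
    A.mul x (A.c i) = if l = i then x else 0 := by
  split_ifs with h
  · subst h; exact A.mul_c hx
  · exact A.mul_eq_zero h hx (A.c_mem i)

theorem pr_of_mem {i j k l : Fin r} {x : U} (hx : x ∈ A.comp k l) :
    A.pr i j x = if k = i ∧ l = j then x else 0 := by
  rw [pr_apply, A.mul_c_ite hx]
  by_cases h : l = j
  · simp [h, A.c_mul_ite hx]
  · simp [h]

theorem pr_self {i j : Fin r} {x : U} (hx : x ∈ A.comp i j) : A.pr i j x = x := by
  simp [A.pr_of_mem hx]

theorem sum_pr (x : U) : ∑ i, ∑ j, A.pr i j x = x := by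
  have : (∑ i, ∑ j, A.pr i j) = LinearMap.id := by
    refine A.linearMap_ext fun k l x hx => ?_
    simp only [LinearMap.sum_apply, A.pr_of_mem hx, LinearMap.id_apply]
    rw [Finset.sum_eq_single k, Finset.sum_eq_single l] <;> simp +contextual [eq_comm]
  simpa using LinearMap.congr_fun this x

theorem pr_mem (i j : Fin r) (x : U) : A.pr i j x ∈ A.comp i j := by
  have hx : x ∈ ⨆ ij : Fin r × Fin r, A.comp ij.1 ij.2 := by
    rw [A.isInternal.submodule_iSup_eq_top]; trivial
  induction hx using Submodule.iSup_induction' with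
  | mem ij x hx =>
    rw [A.pr_of_mem hx]
    split_ifs with h
    · rw [← h.1, ← h.2]; exact hx
    · exact zero_mem _
  | zero => simp
  | add x y _ _ hx hy => rw [map_add]; exact add_mem hx hy

theorem pr_pr (i j k l : Fin r) (x : U) :
    A.pr i j (A.pr k l x) = if k = i ∧ l = j then A.pr k l x else 0 :=
  A.pr_of_mem (A.pr_mem k l x)

theorem ext_pr {x y : U} (h : ∀ i j, A.pr i j x = A.pr i j y) : x = y := by
  rw [← A.sum_pr x, ← A.sum_pr y]; simp [h]

theorem pr_star (i j : Fin r) (x : U) : A.pr i j (A.star x) = A.star (A.pr j i x) := by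
  have : A.pr i j ∘ₗ A.star = A.star ∘ₗ A.pr j i := by
    refine A.linearMap_ext fun k l x hx => ?_
    simp only [LinearMap.comp_apply, A.pr_of_mem hx, A.pr_of_mem (A.star_mem hx)]
    by_cases h : k = j ∧ l = i
    · simp [h.1, h.2]
    · rw [if_neg h, if_neg (fun h' => h h'.symm), map_zero]
  exact LinearMap.congr_fun this x

theorem pr_mul (i j : Fin r) (x y : U) :
    A.pr i j (A.mul x y) = ∑ k, A.mul (A.pr i k x) (A.pr k j y) := by
  have : A.mul.compr₂ (A.pr i j) = ∑ k, (A.mul.compl₁₂ (A.pr i k) (A.pr k j)) := by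
    refine A.linearMap_ext fun a b x hx => A.linearMap_ext fun c d y hy => ?_
    simp only [LinearMap.compr₂_apply, LinearMap.sum_apply, LinearMap.compl₁₂_apply,
      A.pr_of_mem hx, A.pr_of_mem hy]
    by_cases hbc : b = c
    · subst hbc
      rw [A.pr_of_mem (A.mul_mem hx hy)]
      rw [Finset.sum_eq_single b]
      · by_cases h1 : a = i <;> by_cases h2 : d = j <;> simp [h1, h2]
      · intro k _ hk; simp [hk.symm]
      · simp
    · rw [A.mul_eq_zero hbc hx hy, map_zero]
      refine (Finset.sum_eq_zero fun k _ => ?_).symm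
      by_cases h1 : b = k
      · have : c ≠ k := fun h => hbc (h1.trans h.symm)
        simp [this]
      · simp [h1]
  simpa using LinearMap.congr_fun₂ this x y

theorem diag_c_ite (i k : Fin r) : A.diag i (A.c k) = if k = i then 1 else 0 := by
  split_ifs with h
  · subst h; exact A.diag_c k
  · exact A.diag_eq_zero (fun h' => h (Prod.ext_iff.1 h').1) (A.c_mem k)

theorem diag_pr (i k l : Fin r) (x : U) :
    A.diag i (A.pr k l x) = if k = i ∧ l = i then A.diag i x else 0 := by
  by_cases h : k = i ∧ l = i
  · obtain ⟨h1, h2⟩ := h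
    subst h1; subst h2
    have : A.diag l ∘ₗ A.pr l l = A.diag l := by
      refine A.linearMap_ext fun a b x hx => ?_
      rw [LinearMap.comp_apply, A.pr_of_mem hx]
      split_ifs with h
      · rfl
      · rw [map_zero, A.diag_eq_zero _ hx]
        exact fun h' => h (by simpa using h')
    simpa using LinearMap.congr_fun this x
  · rw [if_neg h]
    exact A.diag_eq_zero (fun h' => h (by simpa using h')) (A.pr_mem k l x)

theorem pr_diag (i : Fin r) (x : U) : A.pr i i x = A.diag i x • A.c i := by
  have h := A.eq_diag_smul (A.pr_mem i i x)
  rwa [A.diag_pr, if_pos ⟨rfl, rfl⟩] at h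

theorem diag_eq_of_pr {i : Fin r} {x : U} {a : ℝ} (h : A.pr i i x = a • A.c i) :
    A.diag i x = a := by
  have := congrArg (A.diag i) h
  simpa [A.diag_pr, A.diag_c] using this

/-! ### The inner product -/

theorem inner_c (x : U) (i : Fin r) : inner ℝ x (A.c i) = A.diag i x := by
  rw [A.inner_eq, A.star_c, StarMatrixAlgebra.tr]
  have h : ∀ k, A.diag k (A.mul x (A.c i)) = if k = i then A.diag i x else 0 := by
    intro k
    have : A.diag k ∘ₗ A.mul.flip (A.c i) = (if k = i then A.diag i else 0) := by
      refine A.linearMap_ext fun a b x hx => ?_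
      simp only [LinearMap.comp_apply, LinearMap.flip_apply, A.mul_c_ite hx]
      by_cases hb : b = i
      · subst hb
        by_cases hk : k = b
        · simp [hk]
        · simp only [hk, if_true, if_false]
          exact A.diag_eq_zero (by simp; intro _ h; exact hk h.symm) hx
      · simp only [hb, if_false, map_zero]
        split_ifs with hk
        · subst hk; exact (A.diag_eq_zero (by simp; intro _; exact hb) hx).symm
        · rfl
    have := LinearMap.congr_fun this x
    simp only [LinearMap.comp_apply, LinearMap.flip_apply] at this
    rw [this]; split_ifs <;> rfl
  simp [h]

theorem norm_c (i : Fin r) : ‖A.c i‖ = 1 := by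
  have : ‖A.c i‖ ^ 2 = 1 := by
    rw [← real_inner_self_eq_norm_sq, A.inner_c, A.diag_c]
  nlinarith [norm_nonneg (A.c i)]

theorem abs_diag_le (i : Fin r) (x : U) : |A.diag i x| ≤ ‖x‖ := by
  rw [← A.inner_c]
  simpa [A.norm_c] using abs_real_inner_le_norm x (A.c i)

theorem norm_star (x : U) : ‖A.star x‖ = ‖x‖ := by
  have : ‖A.star x‖ ^ 2 = ‖x‖ ^ 2 := by
    rw [← real_inner_self_eq_norm_sq, ← real_inner_self_eq_norm_sq, A.inner_eq, A.inner_eq,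
      A.star_star, A.tr_mul_comm]
  exact (pow_left_inj₀ (norm_nonneg _) (norm_nonneg _) two_ne_zero).1 this

/-! ### Upper triangular elements -/

theorem mem_upper_iff {x : U} : x ∈ A.upper ↔ ∀ i j, j < i → A.pr i j x = 0 := by
  constructor
  · intro hx i j hij
    have : A.upper ≤ LinearMap.ker (A.pr i j) := by
      refine iSup_le fun k => iSup_le fun l => iSup_le fun hkl x hx => ?_
      rw [LinearMap.mem_ker, A.pr_of_mem hx, if_neg]
      rintro ⟨rfl, rfl⟩
      exact absurd hij (not_lt.2 hkl)
    exact this hx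
  · intro h
    rw [← A.sum_pr x]
    refine sum_mem fun i _ => sum_mem fun j _ => ?_
    rcases lt_or_ge j i with hij | hij
    · rw [h i j hij]; exact zero_mem _
    · exact Submodule.mem_iSup_of_mem i (Submodule.mem_iSup_of_mem j
        (Submodule.mem_iSup_of_mem hij (A.pr_mem i j x)))

theorem comp_le_upper {i j : Fin r} (h : i ≤ j) : A.comp i j ≤ A.upper :=
  fun _ hx => Submodule.mem_iSup_of_mem i (Submodule.mem_iSup_of_mem j
    (Submodule.mem_iSup_of_mem h hx))

theorem mul_mem_upper {x y : U} (hx : x ∈ A.upper) (hy : y ∈ A.upper) : A.mul x y ∈ A.upper := by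
  rw [mem_upper_iff] at *
  intro i j hij
  rw [A.pr_mul]
  refine Finset.sum_eq_zero fun k _ => ?_
  rcases lt_or_ge k i with h | h
  · rw [hx i k h]; simp
  · rw [hy k j (hij.trans_le h)]; simp

theorem sum_c_mul (x : U) : A.mul (∑ i, A.c i) x = x := by
  have : A.mul (∑ i, A.c i) = LinearMap.id := by
    refine A.linearMap_ext fun k l x hx => ?_
    simp [map_sum, LinearMap.sum_apply, A.c_mul_ite hx]
  exact LinearMap.congr_fun this x

theorem mul_sum_c (x : U) : A.mul x (∑ i, A.c i) = x := by
  have : A.mul.flip (∑ i, A.c i) = LinearMap.id := by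
    refine A.linearMap_ext fun k l x hx => ?_
    simp [map_sum, A.mul_c_ite hx]
  exact LinearMap.congr_fun this x

/-- The algebra of upper triangular elements, as a type. -/
def Up : Type _ := A.upper

instance : NormedAddCommGroup A.Up := inferInstanceAs (NormedAddCommGroup A.upper)
instance : InnerProductSpace ℝ A.Up := inferInstanceAs (InnerProductSpace ℝ A.upper)
instance [FiniteDimensional ℝ U] : FiniteDimensional ℝ A.Up :=
  inferInstanceAs (FiniteDimensional ℝ A.upper)
instance : MeasurableSpace A.Up := borel A.Up
instance : BorelSpace A.Up := ⟨rfl⟩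

/-- The inclusion of the upper triangular elements in `U`. -/
def upIncl : A.Up →ₗ[ℝ] U := A.upper.subtype

theorem upIncl_mem (t : A.Up) : A.upIncl t ∈ A.upper := t.2

theorem upIncl_injective : Function.Injective A.upIncl := Subtype.val_injective

variable {A} in
theorem Up.ext {s t : A.Up} (h : A.upIncl s = A.upIncl t) : s = t := A.upIncl_injective h

/-- An upper triangular element of `U`, as an element of `A.Up`. -/
def mkUp (x : U) (hx : x ∈ A.upper) : A.Up := (⟨x, hx⟩ : A.upper)

@[simp] theorem upIncl_mkUp (x : U) (hx : x ∈ A.upper) : A.upIncl (A.mkUp x hx) = x := rfl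

theorem norm_upIncl (t : A.Up) : ‖A.upIncl t‖ = ‖t‖ := rfl

theorem inner_upIncl (s t : A.Up) : inner ℝ (A.upIncl s) (A.upIncl t) = inner ℝ s t := rfl

theorem incl_injective : Function.Injective A.incl := Subtype.val_injective

variable {A} in
theorem V.ext {x y : A.V} (h : A.incl x = A.incl y) : x = y := A.incl_injective h

theorem star_incl (x : A.V) : A.star (A.incl x) = A.incl x := x.2

/-- A Hermitian element of `U`, as an element of `A.V`. -/
def mkV (x : U) (hx : A.star x = x) : A.V := (⟨x, hx⟩ : A.herm)

@[simp] theorem incl_mkV (x : U) (hx : A.star x = x) : A.incl (A.mkV x hx) = x := rfl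

theorem norm_incl (x : A.V) : ‖A.incl x‖ = ‖x‖ := rfl

theorem inner_incl (x y : A.V) : inner ℝ (A.incl x) (A.incl y) = inner ℝ x y := rfl

theorem incl_e : A.incl A.e = ∑ i, A.c i := rfl

theorem sum_c_mem_upper : ∑ i, A.c i ∈ A.upper :=
  sum_mem fun i _ => A.comp_le_upper le_rfl (A.c_mem i)

instance : Mul A.Up := ⟨fun s t => A.mkUp _ (A.mul_mem_upper (A.upIncl_mem s) (A.upIncl_mem t))⟩
instance : One A.Up := ⟨A.mkUp _ A.sum_c_mem_upper⟩

theorem upIncl_mul (s t : A.Up) : A.upIncl (s * t) = A.mul (A.upIncl s) (A.upIncl t) := rfl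
theorem upIncl_one : A.upIncl 1 = ∑ i, A.c i := rfl

instance : Ring A.Up where
  __ := (inferInstance : AddCommGroup A.Up)
  mul_assoc a b c := Up.ext (A.upper_assoc _ a.2 _ b.2 _ c.2).symm
  one_mul a := Up.ext (A.sum_c_mul _)
  mul_one a := Up.ext (A.mul_sum_c _)
  left_distrib a b c := Up.ext (map_add (A.mul (A.upIncl a)) _ _)
  right_distrib a b c := Up.ext (LinearMap.map_add₂ A.mul _ _ _)
  zero_mul a := Up.ext (LinearMap.map_zero₂ A.mul _)
  mul_zero a := Up.ext (map_zero (A.mul (A.upIncl a)))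

instance : IsScalarTower ℝ A.Up A.Up := ⟨fun a s t => Up.ext (by
  simp only [smul_eq_mul, upIncl_mul, map_smul, LinearMap.smul_apply])⟩
instance : SMulCommClass ℝ A.Up A.Up := ⟨fun a s t => Up.ext (by
  simp only [smul_eq_mul, upIncl_mul, map_smul])⟩

/-- The diagonal coefficient of an upper triangular element. -/
def dg (i : Fin r) : A.Up →ₗ[ℝ] ℝ := A.diag i ∘ₗ A.upIncl

theorem dg_apply (i : Fin r) (t : A.Up) : A.dg i t = A.diag i (A.upIncl t) := rfl

theorem pr_upIncl_of_lt {i j : Fin r} (h : j < i) (t : A.Up) : A.pr i j (A.upIncl t) = 0 :=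
  A.mem_upper_iff.1 t.2 i j h

theorem pr_upIncl_diag (i : Fin r) (t : A.Up) : A.pr i i (A.upIncl t) = A.dg i t • A.c i :=
  A.pr_diag i _

theorem dg_mul (i : Fin r) (s t : A.Up) : A.dg i (s * t) = A.dg i s * A.dg i t := by
  refine A.diag_eq_of_pr ?_
  rw [upIncl_mul, pr_mul, Finset.sum_eq_single i]
  · rw [pr_upIncl_diag, pr_upIncl_diag, map_smul, LinearMap.map_smul₂, A.c_mul_c, smul_smul,
      mul_comm]
  · intro k _ hk
    rcases lt_or_gt_of_ne hk with h | h
    · rw [A.pr_upIncl_of_lt h]; simp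
    · rw [A.pr_upIncl_of_lt h t]; simp
  · simp

theorem dg_one (i : Fin r) : A.dg i 1 = 1 := by
  simp [dg_apply, upIncl_one, map_sum, A.diag_c_ite]

theorem abs_dg_le (i : Fin r) (t : A.Up) : |A.dg i t| ≤ ‖t‖ := A.abs_diag_le i _

theorem norm_one_sq : ‖(1 : A.Up)‖ ^ 2 = r := by
  rw [← real_inner_self_eq_norm_sq, ← A.inner_upIncl, upIncl_one, inner_sum]
  simp only [A.inner_c, map_sum, A.diag_c_ite]
  simp

theorem inner_one (t : A.Up) : inner ℝ t (1 : A.Up) = ∑ i, A.dg i t := by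
  rw [← A.inner_upIncl, upIncl_one, inner_sum]
  simp [A.inner_c, dg_apply]

end TAlgebra

end

open MeasureTheory Set
open scoped ENNReal NNReal SchwartzMap

set_option linter.unusedSectionVars false

noncomputable section

namespace TAlgebra

variable {r : ℕ} {U : Type*} [NormedAddCommGroup U] [InnerProductSpace ℝ U] (A : TAlgebra r U)

/-! ### The quadratic maps `t ↦ t t⋆` and `t ↦ t⋆ t` -/

/-- The map `t ↦ t t⋆`. -/
def sq (t : A.Up) : A.V :=
  A.mkV (A.mul (A.upIncl t) (A.star (A.upIncl t))) (by rw [A.star_mul, A.star_star])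

/-- The map `t ↦ t⋆ t`. -/
def sqs (t : A.Up) : A.V :=
  A.mkV (A.mul (A.star (A.upIncl t)) (A.upIncl t)) (by rw [A.star_mul, A.star_star])

theorem incl_sq (t : A.Up) :
    A.incl (A.sq t) = A.mul (A.upIncl t) (A.star (A.upIncl t)) := rfl
theorem incl_sqs (t : A.Up) :
    A.incl (A.sqs t) = A.mul (A.star (A.upIncl t)) (A.upIncl t) := rfl

theorem star_sum_c : A.star (∑ i, A.c i) = ∑ i, A.c i := by simp [A.star_c]

theorem sq_one : A.sq 1 = A.e := V.ext (by
  rw [incl_sq, upIncl_one, star_sum_c, sum_c_mul, incl_e])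

theorem sqs_one : A.sqs 1 = A.e := V.ext (by
  rw [incl_sqs, upIncl_one, star_sum_c, sum_c_mul, incl_e])

theorem sq_smul (a : ℝ) (t : A.Up) : A.sq (a • t) = a ^ 2 • A.sq t := V.ext (by
  simp [incl_sq, smul_smul, pow_two])

theorem mul_sq (t u : A.Up) : A.mul (A.upIncl t) (A.incl (A.sq u)) =
    A.mul (A.upIncl (t * u)) (A.star (A.upIncl u)) :=
  A.upper_mul_star _ t.2 _ u.2

theorem sq_mul_star (t u : A.Up) : A.mul (A.incl (A.sq u)) (A.star (A.upIncl t)) =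
    A.mul (A.upIncl u) (A.star (A.upIncl (t * u))) := by
  have h := congrArg A.star (A.mul_sq t u)
  rwa [A.star_mul, A.star_incl, A.star_mul, A.star_star] at h

/-- Polarisation of the T-algebra axiom behind `mul_sq`. For two different elements only the
symmetrised product may be reassociated. -/
theorem mul_polar (t u v : A.Up) :
    A.mul (A.upIncl t) (A.mul (A.upIncl u) (A.star (A.upIncl v))
      + A.mul (A.upIncl v) (A.star (A.upIncl u))) =
    A.mul (A.upIncl (t * u)) (A.star (A.upIncl v)) +
      A.mul (A.upIncl (t * v)) (A.star (A.upIncl u)) := by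
  have h := A.mul_sq t (u + v)
  have h1 := A.mul_sq t u
  have h2 := A.mul_sq t v
  simp only [incl_sq, upIncl_mul, map_add, LinearMap.add_apply] at h h1 h2 ⊢
  rw [h1, h2] at h
  have := congrArg (fun z => z - A.mul (A.mul (A.upIncl t) (A.upIncl u)) (A.star (A.upIncl u)) -
    A.mul (A.mul (A.upIncl t) (A.upIncl v)) (A.star (A.upIncl v))) h
  convert this using 1 <;> abel

/-- The linear map `u u⋆ ↦ (w u) (u⋆ w⋆)` on `U`. -/
def piU (w : A.Up) : U →ₗ[ℝ] U :=
  A.mul (A.upIncl w) ∘ₗ (A.mul.flip (A.star (A.upIncl w)) + A.mul (A.upIncl w)) -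
    A.mul (A.upIncl (w * w))

theorem piU_apply (w : A.Up) (x : U) : A.piU w x =
    A.mul (A.upIncl w) (A.mul x (A.star (A.upIncl w)) + A.mul (A.upIncl w) x) -
      A.mul (A.upIncl (w * w)) x := rfl

/-- The shape of `piU` comes from the lack of associativity. For x = u u⋆ one has x w⋆ = u (w u)⋆
and w x = (w u) u⋆, so `mul_polar` for the pair u, w u applies to their sum. It produces (w u)(w u)⋆
plus the term (w w) x that `piU` subtracts. -/
theorem piU_sq (w u : A.Up) : A.piU w (A.incl (A.sq u)) = A.incl (A.sq (w * u)) := by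
  rw [piU_apply, sq_mul_star, mul_sq, mul_polar, mul_sq, mul_assoc, add_sub_cancel_right, incl_sq]

theorem add_star_eq (a : A.Up) : A.upIncl a + A.star (A.upIncl a) =
    A.incl (A.sq (1 + a)) - A.incl (A.sq 1) - A.incl (A.sq a) := by
  have h1 : A.mul (A.upIncl 1) (A.star (A.upIncl a)) = A.star (A.upIncl a) := A.sum_c_mul _
  have h2 : A.mul (A.upIncl a) (A.star (A.upIncl 1)) = A.upIncl a := by
    rw [upIncl_one, star_sum_c, mul_sum_c]
  simp only [incl_sq, map_add, LinearMap.add_apply, h1, h2]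
  abel

/-- The map `h ↦ h + h⋆`. -/
def symL : A.Up →ₗ[ℝ] A.V where
  toFun a := A.mkV (A.upIncl a + A.star (A.upIncl a)) (by rw [map_add, A.star_star, add_comm])
  map_add' a b := V.ext (by simp only [incl_mkV, map_add]; abel)
  map_smul' a b := V.ext (by simp only [incl_mkV, map_smul, smul_add, RingHom.id_apply])

theorem incl_symL (a : A.Up) : A.incl (A.symL a) = A.upIncl a + A.star (A.upIncl a) := rfl

theorem symL_injective : Function.Injective A.symL := by
  rw [← LinearMap.ker_eq_bot, LinearMap.ker_eq_bot']
  intro a ha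
  have ha' : A.upIncl a + A.star (A.upIncl a) = 0 := by
    rw [← incl_symL, ha, map_zero]
  refine Up.ext (A.ext_pr fun i j => ?_)
  have h := congrArg (A.pr i j) ha'
  rw [map_add, pr_star, map_zero] at h
  rw [map_zero, map_zero]
  rcases lt_trichotomy i j with hij | rfl | hij
  · rwa [A.pr_upIncl_of_lt hij, map_zero, add_zero] at h
  · rw [pr_upIncl_diag, map_smul, A.star_c, ← two_smul ℝ] at h
    rw [pr_upIncl_diag]
    exact (smul_eq_zero.1 h).resolve_left two_ne_zero
  · exact A.pr_upIncl_of_lt hij a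

theorem symL_surjective : Function.Surjective A.symL := by
  intro x
  -- The upper half of x, with the diagonal halved because a + a⋆ counts it twice.
  let a : U := ∑ i, ∑ j, if i < j then A.pr i j (A.incl x) else
    if i = j then (1 / 2 : ℝ) • A.pr i j (A.incl x) else 0
  have ha : a ∈ A.upper := by
    refine sum_mem fun i _ => sum_mem fun j _ => ?_
    split_ifs with h1 h2
    · exact A.comp_le_upper h1.le (A.pr_mem i j _)
    · exact Submodule.smul_mem _ _ (A.comp_le_upper h2.le (A.pr_mem i j _))
    · exact zero_mem _
  refine ⟨A.mkUp a ha, V.ext ?_⟩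
  rw [incl_symL, upIncl_mkUp]
  have hs : A.star a = ∑ i, ∑ j, if j < i then A.pr i j (A.incl x) else
    if i = j then (1 / 2 : ℝ) • A.pr i j (A.incl x) else 0 := by
    rw [Finset.sum_comm]
    simp only [a, map_sum]
    refine Finset.sum_congr rfl fun i _ => Finset.sum_congr rfl fun j _ => ?_
    have h : A.star (A.pr i j (A.incl x)) = A.pr j i (A.incl x) := by
      rw [← pr_star, star_incl]
    rcases lt_trichotomy i j with h' | h' | h'
    · simp [h', h]
    · subst h'
      simp [h]
    · simp [h'.not_gt, h'.ne, h'.ne']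
  rw [hs, ← Finset.sum_add_distrib]
  simp only [← Finset.sum_add_distrib]
  conv_rhs => rw [← A.sum_pr (A.incl x)]
  refine Finset.sum_congr rfl fun i _ => Finset.sum_congr rfl fun j _ => ?_
  rcases lt_trichotomy i j with h | h | h
  · simp [h, h.not_gt, h.ne]
  · subst h
    simp only [lt_irrefl, if_false, if_true, ← add_smul]; norm_num
  · simp [h, h.not_gt, h.ne']

theorem symL_eq (a : A.Up) : A.symL a = A.sq (1 + a) - A.sq 1 - A.sq a :=
  V.ext (by rw [incl_symL, add_star_eq, map_sub, map_sub])

/-- Polarising at the unit, a + a⋆ = (1+a)(1+a)⋆ - 1 - a a⋆, and such elements exhaust V. Hence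
linear identities on V need only be checked on squares. -/
theorem span_range_sq : Submodule.span ℝ (range A.sq) = ⊤ := by
  rw [eq_top_iff]
  intro x _
  obtain ⟨a, rfl⟩ := A.symL_surjective x
  rw [symL_eq]
  exact sub_mem (sub_mem (Submodule.subset_span ⟨_, rfl⟩) (Submodule.subset_span ⟨_, rfl⟩))
    (Submodule.subset_span ⟨_, rfl⟩)

theorem star_piU (w : A.Up) (x : A.V) : A.star (A.piU w (A.incl x)) = A.piU w (A.incl x) := by
  have hx : x ∈ Submodule.span ℝ (range A.sq) := by rw [span_range_sq]; trivial
  induction hx using Submodule.span_induction with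
  | mem x hx => obtain ⟨u, rfl⟩ := hx; rw [piU_sq, star_incl]
  | zero => simp
  | add x y _ _ hx hy => simp only [map_add, hx, hy]
  | smul a x _ hx => simp only [map_smul, hx]

/-- The linear map `u u⋆ ↦ (w u) (u⋆ w⋆)` on `V`. -/
def piL (w : A.Up) : A.V →ₗ[ℝ] A.V where
  toFun x := A.mkV (A.piU w (A.incl x)) (A.star_piU w x)
  map_add' x y := V.ext (by simp only [incl_mkV, map_add])
  map_smul' a x := V.ext (by simp only [incl_mkV, map_smul, RingHom.id_apply])

theorem incl_piL (w : A.Up) (x : A.V) : A.incl (A.piL w x) = A.piU w (A.incl x) := rfl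

theorem piL_sq (w u : A.Up) : A.piL w (A.sq u) = A.sq (w * u) :=
  V.ext (by rw [incl_piL, piU_sq])

theorem linearMap_ext_sq {W : Type*} [AddCommGroup W] [Module ℝ W] {f g : A.V →ₗ[ℝ] W}
    (h : ∀ t, f (A.sq t) = g (A.sq t)) : f = g :=
  LinearMap.ext_on A.span_range_sq (by rintro _ ⟨t, rfl⟩; exact h t)

theorem piL_mul (v w : A.Up) : A.piL (v * w) = A.piL v ∘ₗ A.piL w :=
  A.linearMap_ext_sq fun t => by simp only [LinearMap.comp_apply, piL_sq, mul_assoc]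

theorem piL_one : A.piL 1 = LinearMap.id :=
  A.linearMap_ext_sq fun t => by simp only [LinearMap.id_apply, piL_sq, one_mul]

/-- The trace is cyclic and associative even though the product is not, so tr(s s⋆ · t⋆ t) = tr((t
s)(t s)⋆). This identity turns all later pairings into norms of products in an associative algebra.
-/
theorem inner_sq_sqs (s t : A.Up) : inner ℝ (A.sq s) (A.sqs t) = ‖t * s‖ ^ 2 := by
  rw [← A.inner_incl, A.inner_eq, star_incl, incl_sqs, A.tr_mul_assoc, A.tr_mul_comm,
    sq_mul_star, A.tr_mul_assoc, ← A.norm_upIncl, ← real_inner_self_eq_norm_sq, A.inner_eq]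
  rfl

/-! ### The group `H` -/

/-- Back substitution from the last row upwards: the (i, j) entry of t u is t_ii u_ij plus terms
involving only rows k > i of u. -/
theorem eq_zero_of_mul_eq_zero {t u : A.Up} (ht : ∀ i, A.dg i t ≠ 0) (h : t * u = 0) : u = 0 := by
  have key : ∀ i j, A.pr i j (A.upIncl u) = 0 := by
    intro i
    induction i using (wellFounded_gt (α := Fin r)).induction with
    | _ i ih =>
      intro j
      have h' : A.pr i j (A.upIncl (t * u)) = 0 := by rw [h, map_zero, map_zero]
      rw [upIncl_mul, pr_mul, Finset.sum_eq_single i] at h'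
      · rw [pr_upIncl_diag, LinearMap.map_smul₂, A.c_mul (A.pr_mem i j _)] at h'
        exact (smul_eq_zero.1 h').resolve_left (ht i)
      · intro k _ hk
        rcases lt_or_gt_of_ne hk with hlt | hgt
        · rw [A.pr_upIncl_of_lt hlt, LinearMap.map_zero₂]
        · rw [ih k hgt, map_zero]
      · simp
  exact Up.ext (A.ext_pr fun i j => by rw [key, map_zero, map_zero])

/-- Left multiplication on the upper triangular elements. -/
def mulL (t : A.Up) : A.Up →ₗ[ℝ] A.Up := LinearMap.mulLeft ℝ t

/-- Right multiplication on the upper triangular elements. -/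
def mulR (t : A.Up) : A.Up →ₗ[ℝ] A.Up := LinearMap.mulRight ℝ t

@[simp] theorem mulL_apply (t u : A.Up) : A.mulL t u = t * u := rfl
@[simp] theorem mulR_apply (t u : A.Up) : A.mulR t u = u * t := rfl

section

variable [FiniteDimensional ℝ U]

theorem exists_right_inv {t : A.Up} (ht : ∀ i, 0 < A.dg i t) :
    ∃ u : A.Up, (∀ i, 0 < A.dg i u) ∧ t * u = 1 := by
  have hinj : Function.Injective (A.mulL t) := by
    rw [← LinearMap.ker_eq_bot, LinearMap.ker_eq_bot']
    exact fun u hu => A.eq_zero_of_mul_eq_zero (fun i => (ht i).ne') hu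
  obtain ⟨u, hu⟩ := LinearMap.injective_iff_surjective.1 hinj 1
  refine ⟨u, fun i => ?_, hu⟩
  have h : A.dg i t * A.dg i u = 1 := by rw [← dg_mul, ← A.dg_one i]; exact congrArg _ hu
  by_contra hneg
  nlinarith [ht i, mul_nonneg (ht i).le (neg_nonneg.2 (not_lt.1 hneg))]

end

/-- The group of upper triangular elements with positive diagonal, as a type. -/
def Hg : Type _ := {t : A.Up // ∀ i, 0 < A.dg i t}

instance : Coe A.Hg A.Up := ⟨Subtype.val⟩

theorem Hg.pos {A : TAlgebra r U} (t : A.Hg) (i : Fin r) : 0 < A.dg i (t : A.Up) := t.2 i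

theorem Hg.ext {A : TAlgebra r U} {s t : A.Hg} (h : (s : A.Up) = t) : s = t := Subtype.ext h

section

variable [FiniteDimensional ℝ U]

instance : Group A.Hg where
  mul s t := ⟨(s : A.Up) * t, fun i => by rw [dg_mul]; exact mul_pos (s.2 i) (t.2 i)⟩
  mul_assoc a b c := Subtype.ext (mul_assoc a.1 b.1 c.1)
  one := ⟨1, fun i => by rw [dg_one]; exact one_pos⟩
  one_mul a := Subtype.ext (one_mul a.1)
  mul_one a := Subtype.ext (mul_one a.1)
  inv t := ⟨(A.exists_right_inv t.2).choose, (A.exists_right_inv t.2).choose_spec.1⟩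
  inv_mul_cancel t := by
    obtain ⟨hu, htu⟩ := (A.exists_right_inv t.2).choose_spec
    set u := (A.exists_right_inv t.2).choose
    obtain ⟨v, hv, huv⟩ := A.exists_right_inv hu
    -- By associativity t equals the right inverse of its own right inverse u, so u is a left
    -- inverse too.
    have : t.1 = v := by rw [← mul_one t.1, ← huv, ← mul_assoc, htu, one_mul]
    refine Subtype.ext ?_
    change u * t.1 = 1
    rw [this, huv]

@[simp] theorem Hg.coe_mul (s t : A.Hg) : ((s * t : A.Hg) : A.Up) = (s : A.Up) * t := rfl
@[simp] theorem Hg.coe_one : ((1 : A.Hg) : A.Up) = 1 := rfl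
theorem Hg.coe_mul_inv (t : A.Hg) : (t : A.Up) * (t⁻¹ : A.Hg) = 1 := by
  rw [← Hg.coe_mul, mul_inv_cancel, Hg.coe_one]
theorem Hg.coe_inv_mul (t : A.Hg) : ((t⁻¹ : A.Hg) : A.Up) * t = 1 := by
  rw [← Hg.coe_mul, inv_mul_cancel, Hg.coe_one]

theorem Hg.dg_inv {A : TAlgebra r U} (t : A.Hg) (i : Fin r) :
    A.dg i (t⁻¹ : A.Hg) = (A.dg i (t : A.Up))⁻¹ := by
  refine eq_inv_of_mul_eq_one_left ?_
  rw [← dg_mul, Hg.coe_inv_mul, dg_one]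

/-- The linear automorphism `u u⋆ ↦ (w u) (u⋆ w⋆)` of `V`. -/
def piE (w : A.Hg) : A.V ≃L[ℝ] A.V :=
  LinearEquiv.toContinuousLinearEquiv
    (LinearEquiv.ofLinearMap (A.piL w) (A.piL (w⁻¹ : A.Hg))
      (by rw [← piL_mul, Hg.coe_mul_inv, piL_one]) (by rw [← piL_mul, Hg.coe_inv_mul, piL_one]))

theorem piE_apply (w : A.Hg) (x : A.V) : A.piE w x = A.piL w x := rfl

theorem piE_sq (w : A.Hg) (u : A.Up) : A.piE w (A.sq u) = A.sq (w * u) := A.piL_sq _ _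

/-- The linear map `u⋆ u ↦ (w⋆ u⋆) (u w)` on `V`. -/
def PL (w : A.Up) : A.V →ₗ[ℝ] A.V := LinearMap.adjoint (A.piL w)

theorem inner_PL (w : A.Up) (x ξ : A.V) : inner ℝ x (A.PL w ξ) = inner ℝ (A.piL w x) ξ :=
  LinearMap.adjoint_inner_right _ _ _

theorem ext_inner_sq {ξ η : A.V} (h : ∀ s, inner ℝ (A.sq s) ξ = inner ℝ (A.sq s) η) : ξ = η := by
  have h2 : innerₗ A.V ξ = innerₗ A.V η := A.linearMap_ext_sq fun t => by
    simp only [innerₗ_apply_apply, real_inner_comm _ ξ, real_inner_comm _ η, h]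
  exact ext_inner_left ℝ fun v => by
    have := LinearMap.congr_fun h2 v
    simpa only [innerₗ_apply_apply, real_inner_comm v] using this

/-- Tested against the spanning squares s s⋆, both sides equal ‖u w s‖². -/
theorem PL_sqs (w u : A.Up) : A.PL w (A.sqs u) = A.sqs (u * w) :=
  A.ext_inner_sq fun s => by
    rw [inner_PL, piL_sq, inner_sq_sqs, inner_sq_sqs, mul_assoc]

theorem PL_mul (v w : A.Up) : A.PL (v * w) = A.PL w ∘ₗ A.PL v := by
  rw [PL, piL_mul, LinearMap.adjoint_comp]; rfl

theorem PL_one : A.PL 1 = LinearMap.id := by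
  rw [PL, piL_one, LinearMap.adjoint_id]

/-- The linear automorphism `u⋆ u ↦ (w⋆ u⋆) (u w)` of `V`. -/
def PE (w : A.Hg) : A.V ≃L[ℝ] A.V :=
  LinearEquiv.toContinuousLinearEquiv
    (LinearEquiv.ofLinearMap (A.PL w) (A.PL (w⁻¹ : A.Hg))
      (by rw [← PL_mul, Hg.coe_inv_mul, PL_one]) (by rw [← PL_mul, Hg.coe_mul_inv, PL_one]))

theorem PE_apply (w : A.Hg) (x : A.V) : A.PE w x = A.PL w x := rfl
theorem PE_symm (w : A.Hg) : (A.PE w).symm = A.PE w⁻¹ := by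
  ext x
  have h : A.PL ((w⁻¹)⁻¹ : A.Hg) = A.PL w := by rw [inv_inv]
  rfl

theorem PE_sqs (w : A.Hg) (u : A.Up) : A.PE w (A.sqs u) = A.sqs (u * w) := A.PL_sqs _ _

theorem PE_e (w : A.Hg) : A.PE w A.e = A.sqs w := by rw [← sqs_one, PE_sqs, one_mul]

theorem PE_one (x : A.V) : A.PE 1 x = x := by
  rw [PE_apply, Hg.coe_one, PL_one]; rfl

theorem PE_mul (v w : A.Hg) (x : A.V) : A.PE (v * w) x = A.PE w (A.PE v x) := by
  rw [PE_apply, Hg.coe_mul, PL_mul]; rfl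

theorem inner_PE (w : A.Hg) (x ξ : A.V) : inner ℝ x (A.PE w ξ) = inner ℝ (A.piE w x) ξ :=
  A.inner_PL _ _ _

/-- Expanding, ‖v - 1‖² + ‖v⁻¹ - 1‖² = ‖v‖² + ‖v⁻¹‖² + 2r - 2∑(v_ii + 1/v_ii), which is at most 0
because a + 1/a ≥ 2. This gives uniqueness of the triangular factorisations, since t t⋆ = e or t⋆ t
= e fixes ‖t‖² = r. -/
theorem Hg.eq_one {A : TAlgebra r U} {v : A.Hg} (h1 : ‖(v : A.Up)‖ ^ 2 ≤ r)
    (h2 : ‖((v⁻¹ : A.Hg) : A.Up)‖ ^ 2 ≤ r) : v = 1 := by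
  have e1 : ‖(v : A.Up) - 1‖ ^ 2 = ‖(v : A.Up)‖ ^ 2 - 2 * ∑ i, A.dg i (v : A.Up) + r := by
    rw [norm_sub_sq_real, inner_one, norm_one_sq]
  have e2 : ‖((v⁻¹ : A.Hg) : A.Up) - 1‖ ^ 2 =
      ‖((v⁻¹ : A.Hg) : A.Up)‖ ^ 2 - 2 * ∑ i, (A.dg i (v : A.Up))⁻¹ + r := by
    rw [norm_sub_sq_real, inner_one, norm_one_sq]
    simp only [Hg.dg_inv]
  have e3 : (2 * r : ℝ) ≤ ∑ i, (A.dg i (v : A.Up) + (A.dg i (v : A.Up))⁻¹) := by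
    have : ∑ i : Fin r, (2 : ℝ) ≤ ∑ i, (A.dg i (v : A.Up) + (A.dg i (v : A.Up))⁻¹) := by
      refine Finset.sum_le_sum fun i _ => ?_
      have h0 := v.pos i
      have : A.dg i (v : A.Up) * (A.dg i (v : A.Up))⁻¹ = 1 := mul_inv_cancel₀ h0.ne'
      nlinarith [sq_nonneg (A.dg i (v : A.Up) - (A.dg i (v : A.Up))⁻¹), inv_pos.2 h0]
    simpa [mul_comm] using this
  rw [Finset.sum_add_distrib] at e3
  have h : ‖(v : A.Up) - 1‖ ^ 2 = 0 := by
    nlinarith [sq_nonneg ‖(v : A.Up) - 1‖, sq_nonneg ‖((v⁻¹ : A.Hg) : A.Up) - 1‖]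
  have h' : (v : A.Up) - 1 = 0 := by simpa using h
  exact Hg.ext (sub_eq_zero.1 h')

theorem norm_sq_eq_inner_sq_e (s : A.Up) : ‖s‖ ^ 2 = inner ℝ (A.sq s) A.e := by
  rw [← sqs_one, inner_sq_sqs, one_mul]

theorem norm_sq_eq_inner_e_sqs (s : A.Up) : ‖s‖ ^ 2 = inner ℝ A.e (A.sqs s) := by
  rw [← sq_one, inner_sq_sqs, mul_one]

theorem inner_e_e : inner ℝ A.e A.e = (r : ℝ) := by
  rw [← A.norm_one_sq, norm_sq_eq_inner_sq_e, sq_one]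

theorem sq_injective_Hg {s t : A.Hg} (h : A.sq s = A.sq t) : s = t := by
  have key : ∀ v : A.Hg, A.sq v = A.e → ‖(v : A.Up)‖ ^ 2 ≤ r := by
    intro v hv
    rw [norm_sq_eq_inner_sq_e, hv, inner_e_e]
  have h1 : A.sq (t⁻¹ * s : A.Hg) = A.e := by
    rw [Hg.coe_mul, ← piE_sq, h, piE_sq, Hg.coe_inv_mul, sq_one]
  have h2 : A.sq ((t⁻¹ * s)⁻¹ : A.Hg) = A.e := by
    rw [mul_inv_rev, inv_inv, Hg.coe_mul, ← piE_sq, ← h, piE_sq, Hg.coe_inv_mul, sq_one]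
  exact (inv_mul_eq_one.1 (Hg.eq_one (key _ h1) (key _ h2))).symm

theorem sqs_injective_Hg {s t : A.Hg} (h : A.sqs s = A.sqs t) : s = t := by
  have key : ∀ v : A.Hg, A.sqs v = A.e → ‖(v : A.Up)‖ ^ 2 ≤ r := by
    intro v hv
    rw [norm_sq_eq_inner_e_sqs, hv, inner_e_e]
  have h1 : A.sqs (s * t⁻¹ : A.Hg) = A.e := by
    rw [Hg.coe_mul, ← PE_sqs, h, PE_sqs, Hg.coe_mul_inv, sqs_one]
  have h2 : A.sqs ((s * t⁻¹)⁻¹ : A.Hg) = A.e := by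
    rw [mul_inv_rev, inv_inv, Hg.coe_mul, ← PE_sqs, ← h, PE_sqs, Hg.coe_mul_inv, sqs_one]
  exact mul_inv_eq_one.1 (Hg.eq_one (key _ h1) (key _ h2))

/-! ### Triangular coordinates for the cone and the compound functions -/

theorem mem_H_iff {x : U} : x ∈ A.H ↔ ∃ t : A.Hg, A.upIncl t = x :=
  ⟨fun h => ⟨⟨A.mkUp x h.1, h.2⟩, rfl⟩, by rintro ⟨t, rfl⟩; exact ⟨t.1.2, t.2⟩⟩

theorem mem_cone_iff {y : A.V} : y ∈ A.cone ↔ ∃ t : A.Hg, A.sq t = y := by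
  constructor
  · rintro ⟨s, hs, h⟩
    obtain ⟨t, rfl⟩ := A.mem_H_iff.1 hs
    exact ⟨t, V.ext h.symm⟩
  · rintro ⟨t, rfl⟩
    exact ⟨_, A.mem_H_iff.2 ⟨t, rfl⟩, rfl⟩

theorem Q_sq (j : Fin r) (t : A.Hg) : A.Q j (A.sq t) = A.dg j (t : A.Up) ^ 2 := by
  have h : ∃ s ∈ A.H, A.incl (A.sq t) = A.mul s (A.star s) := ⟨_, A.mem_H_iff.2 ⟨t, rfl⟩, rfl⟩
  rw [Q, dif_pos h]
  obtain ⟨s, hs⟩ := A.mem_H_iff.1 h.choose_spec.1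
  have h2 := h.choose_spec.2
  rw [← hs] at h2 ⊢
  rw [A.sq_injective_Hg (V.ext h2)]; rfl

theorem Qstar_sqs (j : Fin r) (t : A.Hg) : A.Qstar j (A.sqs t) = A.dg j (t : A.Up) ^ 2 := by
  have h : ∃ s ∈ A.H, A.incl (A.sqs t) = A.mul (A.star s) s := ⟨_, A.mem_H_iff.2 ⟨t, rfl⟩, rfl⟩
  rw [Qstar, dif_pos h]
  obtain ⟨s, hs⟩ := A.mem_H_iff.1 h.choose_spec.1
  have h2 := h.choose_spec.2
  rw [← hs] at h2 ⊢
  rw [A.sqs_injective_Hg (V.ext h2)]; rfl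

/-- The monomial `∏ t_{ii} ^ a_i`. -/
def mon (a : Fin r → ℝ) (t : A.Up) : ℝ := ∏ i, A.dg i t ^ a i

theorem mon_pos (a : Fin r → ℝ) (t : A.Hg) : 0 < A.mon a t :=
  Finset.prod_pos fun i _ => Real.rpow_pos_of_pos (t.pos i) _

theorem mon_mul (a : Fin r → ℝ) (s t : A.Hg) :
    A.mon a ((s : A.Up) * t) = A.mon a s * A.mon a t := by
  simp only [mon, ← Finset.prod_mul_distrib, dg_mul]
  exact Finset.prod_congr rfl fun i _ => Real.mul_rpow (s.pos i).le (t.pos i).le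

theorem mon_add (a b : Fin r → ℝ) (t : A.Hg) :
    A.mon (fun i => a i + b i) t = A.mon a t * A.mon b t := by
  simp only [mon, ← Finset.prod_mul_distrib]
  exact Finset.prod_congr rfl fun i _ => Real.rpow_add (t.pos i) _ _

theorem mon_rpow (a : Fin r → ℝ) (c : ℝ) (t : A.Hg) :
    A.mon a t ^ c = A.mon (fun i => a i * c) t := by
  simp only [mon]
  rw [← Real.finsetProd_rpow _ _ (fun i _ => (Real.rpow_pos_of_pos (t.pos i) _).le)]
  exact Finset.prod_congr rfl fun i _ => (Real.rpow_mul (t.pos i).le _ _).symm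

theorem Qpow_sq (α : Fin r → ℝ) (t : A.Hg) : A.Qpow α (A.sq t) = A.mon (fun i => 2 * α i) t := by
  refine Finset.prod_congr rfl fun i _ => ?_
  rw [Q_sq, Real.rpow_mul (t.pos i).le, Real.rpow_two]

theorem Qstarpow_sqs (α : Fin r → ℝ) (t : A.Hg) :
    A.Qstarpow α (A.sqs t) = A.mon (fun i => 2 * α i) t := by
  refine Finset.prod_congr rfl fun i _ => ?_
  rw [Qstar_sqs, Real.rpow_mul (t.pos i).le, Real.rpow_two]

end

end TAlgebra

end

open MeasureTheory Set
open scoped ENNReal NNReal SchwartzMap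

set_option linter.unusedSectionVars false

noncomputable section

namespace TAlgebra

variable {r : ℕ} {U : Type*} [NormedAddCommGroup U] [InnerProductSpace ℝ U] (A : TAlgebra r U)

variable [FiniteDimensional ℝ U]

open scoped Topology

/-! ### Continuity and differentiability of the quadratic maps -/

/-- The product of `U`, as a continuous bilinear map. -/
def mulCL : U →L[ℝ] U →L[ℝ] U := LinearMap.toContinuousBilinearMap A.mul

/-- A bound for the product of `U`. -/
def cb : ℝ := ‖A.mulCL‖ + 1

theorem one_le_cb : 1 ≤ A.cb := by
  have := norm_nonneg A.mulCL
  unfold cb; linarith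

theorem cb_pos : 0 < A.cb := one_pos.trans_le A.one_le_cb

theorem norm_mul_le_cb (x y : U) : ‖A.mul x y‖ ≤ A.cb * ‖x‖ * ‖y‖ := by
  refine (A.mulCL.le_opNorm₂ x y).trans ?_
  unfold cb
  gcongr
  linarith

theorem norm_upMul_le (s t : A.Up) : ‖s * t‖ ≤ A.cb * ‖s‖ * ‖t‖ := A.norm_mul_le_cb _ _

theorem norm_sqMap_le (s : A.Up) : ‖A.sq s‖ ≤ A.cb * ‖s‖ ^ 2 := by
  rw [← A.norm_incl, incl_sq]
  refine (A.norm_mul_le_cb _ _).trans_eq ?_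
  rw [A.norm_star, A.norm_upIncl]; ring

theorem norm_sqsMap_le (s : A.Up) : ‖A.sqs s‖ ≤ A.cb * ‖s‖ ^ 2 := by
  rw [← A.norm_incl, incl_sqs]
  refine (A.norm_mul_le_cb _ _).trans_eq ?_
  rw [A.norm_star, A.norm_upIncl]; ring

/-- The derivative `h ↦ s h⋆ + h s⋆` of the map `t ↦ t t⋆`, as a bilinear map. -/
def sqB : A.Up →ₗ[ℝ] A.Up →ₗ[ℝ] A.V :=
  LinearMap.mk₂ ℝ (fun s h => A.mkV (A.mul (A.upIncl s) (A.star (A.upIncl h)) +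
      A.mul (A.upIncl h) (A.star (A.upIncl s)))
      (by simp only [map_add, A.star_mul, A.star_star]; abel))
    (fun s t h => V.ext (by simp only [incl_mkV, map_add, LinearMap.add_apply]; abel))
    (fun a s h => V.ext (by simp only [incl_mkV, map_smul, LinearMap.smul_apply, smul_add]))
    (fun s t h => V.ext (by simp only [incl_mkV, map_add, LinearMap.add_apply]; abel))
    (fun a s h => V.ext (by simp only [incl_mkV, map_smul, LinearMap.smul_apply, smul_add]))

/-- The derivative `h ↦ s⋆ h + h⋆ s` of the map `t ↦ t⋆ t`, as a bilinear map. -/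
def sqsB : A.Up →ₗ[ℝ] A.Up →ₗ[ℝ] A.V :=
  LinearMap.mk₂ ℝ (fun s h => A.mkV (A.mul (A.star (A.upIncl s)) (A.upIncl h) +
      A.mul (A.star (A.upIncl h)) (A.upIncl s))
      (by simp only [map_add, A.star_mul, A.star_star]; abel))
    (fun s t h => V.ext (by simp only [incl_mkV, map_add, LinearMap.add_apply]; abel))
    (fun a s h => V.ext (by simp only [incl_mkV, map_smul, LinearMap.smul_apply, smul_add]))
    (fun s t h => V.ext (by simp only [incl_mkV, map_add, LinearMap.add_apply]; abel))
    (fun a s h => V.ext (by simp only [incl_mkV, map_smul, LinearMap.smul_apply, smul_add]))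

theorem sqB_apply (s h : A.Up) : A.incl (A.sqB s h) = A.mul (A.upIncl s) (A.star (A.upIncl h)) +
      A.mul (A.upIncl h) (A.star (A.upIncl s)) := rfl
theorem sqsB_apply (s h : A.Up) : A.incl (A.sqsB s h) = A.mul (A.star (A.upIncl s)) (A.upIncl h) +
      A.mul (A.star (A.upIncl h)) (A.upIncl s) := rfl

theorem sqB_comm (s h : A.Up) : A.sqB s h = A.sqB h s :=
  V.ext (by rw [sqB_apply, sqB_apply, add_comm])

theorem sqsB_comm (s h : A.Up) : A.sqsB s h = A.sqsB h s :=
  V.ext (by rw [sqsB_apply, sqsB_apply, add_comm])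

theorem sq_add (s h : A.Up) : A.sq (s + h) = A.sq s + A.sqB s h + A.sq h :=
  V.ext (by simp only [incl_sq, sqB_apply, map_add, LinearMap.add_apply]; abel)

theorem sq_eq_sqB (s : A.Up) : A.sq s = (1 / 2 : ℝ) • A.sqB s s :=
  V.ext (by rw [map_smul, sqB_apply, ← two_smul ℝ, smul_smul, incl_sq]; norm_num)

theorem sqs_eq_sqsB (s : A.Up) : A.sqs s = (1 / 2 : ℝ) • A.sqsB s s :=
  V.ext (by rw [map_smul, sqsB_apply, ← two_smul ℝ, smul_smul, incl_sqs]; norm_num)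

theorem sqsB_one (h : A.Up) : A.sqsB 1 h = A.symL h := V.ext (by
  rw [sqsB_apply, incl_symL, upIncl_one, star_sum_c, sum_c_mul, mul_sum_c])

theorem hasStrictFDerivAt_sq (t : A.Up) :
    HasStrictFDerivAt A.sq (A.sqB t).toContinuousLinearMap t := by
  have h := (LinearMap.toContinuousBilinearMap A.sqB).hasStrictFDerivAt_of_bilinear
    (hasStrictFDerivAt_id t) (hasStrictFDerivAt_id t)
  have h2 := h.const_smul (1 / 2 : ℝ)
  refine (h2.congr_fderiv ?_).congr_of_eventuallyEq (Filter.Eventually.of_forall fun s => ?_)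
  · ext u
    change (1 / 2 : ℝ) • (A.sqB t u + A.sqB u t) = A.sqB t u
    rw [A.sqB_comm u t, ← two_smul ℝ, smul_smul]; norm_num
  · exact (A.sq_eq_sqB s).symm

theorem hasStrictFDerivAt_sqs (t : A.Up) :
    HasStrictFDerivAt A.sqs (A.sqsB t).toContinuousLinearMap t := by
  have h := (LinearMap.toContinuousBilinearMap A.sqsB).hasStrictFDerivAt_of_bilinear
    (hasStrictFDerivAt_id t) (hasStrictFDerivAt_id t)
  have h2 := h.const_smul (1 / 2 : ℝ)
  refine (h2.congr_fderiv ?_).congr_of_eventuallyEq (Filter.Eventually.of_forall fun s => ?_)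
  · ext u
    change (1 / 2 : ℝ) • (A.sqsB t u + A.sqsB u t) = A.sqsB t u
    rw [A.sqsB_comm u t, ← two_smul ℝ, smul_smul]; norm_num
  · exact (A.sqs_eq_sqsB s).symm

theorem continuous_sq : Continuous A.sq :=
  continuous_iff_continuousAt.2 fun t => (A.hasStrictFDerivAt_sq t).continuousAt

theorem continuous_sqs : Continuous A.sqs :=
  continuous_iff_continuousAt.2 fun t => (A.hasStrictFDerivAt_sqs t).continuousAt

/-- The isomorphism `h ↦ h + h⋆` of the upper triangular elements with `V`. -/
def symE : A.Up ≃L[ℝ] A.V :=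
  (LinearEquiv.ofBijective A.symL ⟨A.symL_injective, A.symL_surjective⟩).toContinuousLinearEquiv

theorem symE_apply (h : A.Up) : A.symE h = A.symL h := rfl

theorem continuous_dg (i : Fin r) : Continuous (A.dg i) :=
  LinearMap.continuous_of_finiteDimensional _

/-- The set of upper triangular elements with positive diagonal. -/
def Hset : Set A.Up := {t | ∀ i, 0 < A.dg i t}

theorem isOpen_Hset : IsOpen A.Hset := by
  simp only [Hset, ofPred_forall]
  exact isOpen_iInter_of_finite fun i => isOpen_lt continuous_const (A.continuous_dg i)

theorem convex_Hset : Convex ℝ A.Hset := by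
  intro s hs t ht a b ha hb hab i
  rw [map_add, map_smul, map_smul, smul_eq_mul, smul_eq_mul]
  rcases ha.eq_or_lt with rfl | ha
  · rw [zero_add] at hab
    rw [hab]; simpa using ht i
  · exact add_pos_of_pos_of_nonneg (mul_pos ha (hs i)) (mul_nonneg hb (ht i).le)

theorem Hg.mem_Hset {A : TAlgebra r U} (t : A.Hg) : (t : A.Up) ∈ A.Hset := t.2

variable {A} in
theorem exists_Hg_eq {t : A.Up} (ht : t ∈ A.Hset) : ∃ u : A.Hg, (u : A.Up) = t := ⟨⟨t, ht⟩, rfl⟩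

theorem one_mem_Hset : (1 : A.Up) ∈ A.Hset := fun i => by rw [dg_one]; exact one_pos

/-- The derivative of t⋆ t at the unit is the isomorphism h ↦ h + h⋆, so the inverse function
theorem applies at e. Homogeneity carries openness to the other points. -/
theorem image_sqs_mem_nhds {N : Set A.Up} (hN : N ∈ 𝓝 (1 : A.Up)) : A.sqs '' N ∈ 𝓝 A.e := by
  have h : HasStrictFDerivAt A.sqs (A.symE : A.Up →L[ℝ] A.V) 1 :=
    (A.hasStrictFDerivAt_sqs 1).congr_fderiv (by ext h; exact A.sqsB_one h)
  rw [← sqs_one, ← h.map_nhds_eq_of_equiv]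
  exact Filter.image_mem_map hN

theorem isOpen_image_sqs_Hset : IsOpen (A.sqs '' A.Hset) := by
  rw [isOpen_iff_mem_nhds]
  rintro _ ⟨t, ht, rfl⟩
  obtain ⟨t, rfl⟩ := exists_Hg_eq ht
  have h1 := (A.PE t).toHomeomorph.isOpenMap.image_mem_nhds
    (A.image_sqs_mem_nhds (A.isOpen_Hset.mem_nhds A.one_mem_Hset))
  change A.PE t '' _ ∈ 𝓝 (A.PE t A.e) at h1
  rw [PE_e] at h1
  refine Filter.mem_of_superset h1 ?_
  rintro _ ⟨_, ⟨u, hu, rfl⟩, rfl⟩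
  obtain ⟨u, rfl⟩ := exists_Hg_eq hu
  rw [PE_sqs]
  exact ⟨_, (u * t).mem_Hset, rfl⟩

/-! ### Self-duality and the second parametrisation of the cone -/

theorem cone_eq_image : A.cone = A.sq '' A.Hset := by
  ext y
  rw [mem_cone_iff]
  exact ⟨fun ⟨t, h⟩ => ⟨t.1, t.2, h⟩, fun ⟨t, ht, h⟩ => ⟨⟨t, ht⟩, h⟩⟩

/-- A quantitative form of positivity, stable under closure: for x = s s⋆, writing s = t⁻¹(t s)
bounds ‖s‖² by a multiple of ‖t s‖² = (x | t⋆ t). -/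
theorem norm_le_inner_sqs (t : A.Hg) {x : A.V} (hx : x ∈ closure A.cone) :
    ‖x‖ ≤ A.cb ^ 3 * ‖((t⁻¹ : A.Hg) : A.Up)‖ ^ 2 * inner ℝ x (A.sqs t) := by
  have hcl : IsClosed {x : A.V | ‖x‖ ≤
      A.cb ^ 3 * ‖((t⁻¹ : A.Hg) : A.Up)‖ ^ 2 * inner ℝ x (A.sqs t)} :=
    isClosed_le continuous_norm (by fun_prop)
  refine closure_minimal ?_ hcl hx
  intro x hx
  obtain ⟨s, rfl⟩ := A.mem_cone_iff.1 hx
  have h1 : ‖(s : A.Up)‖ ≤ A.cb * ‖((t⁻¹ : A.Hg) : A.Up)‖ * ‖(t : A.Up) * s‖ := by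
    have := A.norm_upMul_le (t⁻¹ : A.Hg) (t * s)
    rwa [← mul_assoc, Hg.coe_inv_mul, one_mul] at this
  rw [mem_ofPred_eq, inner_sq_sqs]
  calc ‖A.sq s‖ ≤ A.cb * ‖(s : A.Up)‖ ^ 2 := A.norm_sqMap_le _
    _ ≤ A.cb * (A.cb * ‖((t⁻¹ : A.Hg) : A.Up)‖ * ‖(t : A.Up) * s‖) ^ 2 := by
        gcongr; exact A.cb_pos.le
    _ = _ := by ring

theorem sqs_mem_dualCone (t : A.Hg) : A.sqs t ∈ A.dualCone := by
  intro x hx hx0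
  have h := A.norm_le_inner_sqs t hx
  have h1 : 0 < ‖x‖ := norm_pos_iff.2 hx0
  by_contra hneg
  have : A.cb ^ 3 * ‖((t⁻¹ : A.Hg) : A.Up)‖ ^ 2 * inner ℝ x (A.sqs t) ≤ 0 :=
    mul_nonpos_of_nonneg_of_nonpos (by have := A.cb_pos; positivity) (not_lt.1 hneg)
  linarith

theorem smul_mem_cone {a : ℝ} (ha : 0 < a) {x : A.V} (hx : x ∈ A.cone) : a • x ∈ A.cone := by
  rw [cone_eq_image] at *
  obtain ⟨t, ht, rfl⟩ := hx
  refine ⟨√a • t, fun i => ?_, ?_⟩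
  · rw [map_smul, smul_eq_mul]
    exact mul_pos (Real.sqrt_pos.2 ha) (ht i)
  · rw [sq_smul, Real.sq_sqrt ha.le]

theorem smul_mem_closure_cone {a : ℝ} (ha : 0 < a) {x : A.V} (hx : x ∈ closure A.cone) :
    a • x ∈ closure A.cone :=
  map_mem_closure (continuous_const_smul a) hx fun _ h => A.smul_mem_cone ha h

theorem exists_norm_le_inner {ξ : A.V} (hξ : ξ ∈ A.dualCone) :
    ∃ c > 0, ∀ x ∈ closure A.cone, c * ‖x‖ ≤ inner ℝ x ξ := by
  have hK : IsCompact (closure A.cone ∩ Metric.sphere 0 1) :=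
    (isCompact_sphere 0 1).inter_left isClosed_closure
  have key : ∃ c > 0, ∀ x ∈ closure A.cone ∩ Metric.sphere 0 1, c ≤ inner ℝ x ξ := by
    by_cases hne : (closure A.cone ∩ Metric.sphere (0 : A.V) 1).Nonempty
    · obtain ⟨x, hx, hmin⟩ := hK.exists_isMinOn hne
        (f := fun x => inner ℝ x ξ) (by fun_prop)
      refine ⟨inner ℝ x ξ, hξ x hx.1 ?_, fun y hy => hmin hy⟩
      rintro rfl
      simpa using hx.2
    · exact ⟨1, one_pos, fun x hx => (hne ⟨x, hx⟩).elim⟩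
  obtain ⟨c, hc, h⟩ := key
  refine ⟨c, hc, fun x hx => ?_⟩
  rcases eq_or_ne x 0 with rfl | hx0
  · simp
  · have hn : 0 < ‖x‖ := norm_pos_iff.2 hx0
    have := h (‖x‖⁻¹ • x) ⟨A.smul_mem_closure_cone (inv_pos.2 hn) hx, by
      simp [norm_smul, hn.ne']⟩
    rw [real_inner_smul_left] at this
    rwa [← le_div_iff₀ hn, div_eq_inv_mul]

/-- The elements t with t⋆ t near ξ stay in a compact part of H. Their norms are bounded because
‖t‖² = (e | t⋆ t). Their diagonals stay away from 0 because x = t⁻¹(t⁻¹)⋆ satisfies (x | t⋆ t) = r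
while (x | ξ) ≥ c‖x‖, which bounds ‖t⁻¹‖. -/
theorem mem_image_sqs_of_mem_closure {ξ : A.V} (hξ : ξ ∈ A.dualCone)
    (hcl : ξ ∈ closure (A.sqs '' A.Hset)) : ξ ∈ A.sqs '' A.Hset := by
  obtain ⟨c, hc, h⟩ := A.exists_norm_le_inner hξ
  -- A bound for ‖t⁻¹‖² when t⋆ t is within c/2 of ξ. The condition `1 ≤ M * A.dg i t ^ 2` below is
  -- the closed form of t_ii⁻² ≤ M.
  set M : ℝ := 2 * r * ‖A.e‖ / c
  set K : Set A.Up := Metric.closedBall 0 √(‖A.e‖ * (‖ξ‖ + c / 2)) ∩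
    {t | ∀ i, 0 ≤ A.dg i t ∧ 1 ≤ M * A.dg i t ^ 2}
  have hK : IsCompact K := by
    refine (isCompact_closedBall _ _).inter_right ?_
    simp only [ofPred_forall]
    refine isClosed_iInter fun i => IsClosed.inter ?_ ?_
    · exact isClosed_le continuous_const (A.continuous_dg i)
    · exact isClosed_le continuous_const (continuous_const.mul ((A.continuous_dg i).pow 2))
  have hmem : ξ ∈ A.sqs '' K := by
    by_contra hnot
    have hopen : IsOpen ((A.sqs '' K)ᶜ ∩ Metric.ball ξ (c / 2)) :=
      (hK.image A.continuous_sqs).isClosed.isOpen_compl.inter Metric.isOpen_ball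
    obtain ⟨_, ⟨hη1, hη2⟩, t, ht, rfl⟩ := mem_closure_iff.1 hcl _ hopen
      ⟨hnot, Metric.mem_ball_self (half_pos hc)⟩
    refine hη1 ⟨t, ⟨?_, ?_⟩, rfl⟩
    · rw [mem_closedBall_zero_iff]
      refine Real.le_sqrt_of_sq_le ?_
      rw [norm_sq_eq_inner_e_sqs]
      refine (real_inner_le_norm _ _).trans ?_
      gcongr
      have h3 : ‖A.sqs t - ξ‖ < c / 2 := by rwa [← dist_eq_norm]
      have h4 : ‖A.sqs t‖ ≤ ‖ξ‖ + ‖A.sqs t - ξ‖ := by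
        simpa using norm_add_le ξ (A.sqs t - ξ)
      linarith
    · intro i
      refine ⟨(ht i).le, ?_⟩
      set u : A.Hg := ⟨t, ht⟩
      set x : A.V := A.sq (u⁻¹ : A.Hg)
      have hx : x ∈ closure A.cone := subset_closure (A.mem_cone_iff.2 ⟨_, rfl⟩)
      have h1 : inner ℝ x (A.sqs u) = (r : ℝ) := by
        rw [inner_sq_sqs, Hg.coe_mul_inv, norm_one_sq]
      have h2 : c / 2 * ‖x‖ ≤ r := by
        have h3 : inner ℝ x (ξ - A.sqs u) ≤ ‖x‖ * (c / 2) := by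
          refine (real_inner_le_norm _ _).trans ?_
          gcongr
          rw [← dist_eq_norm, dist_comm]
          exact (Metric.mem_ball.1 hη2).le
        rw [inner_sub_right, h1] at h3
        have := h x hx
        linarith
      have h3 : ‖((u⁻¹ : A.Hg) : A.Up)‖ ^ 2 ≤ ‖x‖ * ‖A.e‖ := by
        rw [norm_sq_eq_inner_sq_e]; exact real_inner_le_norm _ _
      have h4 : ‖((u⁻¹ : A.Hg) : A.Up)‖ ^ 2 ≤ M := by
        rw [le_div_iff₀ hc]
        have := mul_le_mul_of_nonneg_right h2 (norm_nonneg A.e)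
        nlinarith
      have h5 : (A.dg i t)⁻¹ ^ 2 ≤ M := by
        refine le_trans ?_ h4
        have := A.abs_dg_le i (u⁻¹ : A.Hg)
        rw [Hg.dg_inv] at this
        exact sq_le_sq' (by linarith [abs_le.1 this]) (abs_le.1 this).2
      have h6 : 0 < A.dg i t := ht i
      rw [inv_pow] at h5
      calc (1 : ℝ) = (A.dg i t ^ 2)⁻¹ * A.dg i t ^ 2 := by field_simp
        _ ≤ _ := by gcongr
  obtain ⟨t, ⟨_, ht⟩, rfl⟩ := hmem
  refine ⟨t, fun i => (ht i).1.lt_of_ne fun h0 => ?_, rfl⟩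
  have := (ht i).2
  rw [← h0] at this
  norm_num at this

-- A connectedness argument: the image of t ↦ t⋆ t is open, lies in the dual cone, and is relatively
-- closed there, while Ω is connected as an image of the convex set `Hset`.
variable {A} in
theorem IsSymmetric.cone_eq (hA : A.IsSymmetric) : A.cone = A.sqs '' A.Hset := by
  have hsub : A.sqs '' A.Hset ⊆ A.cone := by
    rintro _ ⟨t, ht, rfl⟩
    rw [← hA]
    exact A.sqs_mem_dualCone ⟨t, ht⟩
  refine Subset.antisymm ?_ hsub
  have hconn : IsPreconnected A.cone := by
    rw [cone_eq_image]
    exact A.convex_Hset.isPreconnected.image _ A.continuous_sq.continuousOn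
  refine hconn.subset_of_closure_inter_subset A.isOpen_image_sqs_Hset ?_ ?_
  · exact ⟨A.sqs 1, hsub ⟨1, A.one_mem_Hset, rfl⟩, 1, A.one_mem_Hset, rfl⟩
  · rintro ξ ⟨h1, h2⟩
    exact A.mem_image_sqs_of_mem_closure (by rw [hA]; exact h2) h1

variable {A} in
theorem IsSymmetric.isOpen_cone (hA : A.IsSymmetric) : IsOpen A.cone := by
  rw [hA.cone_eq]; exact A.isOpen_image_sqs_Hset

variable {A} in
theorem IsSymmetric.mem_cone_iff (hA : A.IsSymmetric) {ξ : A.V} :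
    ξ ∈ A.cone ↔ ∃ t : A.Hg, A.sqs t = ξ := by
  rw [hA.cone_eq]
  exact ⟨fun ⟨t, ht, h⟩ => ⟨⟨t, ht⟩, h⟩, fun ⟨t, h⟩ => ⟨t.1, t.2, h⟩⟩

theorem e_mem_cone : A.e ∈ A.cone := by
  rw [cone_eq_image, ← sq_one]; exact ⟨1, A.one_mem_Hset, rfl⟩

variable {A} in
theorem IsSymmetric.inner_nonneg (hA : A.IsSymmetric) {y ξ : A.V} (hy : y ∈ A.cone)
    (hξ : ξ ∈ closure A.cone) : 0 ≤ inner ℝ y ξ := by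
  have h1 : y ∈ A.dualCone := by rw [hA]; exact hy
  rcases eq_or_ne ξ 0 with rfl | h0
  · simp
  · rw [real_inner_comm]; exact (h1 ξ hξ h0).le

variable {A} in
/-- A continuous function vanishing off the closure of `Ω` vanishes off `Ω`. -/
theorem IsSymmetric.eq_zero_of_notMem_cone (hA : A.IsSymmetric) {h : A.V → ℂ} (hc : Continuous h)
    (hs : tsupport h ⊆ closure A.cone) {ξ : A.V} (hξ : ξ ∉ A.cone) : h ξ = 0 := by
  rw [← hA, dualCone] at hξ
  simp only [mem_ofPred_eq, not_forall, not_lt] at hξ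
  obtain ⟨x, hx, hx0, hle⟩ := hξ
  -- The vector x witnesses that ξ is not in the dual cone. It pairs nonpositively with ξ and
  -- positively with e, hence negatively with ξ - εe, which therefore lies outside the closed cone.
  -- Then ε tends to 0.
  have hzero : ∀ ε : ℝ, 0 < ε → h (ξ - ε • A.e) = 0 := by
    intro ε hε
    refine image_eq_zero_of_notMem_tsupport fun hmem => ?_
    have h1 : 0 ≤ inner ℝ x (ξ - ε • A.e) := by
      have hcl : IsClosed {x : A.V | 0 ≤ inner ℝ x (ξ - ε • A.e)} :=
        isClosed_le continuous_const (by fun_prop)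
      exact closure_minimal (fun y hy => hA.inner_nonneg hy (hs hmem)) hcl hx
    have h2 : 0 < inner ℝ x A.e := by
      have : A.e ∈ A.dualCone := by rw [hA]; exact A.e_mem_cone
      exact this x hx hx0
    rw [inner_sub_right, real_inner_smul_right] at h1
    nlinarith
  have hlim : Filter.Tendsto (fun ε : ℝ => h (ξ - ε • A.e)) (𝓝[>] 0) (𝓝 (h (ξ - (0 : ℝ) • A.e))) :=
    Filter.Tendsto.mono_left (Continuous.tendsto (by fun_prop) 0) nhdsWithin_le_nhds
  have hlim2 : Filter.Tendsto (fun ε : ℝ => h (ξ - ε • A.e)) (𝓝[>] 0) (𝓝 0) :=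
    tendsto_const_nhds.congr' (by
      filter_upwards [self_mem_nhdsWithin] with ε hε using (hzero ε hε).symm)
  simpa using tendsto_nhds_unique hlim hlim2

end TAlgebra

end

open MeasureTheory Set
open scoped ENNReal NNReal SchwartzMap

set_option linter.unusedSectionVars false

noncomputable section

namespace TAlgebra

variable {r : ℕ} {U : Type*} [NormedAddCommGroup U] [InnerProductSpace ℝ U] (A : TAlgebra r U)

variable [FiniteDimensional ℝ U]

open scoped Topology

/-! ### Determinants of the left and right multiplications -/

/-- The component `U i j` of the upper triangular elements. -/
def upComp (ij : Fin r × Fin r) : Submodule ℝ A.Up := (A.comp ij.1 ij.2).comap A.upIncl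

theorem isInternal_upComp : DirectSum.IsInternal A.upComp := by
  rw [DirectSum.isInternal_submodule_iff_iSupIndep_and_iSup_eq_top]
  constructor
  · intro ij
    rw [Submodule.disjoint_def]
    intro t ht ht'
    have hle : (⨆ kl, ⨆ (_ : kl ≠ ij), A.upComp kl) ≤
        LinearMap.ker (A.pr ij.1 ij.2 ∘ₗ A.upIncl) := by
      refine iSup_le fun kl => iSup_le fun hne s hs => ?_
      rw [LinearMap.mem_ker, LinearMap.comp_apply, A.pr_of_mem hs, if_neg]
      exact fun h => hne (Prod.ext h.1 h.2)
    have h1 := hle ht'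
    rw [LinearMap.mem_ker, LinearMap.comp_apply, A.pr_self ht] at h1
    exact Up.ext (by rw [h1, map_zero])
  · rw [eq_top_iff]
    intro t _
    have hmem : ∀ i j, A.pr i j (A.upIncl t) ∈ A.upper := by
      intro i j
      rcases lt_or_ge j i with h | h
      · rw [A.pr_upIncl_of_lt h]; exact zero_mem _
      · exact A.comp_le_upper h (A.pr_mem i j _)
    have ht : t = ∑ i, ∑ j, A.mkUp _ (hmem i j) := by
      refine Up.ext ?_
      simp only [map_sum, upIncl_mkUp, A.sum_pr]
    rw [ht]
    exact sum_mem fun i _ => sum_mem fun j _ =>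
      Submodule.mem_iSup_of_mem (i, j) (A.pr_mem i j _)

theorem finrank_upComp (ij : Fin r × Fin r) :
    Module.finrank ℝ (A.upComp ij) = if ij.1 ≤ ij.2 then A.nij ij.1 ij.2 else 0 := by
  split_ifs with h
  · refine LinearEquiv.finrank_eq
      { toFun := fun t => ⟨A.upIncl t, t.2⟩
        map_add' := fun _ _ => rfl
        map_smul' := fun _ _ => rfl
        invFun := fun x => ⟨A.mkUp x (A.comp_le_upper h x.2), x.2⟩
        left_inv := fun _ => rfl
        right_inv := fun _ => rfl }
  · have : A.upComp ij = ⊥ := by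
      rw [eq_bot_iff]
      intro t ht
      have h2 := A.pr_upIncl_of_lt (not_le.1 h) t
      rw [A.pr_self ht] at h2
      exact Up.ext (by rw [h2, map_zero])
    rw [this, finrank_bot]

theorem nij_self (i : Fin r) : A.nij i i = 1 := by
  refine finrank_eq_one (⟨A.c i, A.c_mem i⟩ : A.comp i i) ?_ ?_
  · intro h
    have h2 : A.c i = 0 := congrArg Subtype.val h
    have := A.norm_c i
    rw [h2, norm_zero] at this
    exact zero_ne_one this
  · rintro ⟨x, hx⟩
    exact ⟨A.diag i x, Subtype.ext (A.eq_diag_smul hx).symm⟩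

theorem det_of_eigen {f : A.Up →ₗ[ℝ] A.Up} {l : Fin r × Fin r → ℝ}
    (hf : ∀ ij, ∀ t ∈ A.upComp ij, f t = l ij • t) :
    LinearMap.det f = ∏ i, ∏ j, l (i, j) ^ (if i ≤ j then A.nij i j else 0) := by
  classical
  let b := A.isInternal_upComp.collectedBasis fun ij => Module.finBasis ℝ (A.upComp ij)
  have hb : ∀ k, f (b k) = l k.1 • b k := by
    intro k
    refine hf k.1 _ ?_
    simp only [b, DirectSum.IsInternal.collectedBasis_coe]
    exact Subtype.mem _
  have hM : LinearMap.toMatrix b b f = Matrix.diagonal fun k => l k.1 := by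
    ext k m
    rw [LinearMap.toMatrix_apply, hb, map_smul, Module.Basis.repr_self, Matrix.diagonal_apply]
    by_cases h : k = m
    · subst h; simp
    · rw [if_neg h, Finsupp.smul_apply, Finsupp.single_eq_of_ne h, smul_zero]
  rw [← LinearMap.det_toMatrix b f, hM, Matrix.det_diagonal, Fintype.prod_sigma,
    Fintype.prod_prod_type]
  refine Finset.prod_congr rfl fun i _ => Finset.prod_congr rfl fun j _ => ?_
  simp [finrank_upComp]

/-- The diagonal element with coefficients `a i`. -/
def diagUp (a : Fin r → ℝ) : A.Up :=
  A.mkUp (∑ i, a i • A.c i) (sum_mem fun i _ => Submodule.smul_mem _ _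
    (A.comp_le_upper le_rfl (A.c_mem i)))

theorem upIncl_diagUp (a : Fin r → ℝ) : A.upIncl (A.diagUp a) = ∑ i, a i • A.c i := rfl

theorem dg_diagUp (a : Fin r → ℝ) (i : Fin r) : A.dg i (A.diagUp a) = a i := by
  simp [dg_apply, upIncl_diagUp, map_sum, A.diag_c_ite]

theorem pr_diagUp (a : Fin r → ℝ) (i j : Fin r) :
    A.pr i j (A.upIncl (A.diagUp a)) = if i = j then a i • A.c i else 0 := by
  rw [upIncl_diagUp, map_sum]
  simp only [map_smul, A.pr_of_mem (A.c_mem _)]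
  rw [Finset.sum_eq_single i]
  · by_cases h : i = j <;> simp [h]
  · intro k _ hk; simp [hk]
  · simp

theorem star_diagUp (a : Fin r → ℝ) :
    A.star (A.upIncl (A.diagUp a)) = A.upIncl (A.diagUp a) := by
  simp [upIncl_diagUp, map_sum, A.star_c]

theorem pr_diagUp_mul (a : Fin r → ℝ) (t : A.Up) (i j : Fin r) :
    A.pr i j (A.upIncl (A.diagUp a * t)) = a i • A.pr i j (A.upIncl t) := by
  rw [upIncl_mul, pr_mul, Finset.sum_eq_single i]
  · rw [pr_diagUp, if_pos rfl, LinearMap.map_smul₂, A.c_mul (A.pr_mem i j _)]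
  · intro k _ hk
    rw [pr_diagUp, if_neg hk.symm, LinearMap.map_zero₂]
  · simp

theorem pr_mul_diagUp (a : Fin r → ℝ) (t : A.Up) (i j : Fin r) :
    A.pr i j (A.upIncl (t * A.diagUp a)) = a j • A.pr i j (A.upIncl t) := by
  rw [upIncl_mul, pr_mul, Finset.sum_eq_single j]
  · rw [pr_diagUp, if_pos rfl, map_smul, A.mul_c (A.pr_mem i j _)]
  · intro k _ hk
    rw [pr_diagUp, if_neg hk, map_zero]
  · simp

theorem diagUp_mul_of_mem {a : Fin r → ℝ} {t : A.Up} {ij : Fin r × Fin r} (ht : t ∈ A.upComp ij) :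
    A.diagUp a * t = a ij.1 • t := by
  refine Up.ext (A.ext_pr fun i j => ?_)
  rw [pr_diagUp_mul, map_smul, map_smul, A.pr_of_mem ht]
  split_ifs with h
  · rw [h.1]
  · simp

theorem mul_diagUp_of_mem {a : Fin r → ℝ} {t : A.Up} {ij : Fin r × Fin r} (ht : t ∈ A.upComp ij) :
    t * A.diagUp a = a ij.2 • t := by
  refine Up.ext (A.ext_pr fun i j => ?_)
  rw [pr_mul_diagUp, map_smul, map_smul, A.pr_of_mem ht]
  split_ifs with h
  · rw [h.2]
  · simp

theorem mon_diagUp (a b : Fin r → ℝ) : A.mon b (A.diagUp a) = ∏ i, a i ^ b i := by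
  simp [mon, dg_diagUp]

theorem det_mulL_diagUp (a : Fin r → ℝ) :
    LinearMap.det (A.mulL (A.diagUp a)) = A.mon (fun i => 1 + A.mm i) (A.diagUp a) := by
  rw [A.det_of_eigen (l := fun ij => a ij.1) (fun ij t ht => A.diagUp_mul_of_mem ht), mon_diagUp]
  refine Finset.prod_congr rfl fun i _ => ?_
  dsimp only
  rw [Finset.prod_pow_eq_pow_sum, ← Real.rpow_natCast]
  congr 1
  rw [mm, ← Finset.sum_filter, Nat.cast_sum]
  have : (Finset.univ.filter fun j : Fin r => i ≤ j) =
      insert i (Finset.univ.filter fun j : Fin r => i < j) := by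
    ext j; simp [le_iff_eq_or_lt, eq_comm]
  rw [this, Finset.sum_insert (by simp), nij_self, Nat.cast_one]

theorem det_mulR_diagUp (a : Fin r → ℝ) :
    LinearMap.det (A.mulR (A.diagUp a)) = A.mon (fun i => 1 + A.nn i) (A.diagUp a) := by
  rw [A.det_of_eigen (l := fun ij => a ij.2) (fun ij t ht => A.mul_diagUp_of_mem ht), mon_diagUp,
    Finset.prod_comm]
  refine Finset.prod_congr rfl fun i _ => ?_
  dsimp only
  rw [Finset.prod_pow_eq_pow_sum, ← Real.rpow_natCast]
  congr 1
  rw [nn, ← Finset.sum_filter, Nat.cast_sum]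
  have : (Finset.univ.filter fun j : Fin r => j ≤ i) =
      insert i (Finset.univ.filter fun j : Fin r => j < i) := by
    ext j; simp [le_iff_eq_or_lt]
  rw [this, Finset.sum_insert (by simp), nij_self, Nat.cast_one]

/-! ### Characters of the triangular group and the Jacobian of t ↦ t t⋆ -/

/-- The element with components `ε ^ (j - i) t_{ij}`. -/
def contractUp (ε : ℝ) (t : A.Up) : A.Up :=
  A.mkUp (∑ i, ∑ j, ε ^ (j.val - i.val) • A.pr i j (A.upIncl t))
    (sum_mem fun i _ => sum_mem fun j _ => by
      rcases lt_or_ge j i with h | h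
      · rw [A.pr_upIncl_of_lt h, smul_zero]; exact zero_mem _
      · exact Submodule.smul_mem _ _ (A.comp_le_upper h (A.pr_mem i j _)))

theorem pr_contractUp (ε : ℝ) (t : A.Up) (i j : Fin r) :
    A.pr i j (A.upIncl (A.contractUp ε t)) = ε ^ (j.val - i.val) • A.pr i j (A.upIncl t) := by
  simp only [contractUp, upIncl_mkUp, map_sum, map_smul, A.pr_pr]
  rw [Finset.sum_eq_single i, Finset.sum_eq_single j]
  · simp
  · intro k _ hk; simp [hk]
  · simp
  · intro k _ hk; simp [hk]
  · simp

theorem contractUp_zero (t : A.Up) : A.contractUp 0 t = A.diagUp fun i => A.dg i t := by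
  refine Up.ext (A.ext_pr fun i j => ?_)
  rw [pr_contractUp, pr_diagUp]
  split_ifs with h
  · subst h; rw [pr_upIncl_diag]; simp
  · rcases lt_or_gt_of_ne h with h1 | h1
    · rw [zero_pow (by have := Fin.lt_def.1 h1; omega), zero_smul]
    · rw [A.pr_upIncl_of_lt h1, smul_zero]

theorem dg_contractUp (ε : ℝ) (t : A.Up) (i : Fin r) : A.dg i (A.contractUp ε t) = A.dg i t := by
  refine A.diag_eq_of_pr ?_
  rw [pr_contractUp, pr_upIncl_diag]; simp

theorem continuous_contractUp (t : A.Up) : Continuous fun ε => A.contractUp ε t := by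
  refine Continuous.subtype_mk ?_ _
  fun_prop

/-- For ε > 0 the contraction is the conjugate D⁻¹ t D by D = diag(ε^i), so t degenerates to its
diagonal within its conjugacy class. Truncated subtraction in the exponent does no harm, since
components with j < i vanish. -/
theorem diagUp_mul_contractUp (ε : ℝ) (t : A.Up) :
    A.diagUp (fun i => ε ^ i.val) * A.contractUp ε t = t * A.diagUp (fun i => ε ^ i.val) := by
  refine Up.ext (A.ext_pr fun i j => ?_)
  rw [pr_diagUp_mul, pr_mul_diagUp, pr_contractUp, smul_smul, ← pow_add]
  rcases lt_or_ge j i with h | h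
  · rw [A.pr_upIncl_of_lt h, smul_zero, smul_zero]
  · rw [Nat.add_sub_cancel' (Fin.le_def.1 h)]

/-- A continuous character of the group `H` only depends on the diagonal. -/
theorem character_eq_diag {K : A.Up → ℝ} (hK : Continuous K) (h1 : K 1 = 1)
    (hmul : ∀ s t : A.Hg, K ((s : A.Up) * t) = K s * K t) (t : A.Hg) :
    K t = K (A.diagUp fun i => A.dg i (t : A.Up)) := by
  -- A multiplicative real function does not see conjugation; its value at D is nonzero because D is
  -- invertible.
  have hconst : ∀ ε : ℝ, 0 < ε → K (A.contractUp ε t) = K t := by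
    intro ε hε
    obtain ⟨D, hD⟩ : ∃ D : A.Hg, (D : A.Up) = A.diagUp fun i => ε ^ i.val :=
      exists_Hg_eq fun i => by rw [dg_diagUp]; positivity
    obtain ⟨T, hT⟩ : ∃ T : A.Hg, (T : A.Up) = A.contractUp ε t :=
      exists_Hg_eq fun i => by rw [dg_contractUp]; exact t.pos i
    have h := A.diagUp_mul_contractUp ε t
    rw [← hD, ← hT] at h
    have h2 := congrArg K h
    rw [hmul, hmul, mul_comm] at h2
    rw [← hT]
    refine mul_right_cancel₀ (fun h0 => ?_) h2
    have h3 := hmul D D⁻¹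
    rw [Hg.coe_mul_inv, h1, h0, zero_mul] at h3
    exact one_ne_zero h3
  have hlim : Filter.Tendsto (fun ε : ℝ => K (A.contractUp ε t)) (𝓝[>] 0)
      (𝓝 (K (A.contractUp 0 t))) :=
    ((hK.comp (A.continuous_contractUp t)).tendsto 0).mono_left nhdsWithin_le_nhds
  have hlim2 : Filter.Tendsto (fun ε : ℝ => K (A.contractUp ε t)) (𝓝[>] 0) (𝓝 (K t)) :=
    tendsto_const_nhds.congr' (by
      filter_upwards [self_mem_nhdsWithin] with ε hε using (hconst ε hε).symm)
  rw [← contractUp_zero]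
  exact tendsto_nhds_unique hlim2 hlim

theorem mon_diag (a : Fin r → ℝ) (t : A.Up) :
    A.mon a (A.diagUp fun i => A.dg i t) = A.mon a t := by
  simp [mon, dg_diagUp]

theorem continuous_det_linear {E F : Type*} [NormedAddCommGroup E] [NormedSpace ℝ E]
    [FiniteDimensional ℝ E] [NormedAddCommGroup F] [NormedSpace ℝ F] [FiniteDimensional ℝ F]
    (f : E →ₗ[ℝ] F →ₗ[ℝ] F) : Continuous fun t => LinearMap.det (f t) := by
  have h := ContinuousLinearMap.continuous_det.comp f.toContinuousBilinearMap.continuous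
  exact h

/-- The determinant is a continuous character, so only the diagonal of t matters. For diagonal t the
components U_ij are eigenspaces with eigenvalue t_ii (for right multiplication t_jj), counted with
multiplicity n_ij. -/
theorem det_mulL (t : A.Hg) :
    LinearMap.det (A.mulL t) = A.mon (fun i => 1 + A.mm i) t := by
  rw [A.character_eq_diag (K := fun t => LinearMap.det (A.mulL t)) (continuous_det_linear
    (LinearMap.mul ℝ A.Up)) (by simp [mulL]) (fun s t => by
      rw [← LinearMap.det_comp]; congr 1; ext u; simp [mul_assoc]) t,
    det_mulL_diagUp, mon_diag]

theorem det_mulR (t : A.Hg) :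
    LinearMap.det (A.mulR t) = A.mon (fun i => 1 + A.nn i) t := by
  rw [A.character_eq_diag (K := fun t => LinearMap.det (A.mulR t)) (continuous_det_linear
    (LinearMap.mul ℝ A.Up).flip) (by simp [mulR]) (fun s t => by
      rw [mul_comm, ← LinearMap.det_comp]; congr 1; ext u; simp [mul_assoc]) t,
    det_mulR_diagUp, mon_diag]

/-- The derivative of `t ↦ t t⋆`, as an endomorphism of the upper triangular elements. -/
def dsq : A.Up →ₗ[ℝ] A.Up →ₗ[ℝ] A.Up := A.sqB.compr₂ A.symE.symm.toLinearMap

theorem dsq_apply (t h : A.Up) : A.dsq t h = A.symE.symm (A.sqB t h) := rfl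

theorem symL_diagUp (a : Fin r → ℝ) (h : A.Up) :
    A.sqB (A.diagUp a) h = A.symL (h * A.diagUp a) := V.ext (by
  rw [sqB_apply, incl_symL, upIncl_mul, A.star_mul, star_diagUp, add_comm])

theorem dsq_diagUp (a : Fin r → ℝ) : A.dsq (A.diagUp a) = A.mulR (A.diagUp a) := by
  ext h
  rw [dsq_apply, symL_diagUp, ← symE_apply, ContinuousLinearEquiv.symm_apply_apply, mulR_apply]

theorem sqB_mul (t h : A.Up) : A.sqB t (t * h) = A.piL t (A.symL h) := by
  have h1 := A.sq_add t (t * h)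
  have h2 : A.sq (t + t * h) = A.piL t (A.sq (1 + h)) := by
    rw [piL_sq, mul_add, mul_one]
  have h3 : A.symL h = A.sq (1 + h) - A.sq 1 - A.sq h := A.symL_eq h
  rw [h3, map_sub, map_sub, ← h2, piL_sq, piL_sq, mul_one, h1]
  abel

/-- Since the square of t(1 + h) is the image under π(t) of the square of 1 + h, the derivative at t
in the direction t h is π(t)(h + h⋆). Hence the Jacobian is the quotient of the characters det π(t)
and det of left multiplication, so it is itself a character; on diagonal elements it agrees with
right multiplication. -/
theorem dsq_comp_mulL (t : A.Up) :
    A.dsq t ∘ₗ A.mulL t = A.symE.symm.toLinearMap ∘ₗ A.piL t ∘ₗ A.symE.toLinearMap := by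
  ext h
  change A.symE.symm (A.sqB t (t * h)) = A.symE.symm (A.piL t (A.symE h))
  rw [sqB_mul]; rfl

theorem det_dsq_mul_det_mulL (t : A.Up) :
    LinearMap.det (A.dsq t) * LinearMap.det (A.mulL t) = LinearMap.det (A.piL t) := by
  rw [← LinearMap.det_comp, dsq_comp_mulL]
  exact LinearMap.det_conj (A.piL t) A.symE.symm.toLinearEquiv

theorem det_dsq (t : A.Hg) :
    LinearMap.det (A.dsq t) = A.mon (fun i => 1 + A.nn i) t := by
  rw [A.character_eq_diag (K := fun t => LinearMap.det (A.dsq t)) (continuous_det_linear A.dsq)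
    ?_ ?_ t, dsq_diagUp, det_mulR_diagUp, mon_diag]
  · have h := A.det_dsq_mul_det_mulL 1
    rw [piL_one, LinearMap.det_id] at h
    simpa [mulL] using h
  · intro s t
    have h := A.det_dsq_mul_det_mulL ((s : A.Up) * t)
    have hL : LinearMap.det (A.mulL ((s : A.Up) * t)) =
        LinearMap.det (A.mulL s) * LinearMap.det (A.mulL t) := by
      rw [← LinearMap.det_comp]; congr 1; ext u; simp [mul_assoc]
    rw [piL_mul, LinearMap.det_comp, ← det_dsq_mul_det_mulL, ← det_dsq_mul_det_mulL, hL] at h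
    have hs : LinearMap.det (A.mulL s) ≠ 0 := by rw [det_mulL]; exact (A.mon_pos _ s).ne'
    have ht : LinearMap.det (A.mulL t) ≠ 0 := by rw [det_mulL]; exact (A.mon_pos _ t).ne'
    refine mul_right_cancel₀ (mul_ne_zero hs ht) ?_
    rw [h]; ring

end TAlgebra

end

open MeasureTheory Set
open scoped ENNReal NNReal SchwartzMap

set_option linter.unusedSectionVars false

noncomputable section

namespace TAlgebra

variable {r : ℕ} {U : Type*} [NormedAddCommGroup U] [InnerProductSpace ℝ U] (A : TAlgebra r U)

variable [FiniteDimensional ℝ U]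

open scoped Topology

/-! ### Integration over the cone and over the group `H` -/

theorem exists_volume_eq_smul_map {E F : Type*} [NormedAddCommGroup E] [NormedSpace ℝ E]
    [FiniteDimensional ℝ E] [MeasurableSpace E] [BorelSpace E]
    [NormedAddCommGroup F] [NormedSpace ℝ F] [FiniteDimensional ℝ F]
    [MeasurableSpace F] [BorelSpace F] (μ : Measure E) [μ.IsAddHaarMeasure]
    (ν : Measure F) [ν.IsAddHaarMeasure] (e : E ≃L[ℝ] F) :
    ∃ c : ℝ≥0, ν = c • μ.map e := by
  have : (μ.map e).IsAddHaarMeasure := e.isAddHaarMeasure_map μ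
  exact ⟨_, Measure.isAddLeftInvariant_eq_smul ν (μ.map e)⟩

theorem measurableSet_Hset : MeasurableSet A.Hset := A.isOpen_Hset.measurableSet

theorem hasFDerivAt_symE_symm_sq (t : A.Up) :
    HasFDerivAt (fun t => A.symE.symm (A.sq t)) (A.dsq t).toContinuousLinearMap t :=
  (A.symE.symm.toContinuousLinearMap.hasFDerivAt.comp t
    (A.hasStrictFDerivAt_sq t).hasFDerivAt).congr_fderiv (by ext h; rfl)

theorem injOn_sq : InjOn A.sq A.Hset := by
  intro s hs t ht h
  obtain ⟨s, rfl⟩ := exists_Hg_eq hs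
  obtain ⟨t, rfl⟩ := exists_Hg_eq ht
  rw [A.sq_injective_Hg h]

/-- Change of variables y = t t⋆, read in the linear chart `symE`. The constant compares Lebesgue
measure on V with its image from `Up`. -/
theorem exists_lintegral_cone_eq : ∃ c : ℝ≥0, ∀ G : A.V → ℝ≥0∞,
    ∫⁻ y in A.cone, G y = c * ∫⁻ t in A.Hset,
      ENNReal.ofReal (A.mon (fun i => 1 + A.nn i) t) * G (A.sq t) := by
  obtain ⟨c, hc⟩ := exists_volume_eq_smul_map (volume : Measure A.Up) (volume : Measure A.V) A.symE
  refine ⟨c, fun G => ?_⟩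
  have hset : A.symE ⁻¹' A.cone = (fun t => A.symE.symm (A.sq t)) '' A.Hset := by
    rw [cone_eq_image]
    ext t
    constructor
    · rintro ⟨s, hs, h⟩
      exact ⟨s, hs, by simp [h]⟩
    · rintro ⟨s, hs, rfl⟩
      exact ⟨s, hs, by simp⟩
  have h1 := lintegral_image_eq_lintegral_abs_det_fderiv_mul (volume : Measure A.Up)
    A.measurableSet_Hset (fun t _ => (A.hasFDerivAt_symE_symm_sq t).hasFDerivWithinAt)
    (fun s hs t ht h => A.injOn_sq hs ht (A.symE.symm.injective h)) (fun t => G (A.symE t))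
  rw [← hset] at h1
  have h2 : ∫⁻ y in A.cone, G y = c * ∫⁻ t in A.symE ⁻¹' A.cone, G (A.symE t) := by
    conv_lhs => rw [hc]
    rw [Measure.restrict_smul, lintegral_smul_measure]
    have : (Measure.map A.symE volume).restrict A.cone =
        (volume.restrict (A.symE ⁻¹' A.cone)).map A.symE.toHomeomorph.toMeasurableEquiv :=
      A.symE.toHomeomorph.toMeasurableEquiv.restrict_map volume A.cone
    rw [this, lintegral_map_equiv]; rfl
  rw [h2, h1]
  congr 1
  refine setLIntegral_congr_fun A.measurableSet_Hset fun t ht => ?_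
  obtain ⟨t, rfl⟩ := exists_Hg_eq ht
  simp only [LinearMap.det_toContinuousLinearMap, det_dsq, ContinuousLinearEquiv.apply_symm_apply]
  rw [abs_of_pos (A.mon_pos _ t)]

theorem lintegral_Hset_mulL (v : A.Hg) (F : A.Up → ℝ≥0∞) :
    ∫⁻ t in A.Hset, F t = ENNReal.ofReal (A.mon (fun i => 1 + A.mm i) v) *
      ∫⁻ t in A.Hset, F ((v : A.Up) * t) := by
  have hset : (A.mulL v).toContinuousLinearMap '' A.Hset = A.Hset := by
    ext t
    constructor
    · rintro ⟨s, hs, rfl⟩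
      obtain ⟨s, rfl⟩ := exists_Hg_eq hs
      exact (v * s).mem_Hset
    · intro ht
      obtain ⟨t, rfl⟩ := exists_Hg_eq ht
      exact ⟨(v⁻¹ * t : A.Hg), (v⁻¹ * t).mem_Hset, by
        change (v : A.Up) * (v⁻¹ * t : A.Hg) = t
        rw [← Hg.coe_mul, mul_inv_cancel_left]⟩
  have h1 := lintegral_image_eq_lintegral_abs_det_fderiv_mul (volume : Measure A.Up)
    A.measurableSet_Hset
    (fun t _ => ((A.mulL v).toContinuousLinearMap.hasFDerivAt (x := t)).hasFDerivWithinAt)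
    (by
      intro s hs t ht h
      have h2 := congrArg (fun x : A.Up => ((v⁻¹ : A.Hg) : A.Up) * x) h
      change ((v⁻¹ : A.Hg) : A.Up) * (v * s) = (v⁻¹ : A.Hg) * (v * t) at h2
      rwa [← mul_assoc, ← mul_assoc, Hg.coe_inv_mul, one_mul, one_mul] at h2) F
  rw [hset] at h1
  rw [h1, ← lintegral_const_mul' _ _ ENNReal.ofReal_ne_top]
  simp only [LinearMap.det_toContinuousLinearMap, det_mulL]
  rw [abs_of_pos (A.mon_pos _ v)]
  rfl

theorem lintegral_image_mulR (v : A.Hg) {N : Set A.Up} (hN : MeasurableSet N) (F : A.Up → ℝ≥0∞) :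
    ∫⁻ t in (fun u => u * (v : A.Up)) '' N, F t = ENNReal.ofReal (A.mon (fun i => 1 + A.nn i) v) *
      ∫⁻ t in N, F (t * (v : A.Up)) := by
  have h1 := lintegral_image_eq_lintegral_abs_det_fderiv_mul (volume : Measure A.Up) hN
    (fun t _ => ((A.mulR v).toContinuousLinearMap.hasFDerivAt (x := t)).hasFDerivWithinAt)
    (by
      intro s hs t ht h
      have h2 := congrArg (fun x : A.Up => x * ((v⁻¹ : A.Hg) : A.Up)) h
      change s * v * ((v⁻¹ : A.Hg) : A.Up) = t * v * (v⁻¹ : A.Hg) at h2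
      rwa [mul_assoc, mul_assoc, Hg.coe_mul_inv, mul_one, mul_one] at h2) F
  change ∫⁻ t in (fun u => u * (v : A.Up)) '' N, F t = _ at h1
  rw [h1, ← lintegral_const_mul' _ _ ENNReal.ofReal_ne_top]
  simp only [LinearMap.det_toContinuousLinearMap, det_mulR]
  rw [abs_of_pos (A.mon_pos _ v)]
  rfl

/-! ### Integrability of monomials on the triangular group -/

theorem integrableOn_rpow_mul_one_add_rpow {κ M : ℝ} (hκ : -1 < κ) (hM : κ + 1 < M) :
    IntegrableOn (fun x : ℝ => x ^ κ * (1 + x) ^ (-M)) (Ioi 0) := by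
  have hM0 : 0 < M := by linarith
  have hmeas : Measurable fun x : ℝ => x ^ κ * (1 + x) ^ (-M) := by fun_prop
  rw [← Ioc_union_Ioi_eq_Ioi (zero_le_one (α := ℝ))]
  refine IntegrableOn.union ?_ ?_
  · have h : IntegrableOn (fun x : ℝ => x ^ κ) (Ioc 0 1) := by
      have := intervalIntegral.intervalIntegrable_rpow' (a := 0) (b := 1) hκ
      rwa [intervalIntegrable_iff_integrableOn_Ioc_of_le zero_le_one] at this
    refine Integrable.mono' h hmeas.aestronglyMeasurable ?_
    refine (ae_restrict_iff' measurableSet_Ioc).2 (Filter.Eventually.of_forall fun x hx => ?_)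
    have h1 : (1 + x) ^ (-M) ≤ 1 :=
      Real.rpow_le_one_of_one_le_of_nonpos (by linarith [hx.1]) (by linarith)
    have h0 : 0 ≤ (1 + x) ^ (-M) := Real.rpow_nonneg (by linarith [hx.1]) _
    have h2 : 0 ≤ x ^ κ := Real.rpow_nonneg hx.1.le _
    rw [Real.norm_of_nonneg (mul_nonneg h2 h0)]
    exact mul_le_of_le_one_right h2 h1
  · have h := integrableOn_Ioi_rpow_of_lt (a := κ - M) (by linarith) one_pos
    refine Integrable.mono' h hmeas.aestronglyMeasurable ?_
    refine (ae_restrict_iff' measurableSet_Ioi).2 (Filter.Eventually.of_forall fun x hx => ?_)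
    have hx0 : 0 < x := zero_lt_one.trans hx
    have h1 : (1 + x) ^ (-M) ≤ x ^ (-M) :=
      Real.rpow_le_rpow_of_nonpos hx0 (by linarith) (by linarith)
    have h0 : 0 ≤ (1 + x) ^ (-M) := Real.rpow_nonneg (by linarith) _
    have h2 : 0 ≤ x ^ κ := Real.rpow_nonneg hx0.le _
    rw [Real.norm_of_nonneg (mul_nonneg h2 h0), sub_eq_add_neg, Real.rpow_add hx0]
    gcongr

/-- The diagonal coefficients, as a linear map. -/
def dgs : A.Up →ₗ[ℝ] (Fin r → ℝ) := LinearMap.pi A.dg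

theorem dgs_diagUp (a : Fin r → ℝ) : A.dgs (A.diagUp a) = a := by
  ext i; exact A.dg_diagUp a i

/-- Coordinates on the upper triangular elements, given by the diagonal coefficients and by the
strictly upper triangular part. -/
def dgsEquiv : A.Up ≃L[ℝ] (Fin r → ℝ) ×
    EuclideanSpace ℝ (Fin (Module.finrank ℝ (LinearMap.ker A.dgs))) :=
  (LinearEquiv.toContinuousLinearEquiv
    { toFun := fun t => (A.dgs t, (⟨t - A.diagUp (A.dgs t), by
        rw [LinearMap.mem_ker, map_sub, dgs_diagUp, sub_self]⟩ : LinearMap.ker A.dgs))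
      map_add' := fun s t => by
        refine Prod.ext (map_add _ _ _) (Subtype.ext (Up.ext ?_))
        simp only [map_add, map_sub, upIncl_diagUp, Pi.add_apply, add_smul,
          Finset.sum_add_distrib, Prod.snd_add, Submodule.coe_add]
        abel
      map_smul' := fun a t => by
        refine Prod.ext (map_smul _ _ _) (Subtype.ext (Up.ext ?_))
        simp [map_smul, map_sub, upIncl_diagUp, smul_sub, Finset.smul_sum, smul_smul]
      invFun := fun z => A.diagUp z.1 + z.2
      left_inv := fun t => by simp
      right_inv := fun z => by
        have h : A.dgs (z.2 : A.Up) = 0 := z.2.2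
        refine Prod.ext ?_ (Subtype.ext ?_)
        · simp [dgs_diagUp, h]
        · simp [dgs_diagUp, h] }).trans
  ((ContinuousLinearEquiv.refl ℝ _).prodCongr
    (stdOrthonormalBasis ℝ (LinearMap.ker A.dgs)).repr.toContinuousLinearEquiv)

theorem dgsEquiv_fst (t : A.Up) (i : Fin r) : (A.dgsEquiv t).1 i = A.dg i t := rfl

/-- The decay of total order M r + M is distributed: one factor (1 + ‖t‖)^{-M} for each diagonal
coordinate and one for the strictly upper part. The integrand is then dominated by a product of
one-variable functions and a function on a Euclidean space. The condition κ_i > -1 controls t_ii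
near 0 and a large M controls infinity. -/
theorem exists_integrableOn_mon_mul_one_add {κ : Fin r → ℝ} (hκ : ∀ i, -1 < κ i) :
    ∃ M : ℝ, 0 < M ∧
      IntegrableOn (fun t : A.Up => A.mon κ t * (1 + ‖t‖) ^ (-M)) A.Hset := by
  set k := Module.finrank ℝ (LinearMap.ker A.dgs)
  obtain ⟨B, hB⟩ : ∃ B : ℝ, ∀ i, κ i + 1 < B := by
    obtain ⟨B, hB⟩ := (finite_range κ).bddAbove
    exact ⟨B + 2, fun i => by linarith [hB ⟨i, rfl⟩]⟩
  set M : ℝ := max 1 (max B (k + 1))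
  have hM1 : 1 ≤ M := le_max_left _ _
  have hMκ : ∀ i, κ i + 1 < M := fun i =>
    (hB i).trans_le ((le_max_left _ _).trans (le_max_right _ _))
  have hMk : (k : ℝ) < M :=
    (lt_add_one _).trans_le ((le_max_right _ _).trans (le_max_right _ _))
  obtain ⟨c, hc⟩ := exists_volume_eq_smul_map
    ((volume : Measure (Fin r → ℝ)).prod (volume : Measure (EuclideanSpace ℝ (Fin k))))
    (volume : Measure A.Up) A.dgsEquiv.symm
  set D : ℝ := ‖A.dgsEquiv.toContinuousLinearMap‖ + 1
  have hD : 1 ≤ D := by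
    have := norm_nonneg A.dgsEquiv.toContinuousLinearMap
    simp only [D]
    linarith
  let g : Fin r → ℝ → ℝ := fun i => (Ioi 0).indicator fun x => x ^ κ i * (1 + x) ^ (-M)
  have hg : ∀ i, Integrable (g i) := fun i =>
    (integrable_indicator_iff measurableSet_Ioi).2
      (integrableOn_rpow_mul_one_add_rpow (hκ i) (hMκ i))
  have hn : Integrable fun x : EuclideanSpace ℝ (Fin k) => (1 + ‖x‖) ^ (-M) :=
    integrable_one_add_norm (by simpa using hMk)
  have hprod : Integrable fun z : (Fin r → ℝ) × EuclideanSpace ℝ (Fin k) =>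
      (∏ i, g i (z.1 i)) * (1 + ‖z.2‖) ^ (-M) :=
    Integrable.mul_prod (Integrable.fintype_prod hg) hn
  have hUp : Integrable fun t : A.Up =>
      (∏ i, g i ((A.dgsEquiv t).1 i)) * (1 + ‖(A.dgsEquiv t).2‖) ^ (-M) := by
    rw [hc]
    refine Integrable.smul_measure ?_ ENNReal.coe_ne_top
    have := (integrable_map_equiv A.dgsEquiv.symm.toHomeomorph.toMeasurableEquiv
      (fun t : A.Up => (∏ i, g i ((A.dgsEquiv t).1 i)) * (1 + ‖(A.dgsEquiv t).2‖) ^ (-M))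
      (μ := (volume : Measure (Fin r → ℝ)).prod
        (volume : Measure (EuclideanSpace ℝ (Fin k))))).2 ?_
    · exact this
    · refine hprod.congr (Filter.Eventually.of_forall fun z => ?_)
      change _ = (∏ i, g i ((A.dgsEquiv (A.dgsEquiv.symm z)).1 i)) *
        (1 + ‖(A.dgsEquiv (A.dgsEquiv.symm z)).2‖) ^ (-M)
      rw [ContinuousLinearEquiv.apply_symm_apply]
  refine ⟨M * r + M, by positivity, ?_⟩
  refine Integrable.mono' (hUp.const_mul (D ^ M)).integrableOn ?_ ?_
  · have h1 : Measurable fun t : A.Up => A.mon κ t :=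
      Finset.measurable_fun_prod _ fun i _ => (A.continuous_dg i).measurable.pow_const _
    exact (h1.mul (by fun_prop)).aestronglyMeasurable
  · refine (ae_restrict_iff' A.measurableSet_Hset).2 (Filter.Eventually.of_forall fun t ht => ?_)
    obtain ⟨t, rfl⟩ := exists_Hg_eq ht
    have hN : 0 < 1 + ‖(t : A.Up)‖ := by positivity
    rw [Real.norm_of_nonneg (mul_nonneg (A.mon_pos _ t).le (Real.rpow_nonneg hN.le _)),
      neg_add, Real.rpow_add hN, neg_mul_eq_neg_mul, Real.rpow_mul hN.le, Real.rpow_natCast,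
      ← mul_assoc, mon]
    have h1 : (∏ i, A.dg i (t : A.Up) ^ κ i) * ((1 + ‖(t : A.Up)‖) ^ (-M)) ^ r ≤
        ∏ i, g i ((A.dgsEquiv (t : A.Up)).1 i) := by
      rw [← Fin.prod_const r, ← Finset.prod_mul_distrib]
      refine Finset.prod_le_prod (fun i _ => ?_) fun i _ => ?_
      · exact mul_nonneg (Real.rpow_nonneg (t.pos i).le _) (Real.rpow_nonneg hN.le _)
      · rw [dgsEquiv_fst]
        simp only [g, indicator_of_mem (mem_Ioi.2 (t.pos i))]
        refine mul_le_mul_of_nonneg_left ?_ (Real.rpow_nonneg (t.pos i).le _)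
        refine Real.rpow_le_rpow_of_nonpos (by linarith [t.pos i]) ?_ (by linarith)
        have := A.abs_dg_le i (t : A.Up)
        linarith [(abs_le.1 this).2]
    have h2 : (1 + ‖(t : A.Up)‖) ^ (-M) ≤ D ^ M * (1 + ‖(A.dgsEquiv (t : A.Up)).2‖) ^ (-M) := by
      have h3 : 1 + ‖(A.dgsEquiv (t : A.Up)).2‖ ≤ D * (1 + ‖(t : A.Up)‖) := by
        have h4 : ‖(A.dgsEquiv (t : A.Up)).2‖ ≤ ‖A.dgsEquiv (t : A.Up)‖ := norm_snd_le _
        have h5 : ‖A.dgsEquiv (t : A.Up)‖ ≤ ‖A.dgsEquiv.toContinuousLinearMap‖ * ‖(t : A.Up)‖ :=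
          A.dgsEquiv.toContinuousLinearMap.le_opNorm _
        have := norm_nonneg (t : A.Up)
        simp only [D] at hD ⊢
        nlinarith
      have h6 := Real.rpow_le_rpow_of_nonpos (z := -M) (by positivity) h3 (by linarith)
      rw [Real.mul_rpow (by linarith) hN.le] at h6
      have h7 : D ^ M * D ^ (-M) = 1 := by
        rw [← Real.rpow_add (by linarith), add_neg_cancel, Real.rpow_zero]
      calc (1 + ‖(t : A.Up)‖) ^ (-M) = D ^ M * (D ^ (-M) * (1 + ‖(t : A.Up)‖) ^ (-M)) := by
            rw [← mul_assoc, h7, one_mul]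
        _ ≤ _ := by gcongr
    calc _ ≤ (∏ i, g i ((A.dgsEquiv (t : A.Up)).1 i)) *
          (D ^ M * (1 + ‖(A.dgsEquiv (t : A.Up)).2‖) ^ (-M)) := by
          refine mul_le_mul h1 h2 (Real.rpow_nonneg hN.le _) ?_
          refine le_trans ?_ h1
          exact mul_nonneg (Finset.prod_nonneg fun i _ => Real.rpow_nonneg (t.pos i).le _)
            (pow_nonneg (Real.rpow_nonneg hN.le _) _)
      _ = _ := by ring

theorem measurable_mon (κ : Fin r → ℝ) : Measurable fun t : A.Up => A.mon κ t :=
  Finset.measurable_fun_prod _ fun i _ => (A.continuous_dg i).measurable.pow_const _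

theorem exp_neg_mul_sq_le {γ M x : ℝ} (hγ : 0 < γ) (hM : 0 ≤ M) (hx : 0 ≤ x) :
    Real.exp (-(γ * x ^ 2)) ≤ Real.exp (M ^ 2 / (4 * γ)) * (1 + x) ^ (-M) := by
  have h1 : (1 + x) ^ M ≤ Real.exp (M * x) := by
    rw [mul_comm, Real.exp_mul]
    exact Real.rpow_le_rpow (by linarith) (by linarith [Real.add_one_le_exp x]) hM
  have h2 : Real.exp (-(γ * x ^ 2)) * (1 + x) ^ M ≤ Real.exp (M ^ 2 / (4 * γ)) := by
    refine (mul_le_mul_of_nonneg_left h1 (Real.exp_pos _).le).trans ?_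
    rw [← Real.exp_add, Real.exp_le_exp, le_div_iff₀ (by positivity)]
    -- Completing the square: M x - γ x² ≤ M²/(4γ).
    nlinarith [sq_nonneg (2 * γ * x - M)]
  rw [Real.rpow_neg (by linarith), ← div_eq_mul_inv, le_div_iff₀ (by positivity)]
  exact h2

theorem integrableOn_mon_mul_exp {κ : Fin r → ℝ} (hκ : ∀ i, -1 < κ i) {γ : ℝ} (hγ : 0 < γ) :
    IntegrableOn (fun t : A.Up => A.mon κ t * Real.exp (-(γ * ‖t‖ ^ 2))) A.Hset := by
  obtain ⟨M, hM, h⟩ := A.exists_integrableOn_mon_mul_one_add hκ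
  refine Integrable.mono' (h.const_mul (Real.exp (M ^ 2 / (4 * γ)))) ?_ ?_
  · exact ((A.measurable_mon κ).mul (by fun_prop)).aestronglyMeasurable
  · refine (ae_restrict_iff' A.measurableSet_Hset).2 (Filter.Eventually.of_forall fun t ht => ?_)
    obtain ⟨t, rfl⟩ := exists_Hg_eq ht
    rw [Real.norm_of_nonneg (mul_nonneg (A.mon_pos _ t).le (Real.exp_pos _).le)]
    have := mul_le_mul_of_nonneg_left (exp_neg_mul_sq_le hγ hM.le (norm_nonneg (t : A.Up)))
      (A.mon_pos κ t).le
    linarith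

end TAlgebra

end

open MeasureTheory Set
open scoped ENNReal NNReal SchwartzMap

set_option linter.unusedSectionVars false

noncomputable section

namespace TAlgebra

variable {r : ℕ} {U : Type*} [NormedAddCommGroup U] [InnerProductSpace ℝ U] (A : TAlgebra r U)

variable [FiniteDimensional ℝ U]

open scoped Topology

/-! ### Bounded subsets of the group `H`, sums over separated families -/

/-- A bounded subset of the group `H`. -/
def bddH (M : ℝ) : Set A.Hg := {t | ‖(t : A.Up)‖ ≤ M ∧ ‖((t⁻¹ : A.Hg) : A.Up)‖ ≤ M}

theorem inv_mem_bddH {M : ℝ} {t : A.Hg} (ht : t ∈ A.bddH M) : t⁻¹ ∈ A.bddH M :=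
  ⟨ht.2, by rw [inv_inv]; exact ht.1⟩

theorem mul_mem_bddH {M N : ℝ} {s t : A.Hg} (hs : s ∈ A.bddH M) (ht : t ∈ A.bddH N) :
    s * t ∈ A.bddH (A.cb * M * N) := by
  have := A.cb_pos
  have h1 := hs.1
  have h2 := hs.2
  have h3 := ht.1
  have h4 := ht.2
  have h0 : 0 ≤ M := (norm_nonneg _).trans h1
  have h0' : 0 ≤ N := (norm_nonneg _).trans h3
  constructor
  · rw [Hg.coe_mul]
    exact (A.norm_upMul_le _ _).trans (by gcongr)
  · rw [mul_inv_rev, Hg.coe_mul]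
    calc _ ≤ A.cb * ‖((t⁻¹ : A.Hg) : A.Up)‖ * ‖((s⁻¹ : A.Hg) : A.Up)‖ := A.norm_upMul_le _ _
      _ ≤ A.cb * N * M := by gcongr
      _ = _ := by ring

theorem norm_le_of_mem_bddH {M : ℝ} {s : A.Hg} (hs : s ∈ A.bddH M) (t : A.Up) :
    ‖(s : A.Up) * t‖ ≤ A.cb * M * ‖t‖ := by
  have := A.cb_pos
  have h1 := hs.1
  exact (A.norm_upMul_le _ _).trans (by gcongr)

theorem abs_log_dg_le {M : ℝ} {t : A.Hg} (ht : t ∈ A.bddH M) (i : Fin r) :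
    |Real.log (A.dg i (t : A.Up))| ≤ Real.log M := by
  have h1 : A.dg i (t : A.Up) ≤ M := ((abs_le.1 (A.abs_dg_le i (t : A.Up))).2).trans ht.1
  have h2 : (A.dg i (t : A.Up))⁻¹ ≤ M := by
    rw [← Hg.dg_inv]; exact ((abs_le.1 (A.abs_dg_le i _)).2).trans ht.2
  rw [abs_le]
  constructor
  · have := Real.log_le_log (inv_pos.2 (t.pos i)) h2
    rw [Real.log_inv] at this; linarith
  · exact Real.log_le_log (t.pos i) h1

theorem exists_le_mon (a : Fin r → ℝ) (M : ℝ) :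
    ∃ c : ℝ, 0 < c ∧ ∀ t ∈ A.bddH M, c ≤ A.mon a t := by
  refine ⟨Real.exp (-∑ i, |a i| * Real.log M), Real.exp_pos _, fun t ht => ?_⟩
  have h : A.mon a t = Real.exp (∑ i, Real.log (A.dg i (t : A.Up)) * a i) := by
    rw [mon, Real.exp_sum]
    exact Finset.prod_congr rfl fun i _ => Real.rpow_def_of_pos (t.pos i) _
  rw [h, Real.exp_le_exp, ← Finset.sum_neg_distrib]
  refine Finset.sum_le_sum fun i _ => ?_
  have h1 : |Real.log (A.dg i (t : A.Up)) * a i| ≤ |a i| * Real.log M := by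
    rw [abs_mul, mul_comm]
    exact mul_le_mul_of_nonneg_left (A.abs_log_dg_le ht i) (abs_nonneg _)
  linarith [(abs_le.1 h1).1]

/-- A radius for which the ball at the unit is contained in the group `H`. -/
def rad : ℝ := 1 / (2 * A.cb)

theorem rad_pos : 0 < A.rad := by have := A.cb_pos; unfold rad; positivity

/-- The value 1/(2 `cb`) of `rad` is chosen for this bound: left multiplication by u then distorts
norms by a factor at most 2 in either direction. -/
theorem norm_sub_le_of_ball {u : A.Up} (hu : ‖u - 1‖ < A.rad) (t : A.Up) :
    ‖u * t - t‖ ≤ ‖t‖ / 2 := by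
  have h0 := A.cb_pos
  have h : u * t - t = (u - 1) * t := by noncomm_ring
  rw [h]
  refine (A.norm_upMul_le _ _).trans ?_
  calc A.cb * ‖u - 1‖ * ‖t‖ ≤ A.cb * A.rad * ‖t‖ := by gcongr
    _ = ‖t‖ / 2 := by unfold rad; field_simp

theorem norm_le_two_mul_of_ball {u : A.Up} (hu : ‖u - 1‖ < A.rad) (t : A.Up) :
    ‖t‖ ≤ 2 * ‖u * t‖ := by
  have h1 := A.norm_sub_le_of_ball hu t
  have h2 := norm_sub_norm_le t (u * t)
  rw [norm_sub_rev] at h2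
  linarith

theorem norm_mul_le_two_of_ball {u : A.Up} (hu : ‖u - 1‖ < A.rad) (t : A.Up) :
    ‖u * t‖ ≤ 2 * ‖t‖ := by
  have h1 := A.norm_sub_le_of_ball hu t
  have h2 := norm_sub_norm_le (u * t) t
  have := norm_nonneg t
  linarith

theorem ball_subset_Hset {u : A.Up} (hu : ‖u - 1‖ < A.rad) : u ∈ A.Hset := by
  intro i
  have h1 : |A.dg i (u - 1)| ≤ ‖u - 1‖ := A.abs_dg_le i _
  rw [map_sub, dg_one] at h1
  have h2 : A.rad < 1 := by
    have := A.one_le_cb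
    rw [rad, div_lt_one (by linarith)]; linarith
  linarith [(abs_le.1 h1).1]

theorem mem_bddH_of_ball {u : A.Hg} (hu : ‖(u : A.Up) - 1‖ < A.rad) :
    u ∈ A.bddH (2 * ‖(1 : A.Up)‖) := by
  constructor
  · simpa using A.norm_mul_le_two_of_ball hu 1
  · simpa [Hg.coe_mul_inv] using A.norm_le_two_mul_of_ball hu (u⁻¹ : A.Hg)

/-- A family in `H` such that the right translates of the ball of radius `ε` at the unit are
disjoint. -/
def Separated (ε : ℝ) (v : ℕ → A.Hg) : Prop :=
  Pairwise (Function.onFun Disjoint fun j => (fun u => u * (v j : A.Up)) '' Metric.ball 1 ε)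

-- Separation with the same ε survives right translation. This makes the constants for the families
-- w_j t independent of the height t.
variable {A} in
theorem Separated.mul_right {ε : ℝ} {v : ℕ → A.Hg} (h : A.Separated ε v) (w : A.Hg) :
    A.Separated ε fun j => v j * w := by
  intro j k hjk
  rw [Function.onFun, Set.disjoint_left]
  rintro _ ⟨s, hs, rfl⟩ ⟨t, ht, h2⟩
  refine Set.disjoint_left.1 (h hjk) ⟨s, hs, rfl⟩ ⟨t, ht, ?_⟩
  have h3 := congrArg (fun x : A.Up => x * ((w⁻¹ : A.Hg) : A.Up)) h2
  simpa only [Hg.coe_mul, mul_assoc, Hg.coe_mul_inv, mul_one] using h3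

theorem isOpen_image_mulR (v : A.Hg) {N : Set A.Up} (hN : IsOpen N) :
    IsOpen ((fun u => u * (v : A.Up)) '' N) := by
  have h : (fun u => u * (v : A.Up)) '' N = (A.mulR (v⁻¹ : A.Hg)) ⁻¹' N := by
    ext t
    constructor
    · rintro ⟨u, hu, rfl⟩
      simpa [mul_assoc, Hg.coe_mul_inv] using hu
    · intro ht
      exact ⟨_, ht, by simp [mul_assoc, Hg.coe_inv_mul]⟩
  rw [h]
  exact hN.preimage (LinearMap.continuous_of_finiteDimensional _)

/-- Comparison of the sum with an integral over disjoint translates N v_j of a small ball N. On N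
v_j the function mon κ · e^{-(γ/4)‖·‖²} dominates a constant times mon κ(v_j) e^{-γ‖v_j‖²}, the
quarter paying for ‖u v_j‖ ≤ 2‖v_j‖. The volume of N v_j is that of N times mon(1 + n)(v_j). Thus κ
= α - 1 - n, and integrability requires α_i > n_i. -/
theorem exists_tsum_mon_exp_le {ε : ℝ} (hε : 0 < ε) (hε1 : ε ≤ A.rad) {α : Fin r → ℝ}
    (hα : ∀ i, A.nn i < α i) {γ : ℝ} (hγ : 0 < γ) :
    ∃ C : ℝ≥0, ∀ v : ℕ → A.Hg, A.Separated ε v →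
      ∑' j, ENNReal.ofReal (A.mon α (v j) * Real.exp (-(γ * ‖(v j : A.Up)‖ ^ 2))) ≤ C := by
  set κ : Fin r → ℝ := fun i => α i - 1 - A.nn i
  have hint := A.integrableOn_mon_mul_exp (κ := κ) (fun i => by simp only [κ]; linarith [hα i])
    (γ := γ / 4) (by positivity)
  set F : A.Up → ℝ≥0∞ := fun t =>
    ENNReal.ofReal (A.mon κ t * Real.exp (-(γ / 4 * ‖t‖ ^ 2)))
  have hF : ∫⁻ t in A.Hset, F t < ∞ := by
    have := hint.2
    rw [hasFiniteIntegral_iff_norm] at this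
    refine lt_of_le_of_lt (setLIntegral_mono' A.measurableSet_Hset fun t ht => ?_) this
    exact ENNReal.ofReal_le_ofReal (le_abs_self _)
  obtain ⟨c, hc, hmon⟩ := A.exists_le_mon κ (2 * ‖(1 : A.Up)‖)
  set N : Set A.Up := Metric.ball 1 ε
  have hN : ∀ u ∈ N, ‖u - 1‖ < A.rad := fun u hu =>
    (mem_ball_iff_norm.1 hu).trans_le hε1
  have hvol : 0 < volume N := Metric.measure_ball_pos _ _ hε
  have hvol' : volume N ≠ ∞ := measure_ball_lt_top.ne
  set I : ℝ≥0∞ := ∫⁻ t in A.Hset, F t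
  set m : ℝ≥0∞ := ENNReal.ofReal c * volume N
  have hm0 : m ≠ 0 := mul_ne_zero (ENNReal.ofReal_pos.2 hc).ne' hvol.ne'
  have hmtop : m ≠ ∞ := ENNReal.mul_ne_top ENNReal.ofReal_ne_top hvol'
  have hC : I / m ≠ ∞ := ENNReal.div_ne_top hF.ne hm0
  refine ⟨(I / m).toNNReal, fun v hv => ?_⟩
  rw [ENNReal.coe_toNNReal hC, ENNReal.le_div_iff_mul_le (Or.inl hm0) (Or.inl hmtop),
    ← ENNReal.tsum_mul_right]
  have hterm : ∀ j, ENNReal.ofReal (A.mon α (v j) * Real.exp (-(γ * ‖(v j : A.Up)‖ ^ 2))) * m ≤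
      ∫⁻ t in (fun u => u * (v j : A.Up)) '' N, F t := by
    intro j
    rw [A.lintegral_image_mulR (v j) Metric.isOpen_ball.measurableSet]
    have hle : ∀ u ∈ N, ENNReal.ofReal (c * (A.mon κ (v j) *
        Real.exp (-(γ * ‖(v j : A.Up)‖ ^ 2)))) ≤ F (u * v j) := by
      intro u hu
      obtain ⟨w, rfl⟩ := exists_Hg_eq (A.ball_subset_Hset (hN u hu))
      refine ENNReal.ofReal_le_ofReal ?_
      rw [mon_mul, mul_assoc]
      have h1 := hmon w (A.mem_bddH_of_ball (hN _ hu))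
      have h2 := A.norm_mul_le_two_of_ball (hN _ hu) (v j : A.Up)
      have h3 := A.mon_pos κ (v j)
      refine mul_le_mul h1 ?_ (by positivity) (hc.le.trans h1)
      refine mul_le_mul_of_nonneg_left (Real.exp_le_exp.2 ?_) h3.le
      have h4 : ‖(w : A.Up) * v j‖ ^ 2 ≤ (2 * ‖(v j : A.Up)‖) ^ 2 := by gcongr
      nlinarith
    calc ENNReal.ofReal (A.mon α (v j) * Real.exp (-(γ * ‖(v j : A.Up)‖ ^ 2))) * m
        = ENNReal.ofReal (A.mon (fun i => 1 + A.nn i) (v j)) *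
          (ENNReal.ofReal (c * (A.mon κ (v j) * Real.exp (-(γ * ‖(v j : A.Up)‖ ^ 2)))) *
            volume N) := by
          have h3 := A.mon_pos κ (v j)
          have h4 := A.mon_pos (fun i => 1 + A.nn i) (v j)
          have h5 : A.mon α (v j) = A.mon (fun i => 1 + A.nn i) (v j) * A.mon κ (v j) := by
            rw [← mon_add]; congr 1; ext i; simp only [κ]; ring
          rw [h5, ENNReal.ofReal_mul hc.le, mul_assoc, ENNReal.ofReal_mul h4.le]
          ring
      _ ≤ _ := by
          gcongr
          rw [← setLIntegral_const]
          exact setLIntegral_mono' Metric.isOpen_ball.measurableSet hle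
  calc _ ≤ ∑' j, ∫⁻ t in (fun u => u * (v j : A.Up)) '' N, F t := ENNReal.tsum_le_tsum hterm
    _ = ∫⁻ t in ⋃ j, (fun u => u * (v j : A.Up)) '' N, F t :=
        (lintegral_iUnion (fun j => (A.isOpen_image_mulR (v j) Metric.isOpen_ball).measurableSet)
          hv _).symm
    _ ≤ I := by
        refine lintegral_mono_set (iUnion_subset fun j => ?_)
        rintro _ ⟨u, hu, rfl⟩
        obtain ⟨w, rfl⟩ := exists_Hg_eq (A.ball_subset_Hset (hN u hu))
        exact (w * v j).mem_Hset

/-- Every index with v_j z in a fixed bounded set contributes at least b to the uniformly bounded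
sum of `exists_tsum_mon_exp_le`, applied to the translated family v_j z. -/
theorem exists_card_le {ε : ℝ} (hε : 0 < ε) (hε1 : ε ≤ A.rad) (M : ℝ) :
    ∃ N : ℕ, ∀ v : ℕ → A.Hg, A.Separated ε v → ∀ z : A.Hg, ∀ J : Finset ℕ,
      (∀ j ∈ J, v j * z ∈ A.bddH M) → J.card ≤ N := by
  obtain ⟨C, hC⟩ := A.exists_tsum_mon_exp_le hε hε1 (α := fun i => A.nn i + 1)
    (fun i => lt_add_one _) one_pos
  obtain ⟨c, hc, hmon⟩ := A.exists_le_mon (fun i => A.nn i + 1) M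
  set b : ℝ := c * Real.exp (-M ^ 2)
  have hb : 0 < b := by positivity
  refine ⟨⌈C / b⌉₊, fun v hv z J hJ => ?_⟩
  have h1 := hC _ (hv.mul_right z)
  have h2 : (J.card : ℝ≥0∞) * ENNReal.ofReal b ≤ C := by
    refine le_trans ?_ ((ENNReal.sum_le_tsum J).trans h1)
    rw [← nsmul_eq_mul, ← Finset.sum_const]
    refine Finset.sum_le_sum fun j hj => ENNReal.ofReal_le_ofReal ?_
    refine mul_le_mul (hmon _ (hJ j hj)) (Real.exp_le_exp.2 ?_) (Real.exp_pos _).le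
      (A.mon_pos _ _).le
    rw [one_mul, neg_le_neg_iff]
    exact pow_le_pow_left₀ (norm_nonneg _) (hJ j hj).1 2
  have h3 : (J.card : ℝ) * b ≤ C := by
    have := ENNReal.toReal_mono ENNReal.coe_ne_top h2
    simpa [ENNReal.toReal_ofReal hb.le] using this
  have h4 : (J.card : ℝ) ≤ C / b := (le_div_iff₀ hb).2 h3
  exact_mod_cast h4.trans (Nat.le_ceil _)

/-- The integral `∫_Ω e^{-γ (y|ξ)} Q^ν (y) Q^{-ρ} (y) Q*^{-ρ}(ξ) Q^{-τ} (y) dy` in triangular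
coordinates. -/
theorem exists_lintegral_mon_exp_le {ν ρ : Fin r → ℝ} (h : ∀ i, A.mm i < ν i - ρ i)
    {γ : ℝ} (hγ : 0 < γ) :
    ∃ C : ℝ≥0, ∀ v : A.Hg,
      ∫⁻ t in A.Hset, ENNReal.ofReal (A.mon (fun i => -ρ i) ((v : A.Up) * t) *
          Real.exp (-(γ * ‖(v : A.Up) * t‖ ^ 2))) *
        ENNReal.ofReal (A.mon (fun i => ν i - 1 - A.mm i) t) ≤
      C * ENNReal.ofReal (A.mon (fun i => -ν i) v) := by
  set κ : Fin r → ℝ := fun i => -ρ i + (ν i - 1 - A.mm i)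
  have hint := A.integrableOn_mon_mul_exp (κ := κ) (fun i => by simp only [κ]; linarith [h i]) hγ
  set F : A.Up → ℝ≥0∞ := fun t => ENNReal.ofReal (A.mon κ t * Real.exp (-(γ * ‖t‖ ^ 2)))
  have hF : ∫⁻ t in A.Hset, F t < ∞ := by
    have := hint.2
    rw [hasFiniteIntegral_iff_norm] at this
    refine lt_of_le_of_lt (setLIntegral_mono' A.measurableSet_Hset fun t ht => ?_) this
    exact ENNReal.ofReal_le_ofReal (le_abs_self _)
  refine ⟨(∫⁻ t in A.Hset, F t).toNNReal, fun v => ?_⟩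
  have h1 : ∀ t ∈ A.Hset, F ((v : A.Up) * t) =
      ENNReal.ofReal (A.mon (fun i => ν i - 1 - A.mm i) v) *
        (ENNReal.ofReal (A.mon (fun i => -ρ i) ((v : A.Up) * t) *
          Real.exp (-(γ * ‖(v : A.Up) * t‖ ^ 2))) *
        ENNReal.ofReal (A.mon (fun i => ν i - 1 - A.mm i) t)) := by
    intro t ht
    obtain ⟨t, rfl⟩ := exists_Hg_eq ht
    have e1 : A.mon κ ((v : A.Up) * t) = A.mon (fun i => ν i - 1 - A.mm i) v *
        (A.mon (fun i => -ρ i) ((v : A.Up) * t) * A.mon (fun i => ν i - 1 - A.mm i) t) := by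
      rw [← Hg.coe_mul, mon_add, Hg.coe_mul, A.mon_mul (fun i => ν i - 1 - A.mm i)]
      ring
    have p1 := (A.mon_pos (fun i => ν i - 1 - A.mm i) v).le
    have p2 := (A.mon_pos (fun i => ν i - 1 - A.mm i) t).le
    have p3 := (A.mon_pos (fun i => -ρ i) (v * t)).le
    rw [Hg.coe_mul] at p3
    rw [← ENNReal.ofReal_mul (by positivity), ← ENNReal.ofReal_mul (by positivity)]
    simp only [F]
    rw [e1]
    congr 1
    ring
  -- The translation t ↦ v t has Jacobian mon(1 + m)(v), and `h1` contributes mon(ν - 1 - m)(v).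
  -- Together they give mon ν(v).
  have hI : ∫⁻ t in A.Hset, F t = ENNReal.ofReal (A.mon ν v) *
      ∫⁻ t in A.Hset, ENNReal.ofReal (A.mon (fun i => -ρ i) ((v : A.Up) * t) *
          Real.exp (-(γ * ‖(v : A.Up) * t‖ ^ 2))) *
        ENNReal.ofReal (A.mon (fun i => ν i - 1 - A.mm i) t) := by
    rw [A.lintegral_Hset_mulL v F, setLIntegral_congr_fun A.measurableSet_Hset h1,
      lintegral_const_mul' _ _ ENNReal.ofReal_ne_top, ← mul_assoc,
      ← ENNReal.ofReal_mul (A.mon_pos _ v).le, ← mon_add]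
    congr 3
    ext i
    ring
  have h2 : ENNReal.ofReal (A.mon ν v) * ENNReal.ofReal (A.mon (fun i => -ν i) v) = 1 := by
    rw [← ENNReal.ofReal_mul (A.mon_pos _ v).le, ← mon_add]
    simp [mon]
  rw [ENNReal.coe_toNNReal hF.ne, hI, mul_right_comm, h2, one_mul]

end TAlgebra

end

open MeasureTheory Set
open scoped ENNReal NNReal SchwartzMap

set_option linter.unusedSectionVars false

noncomputable section

namespace TAlgebra

variable {r : ℕ} {U : Type*} [NormedAddCommGroup U] [InnerProductSpace ℝ U] (A : TAlgebra r U)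

variable [FiniteDimensional ℝ U]

open scoped Topology

/-! ### Triangular transformations and the invariant distance -/

theorem linearMap_ext_of_isOpen {E F : Type*} [NormedAddCommGroup E] [NormedSpace ℝ E]
    [AddCommGroup F] [Module ℝ F] {f g : E →ₗ[ℝ] F} {O : Set E}
    (hO : IsOpen O) (hne : O.Nonempty) (h : ∀ x ∈ O, f x = g x) : f = g := by
  have htop : LinearMap.eqLocus f g = ⊤ := by
    refine Submodule.eq_top_of_nonempty_interior' _ (hne.mono ?_)
    exact interior_maximal (fun x hx => h x hx) hO
  ext x
  have hx : x ∈ LinearMap.eqLocus f g := by rw [htop]; trivial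
  exact hx

/-- The defining formula prescribes g only on elements t⋆ t with t in H, but these form a nonempty
open set, which determines a linear map. -/
theorem isTriangular_iff {g : A.V ≃L[ℝ] A.V} : A.IsTriangular g ↔ ∃ w : A.Hg, g = A.PE w := by
  constructor
  · rintro ⟨w, hw, h⟩
    obtain ⟨w, rfl⟩ := A.mem_H_iff.1 hw
    refine ⟨w, ?_⟩
    have hlin : (g : A.V →ₗ[ℝ] A.V) = A.PL w := by
      refine linearMap_ext_of_isOpen A.isOpen_image_sqs_Hset
        ⟨_, 1, A.one_mem_Hset, rfl⟩ ?_
      rintro _ ⟨u, hu, rfl⟩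
      obtain ⟨u, rfl⟩ := exists_Hg_eq hu
      rw [PL_sqs]
      refine V.ext ?_
      have := h _ (A.mem_H_iff.2 ⟨u, rfl⟩) (A.sqs u) rfl
      refine this.trans ?_
      rw [incl_sqs, upIncl_mul, A.star_mul]
    ext x
    exact LinearMap.congr_fun hlin x
  · rintro ⟨w, rfl⟩
    refine ⟨_, A.mem_H_iff.2 ⟨w, rfl⟩, fun u hu x hx => ?_⟩
    obtain ⟨u, rfl⟩ := A.mem_H_iff.1 hu
    have hx' : x = A.sqs u := V.ext hx
    rw [hx', PE_sqs, incl_sqs, upIncl_mul, A.star_mul]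

theorem tangentNorm_sqs (u : A.Hg) (v : A.V) :
    A.tangentNorm (A.sqs u) v = ‖A.PE u⁻¹ v‖ₑ := by
  have h : ∃ g : A.V ≃L[ℝ] A.V, A.IsTriangular g ∧ g A.e = A.sqs u :=
    ⟨A.PE u, A.isTriangular_iff.2 ⟨u, rfl⟩, A.PE_e u⟩
  rw [tangentNorm, dif_pos h]
  obtain ⟨h1, h2⟩ := h.choose_spec
  obtain ⟨w, hw⟩ := A.isTriangular_iff.1 h1
  rw [hw, PE_e] at h2
  rw [hw, PE_symm, A.sqs_injective_Hg h2]

/-- A `C¹` curve in the cone. -/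
def IsConeCurve (γ : ℝ → A.V) : Prop :=
  ContDiff ℝ 1 γ ∧ ∀ t ∈ Icc (0 : ℝ) 1, γ t ∈ A.cone

theorem invDist_lt_iff {ξ η : A.V} {R : ℝ≥0∞} : A.invDist ξ η < R ↔
    ∃ γ : ℝ → A.V, A.IsConeCurve γ ∧ γ 0 = ξ ∧ γ 1 = η ∧ A.curveLength γ < R := by
  simp only [invDist, iInf_lt_iff]
  exact ⟨fun ⟨γ, ⟨h1, h2, h3, h4⟩, h5⟩ => ⟨γ, ⟨h1, h4⟩, h2, h3, h5⟩,
    fun ⟨γ, ⟨h1, h4⟩, h2, h3, h5⟩ => ⟨γ, ⟨h1, h2, h3, h4⟩, h5⟩⟩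

variable {A}

/-- A Grönwall argument. If γ(t) = u⋆ u then f(t) = (s s⋆ | γ(t)) = ‖u s‖², while f'(t) is the
pairing of (u s)(u s)⋆ with the velocity transported back to e. So |f'/f| is at most `cb` times the
invariant speed, and log f varies by at most `cb` times the length. -/
theorem IsConeCurve.inner_le (hA : A.IsSymmetric) {γ : ℝ → A.V} (hγ : A.IsConeCurve γ) {R : ℝ}
    (hR : A.curveLength γ < ENNReal.ofReal R) {t₀ t₁ : ℝ} (h₀ : t₀ ∈ Icc (0 : ℝ) 1)
    (h₁ : t₁ ∈ Icc (0 : ℝ) 1) (s : A.Up) :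
    inner ℝ (A.sq s) (γ t₁) ≤ Real.exp (A.cb * R) * inner ℝ (A.sq s) (γ t₀) := by
  rcases eq_or_ne s 0 with rfl | hs
  · have : A.sq 0 = 0 := V.ext (by rw [incl_sq]; simp)
    simp [this]
  have hγd : Differentiable ℝ γ := hγ.1.differentiable one_ne_zero
  have hγ'c : Continuous (deriv γ) := hγ.1.continuous_deriv le_rfl
  set f : ℝ → ℝ := fun t => inner ℝ (A.sq s) (γ t)
  set f' : ℝ → ℝ := fun t => inner ℝ (A.sq s) (deriv γ t)
  have hf : ∀ t, HasDerivAt f (f' t) t := fun t => by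
    have := (hasDerivAt_const t (A.sq s)).inner ℝ (hγd t).hasDerivAt
    simpa [f, f'] using this
  have hfc : Continuous f := continuous_const.inner hγd.continuous
  have hf'c : Continuous f' := continuous_const.inner hγ'c
  have hest : ∀ t ∈ Icc (0 : ℝ) 1, 0 < f t ∧
      ENNReal.ofReal ‖f' t / f t‖ ≤ ENNReal.ofReal A.cb * A.tangentNorm (γ t) (deriv γ t) := by
    intro t ht
    obtain ⟨u, hu⟩ := hA.mem_cone_iff.1 (hγ.2 t ht)
    have hft : f t = ‖(u : A.Up) * s‖ ^ 2 := by
      simp only [f]; rw [← hu, inner_sq_sqs]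
    have hpos : 0 < f t := by
      rw [hft]
      refine pow_pos (norm_pos_iff.2 fun h0 => hs ?_) 2
      exact A.eq_zero_of_mul_eq_zero (fun i => (u.pos i).ne') h0
    refine ⟨hpos, ?_⟩
    rw [← hu, tangentNorm_sqs, ← ofReal_norm, ← ENNReal.ofReal_mul A.cb_pos.le]
    refine ENNReal.ofReal_le_ofReal ?_
    rw [norm_div, Real.norm_of_nonneg hpos.le, div_le_iff₀ hpos]
    have h1 : f' t = inner ℝ (A.sq ((u : A.Up) * s)) (A.PE u⁻¹ (deriv γ t)) := by
      rw [← piE_sq, ← inner_PE, ← PE_mul, inv_mul_cancel, PE_one]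
    rw [h1]
    refine (norm_inner_le_norm _ _).trans ?_
    rw [hft]
    calc _ ≤ A.cb * ‖(u : A.Up) * s‖ ^ 2 * ‖A.PE u⁻¹ (deriv γ t)‖ := by
          gcongr; exact A.norm_sqMap_le _
      _ = _ := by ring
  have hcont : ContinuousOn (fun t => f' t / f t) (Icc 0 1) :=
    hf'c.continuousOn.div hfc.continuousOn fun t ht => (hest t ht).1.ne'
  have hint : IntegrableOn (fun t => f' t / f t) (Icc 0 1) := hcont.integrableOn_Icc
  have hsub : uIcc t₀ t₁ ⊆ Icc 0 1 := ordConnected_Icc.uIcc_subset h₀ h₁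
  have hlog : ∫ t in t₀..t₁, f' t / f t = Real.log (f t₁) - Real.log (f t₀) := by
    refine intervalIntegral.integral_eq_sub_of_hasDerivAt (f := fun t => Real.log (f t))
      (f' := fun t => f' t / f t) (fun t ht => ?_) ?_
    · exact (hf t).log (hest t (hsub ht)).1.ne'
    · exact (hcont.mono hsub).intervalIntegrable
  have hbound : |Real.log (f t₁) - Real.log (f t₀)| ≤ A.cb * R := by
    rw [← hlog, ← Real.norm_eq_abs]
    refine (intervalIntegral.norm_integral_le_integral_norm_uIoc
      (f := fun t => f' t / f t)).trans ?_
    refine (setIntegral_mono_set hint.norm (Filter.Eventually.of_forall fun _ => norm_nonneg _)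
      (uIoc_subset_uIcc.trans hsub).eventuallyLE).trans ?_
    have hR0 : 0 < R := by
      by_contra h
      rw [ENNReal.ofReal_of_nonpos (not_lt.1 h)] at hR
      exact not_lt_zero hR
    rw [← ENNReal.ofReal_le_ofReal_iff (mul_nonneg A.cb_pos.le hR0.le),
      ofReal_integral_eq_lintegral_ofReal hint.norm
        (Filter.Eventually.of_forall fun _ => norm_nonneg _), ENNReal.ofReal_mul A.cb_pos.le]
    calc _ ≤ ∫⁻ t in Icc (0 : ℝ) 1, ENNReal.ofReal A.cb * A.tangentNorm (γ t) (deriv γ t) :=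
          setLIntegral_mono' measurableSet_Icc fun t ht => (hest t ht).2
      _ = ENNReal.ofReal A.cb * A.curveLength γ :=
          lintegral_const_mul' _ _ ENNReal.ofReal_ne_top
      _ ≤ _ := by gcongr
  have hp0 := (hest _ h₀).1
  have hp1 := (hest _ h₁).1
  change f t₁ ≤ _ * f t₀
  rw [← Real.log_le_log_iff hp1 (mul_pos (Real.exp_pos _) hp0),
    Real.log_mul (Real.exp_pos _).ne' hp0.ne', Real.log_exp]
  linarith [(abs_le.1 hbound).2]

variable (A) in
/-- A bound for the elements of `H` carrying `e` to a point at distance at most `R`. -/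
def distBound (R : ℝ) : ℝ := Real.exp (A.cb * R / 2) * ‖(1 : A.Up)‖

/-- The previous estimate is tested with s = v⁻¹, which gives ‖u v⁻¹‖² ≤ e^{cb R}‖1‖², and with s =
u⁻¹ along the reversed curve for the inverse. -/
theorem IsConeCurve.mul_inv_mem_bddH (hA : A.IsSymmetric) {γ : ℝ → A.V} (hγ : A.IsConeCurve γ)
    {R : ℝ} (hR : A.curveLength γ < ENNReal.ofReal R) {t₀ t₁ : ℝ} (h₀ : t₀ ∈ Icc (0 : ℝ) 1)
    (h₁ : t₁ ∈ Icc (0 : ℝ) 1) {u v : A.Hg} (hv : γ t₀ = A.sqs v) (hu : γ t₁ = A.sqs u) :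
    u * v⁻¹ ∈ A.bddH (A.distBound R) := by
  have key : ∀ x : A.Up, ‖x‖ ^ 2 ≤ Real.exp (A.cb * R) * ‖(1 : A.Up)‖ ^ 2 →
      ‖x‖ ≤ A.distBound R := by
    intro x hx
    refine abs_le_of_sq_le_sq' (a := ‖x‖) ?_ (by unfold distBound; positivity) |>.2
    refine hx.trans_eq ?_
    rw [distBound, mul_pow, ← Real.exp_nat_mul]
    congr 2
    push_cast; ring
  constructor
  · refine key _ ?_
    have h := hγ.inner_le hA hR h₀ h₁ (v⁻¹ : A.Hg)
    rwa [hu, hv, inner_sq_sqs, inner_sq_sqs, Hg.coe_mul_inv] at h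
  · refine key _ ?_
    have h := hγ.inner_le hA hR h₁ h₀ (u⁻¹ : A.Hg)
    rw [mul_inv_rev, inv_inv]
    rwa [hu, hv, inner_sq_sqs, inner_sq_sqs, Hg.coe_mul_inv, ← Hg.coe_mul] at h

theorem mul_inv_mem_bddH_of_invDist_lt (hA : A.IsSymmetric) {R : ℝ} {u v : A.Hg}
    (h : A.invDist (A.sqs v) (A.sqs u) < ENNReal.ofReal R) :
    u * v⁻¹ ∈ A.bddH (A.distBound R) := by
  obtain ⟨γ, hγ, h0, h1, hR⟩ := A.invDist_lt_iff.1 h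
  exact hγ.mul_inv_mem_bddH hA hR (by simp) (by simp) h0 h1

theorem IsSymmetric.PE_mem_cone (hA : A.IsSymmetric) (w : A.Hg) {ξ : A.V} (hξ : ξ ∈ A.cone) :
    A.PE w ξ ∈ A.cone := by
  obtain ⟨u, rfl⟩ := hA.mem_cone_iff.1 hξ
  rw [PE_sqs]
  exact hA.mem_cone_iff.2 ⟨u * w, rfl⟩

theorem invDist_PE_lt (hA : A.IsSymmetric) (w : A.Hg) {ξ η : A.V} {R : ℝ≥0∞}
    (h : A.invDist ξ η < R) : A.invDist (A.PE w ξ) (A.PE w η) < R := by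
  obtain ⟨γ, hγ, h0, h1, hR⟩ := A.invDist_lt_iff.1 h
  refine A.invDist_lt_iff.2 ⟨fun t => A.PE w (γ t), ⟨(A.PE w).contDiff.comp hγ.1,
    fun t ht => hA.PE_mem_cone w (hγ.2 t ht)⟩, by simp only [h0], by simp only [h1], ?_⟩
  refine lt_of_eq_of_lt ?_ hR
  refine setLIntegral_congr_fun measurableSet_Icc fun t ht => ?_
  obtain ⟨u, hu⟩ := hA.mem_cone_iff.1 (hγ.2 t ht)
  have hd : deriv (fun t => A.PE w (γ t)) t = A.PE w (deriv γ t) :=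
    ((A.PE w).toContinuousLinearMap.hasFDerivAt.comp_hasDerivAt t
      (hγ.1.differentiable one_ne_zero t).hasDerivAt).deriv
  simp only [hd]
  rw [← hu, PE_sqs, tangentNorm_sqs, ← Hg.coe_mul, tangentNorm_sqs, ← PE_mul, mul_inv_rev,
    mul_inv_cancel_left]

theorem PE_mem_dBall (hA : A.IsSymmetric) (w : A.Hg) {ξ η : A.V} {R : ℝ}
    (h : η ∈ A.dBall ξ R) : A.PE w η ∈ A.dBall (A.PE w ξ) R :=
  ⟨hA.PE_mem_cone w h.1, invDist_PE_lt hA w h.2⟩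

/-! ### Smooth dependence on the group element and deformation of curves -/

theorem contDiff_sq {n : WithTop ℕ∞} : ContDiff ℝ n A.sq := by
  have h : A.sq = fun t => (1 / 2 : ℝ) • A.sqB.toContinuousBilinearMap t t := by
    ext t; exact A.sq_eq_sqB t
  rw [h]
  exact (A.sqB.toContinuousBilinearMap.isBoundedBilinearMap.contDiff.comp
      (contDiff_id.prodMk contDiff_id)).const_smul (1 / 2 : ℝ)

theorem contDiff_piL_apply {n : WithTop ℕ∞} (x : A.V) : ContDiff ℝ n fun w => A.piL w x := by
  have hx : x ∈ Submodule.span ℝ (range A.sq) := by rw [span_range_sq]; trivial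
  induction hx using Submodule.span_induction with
  | mem x hx =>
    obtain ⟨u, rfl⟩ := hx
    simp only [piL_sq]
    exact contDiff_sq.comp (A.mulR u).toContinuousLinearMap.contDiff
  | zero => simpa using contDiff_const
  | add x y _ _ hx hy => simpa only [map_add] using hx.add hy
  | smul a x _ hx => simpa only [map_smul] using hx.const_smul a

variable (A) in
/-- The linear map `u⋆ u ↦ (w⋆ u⋆) (u w)`, as a continuous linear map. -/
def PC (w : A.Up) : A.V →L[ℝ] A.V := (A.PL w).toContinuousLinearMap

theorem PC_apply (w : A.Up) (x : A.V) : A.PC w x = A.PL w x := rfl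

theorem contDiff_PC {n : WithTop ℕ∞} : ContDiff ℝ n A.PC := by
  rw [contDiff_clm_apply_iff]
  intro x
  have h : (fun w => A.PC w x) = fun w => ∑ i, (inner ℝ (A.piL w (stdOrthonormalBasis ℝ A.V i)) x) •
      stdOrthonormalBasis ℝ A.V i := by
    ext w
    conv_lhs => rw [← (stdOrthonormalBasis ℝ A.V).sum_repr' (A.PC w x)]
    simp only [PC_apply, inner_PL]
  rw [h]
  exact ContDiff.sum fun i _ => ((contDiff_piL_apply _).inner ℝ contDiff_const).smul contDiff_const

/-- A substitute for the triangle inequality, as the concatenation of C¹ curves need not be C¹. The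
curve ending at e is dragged along by the segment w(t) = 1 + t(u - 1) in H, which leaves its
starting point fixed and moves its end to u⋆ u. The added speed is linear in u - 1. Its constant is
uniform because a curve of length less than 1 ending at e stays in a bounded part of H. -/
theorem exists_perturb (hA : A.IsSymmetric) : ∃ B : ℝ, 0 ≤ B ∧ ∀ u : A.Hg,
    ‖(u : A.Up) - 1‖ < A.rad → ∀ γ : ℝ → A.V, A.IsConeCurve γ → γ 1 = A.e →
    A.curveLength γ < ENNReal.ofReal 1 → ∃ γ' : ℝ → A.V, A.IsConeCurve γ' ∧ γ' 0 = γ 0 ∧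
      γ' 1 = A.sqs u ∧ A.curveLength γ' ≤
        A.curveLength γ + ENNReal.ofReal (B * ‖(u : A.Up) - 1‖) := by
  have hPC : ContDiff ℝ 1 A.PC := contDiff_PC
  obtain ⟨B₁, hB₁⟩ := ((isCompact_closedBall (1 : A.Up) A.rad).bddAbove_image
    (hPC.continuous_fderiv one_ne_zero).norm.continuousOn)
  set M : ℝ := A.cb * A.distBound 1 * (2 * ‖(1 : A.Up)‖)
  obtain ⟨B₂, hB₂⟩ := ((isCompact_closedBall (0 : A.Up) M).bddAbove_image
    hPC.continuous.norm.continuousOn)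
  set B : ℝ := |B₂| * |B₁| * (A.cb * A.distBound 1 ^ 2)
  have hB : 0 ≤ B := by have := A.cb_pos; positivity
  refine ⟨B, hB, fun u hu γ hγ hγ1 hlen => ?_⟩
  set w : ℝ → A.Up := fun t => 1 + t • ((u : A.Up) - 1)
  have hw : ContDiff ℝ 1 w := contDiff_const.add (contDiff_id.smul contDiff_const)
  have hw' : ∀ t, HasDerivAt w ((u : A.Up) - 1) t := fun t => by
    have := ((hasDerivAt_id t).smul_const ((u : A.Up) - 1)).const_add (1 : A.Up)
    rwa [one_smul] at this
  have hwn : ∀ t ∈ Icc (0 : ℝ) 1, ‖w t - 1‖ < A.rad := by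
    intro t ht
    simp only [w, add_sub_cancel_left, norm_smul, Real.norm_of_nonneg ht.1]
    exact (mul_le_of_le_one_left (norm_nonneg _) ht.2).trans_lt hu
  have hγd : Differentiable ℝ γ := hγ.1.differentiable one_ne_zero
  have hder : ∀ t, HasDerivAt (fun t => A.PC (w t) (γ t))
      (fderiv ℝ A.PC (w t) ((u : A.Up) - 1) (γ t) + A.PC (w t) (deriv γ t)) t := by
    intro t
    have h1 : HasDerivAt (fun t => A.PC (w t)) (fderiv ℝ A.PC (w t) ((u : A.Up) - 1)) t :=
      ((hPC.differentiable one_ne_zero (w t)).hasFDerivAt).comp_hasDerivAt t (hw' t)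
    exact h1.clm_apply (hγd t).hasDerivAt
  refine ⟨fun t => A.PC (w t) (γ t), ⟨(hPC.comp hw).clm_apply hγ.1, fun t ht => ?_⟩, ?_, ?_, ?_⟩
  · obtain ⟨W, hW⟩ := exists_Hg_eq (A.ball_subset_Hset (hwn t ht))
    change A.PC (w t) (γ t) ∈ A.cone
    rw [← hW]
    exact hA.PE_mem_cone W (hγ.2 t ht)
  · simp [w, PC_apply, PL_one]
  · simp only [w, one_smul, add_sub_cancel, hγ1]
    exact A.PE_e u
  · have hpt : ∀ t ∈ Icc (0 : ℝ) 1, A.tangentNorm (A.PC (w t) (γ t))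
        (deriv (fun t => A.PC (w t) (γ t)) t) ≤
        A.tangentNorm (γ t) (deriv γ t) + ENNReal.ofReal (B * ‖(u : A.Up) - 1‖) := by
      intro t ht
      obtain ⟨W, hW⟩ := exists_Hg_eq (A.ball_subset_Hset (hwn t ht))
      obtain ⟨a, ha⟩ := hA.mem_cone_iff.1 (hγ.2 t ht)
      have hWn := hwn t ht
      have haM : a ∈ A.bddH (A.distBound 1) := by
        have := hγ.mul_inv_mem_bddH hA hlen (t₀ := 1) (by simp) ht (v := 1) (u := a)
          (by rw [hγ1, Hg.coe_one, sqs_one]) ha.symm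
        rwa [inv_one, mul_one] at this
      have hWM : W ∈ A.bddH (2 * ‖(1 : A.Up)‖) := A.mem_bddH_of_ball (by rw [hW]; exact hWn)
      rw [(hder t).deriv]
      set y := fderiv ℝ A.PC (w t) ((u : A.Up) - 1) (γ t)
      have hy : ‖y‖ ≤ |B₁| * ‖(u : A.Up) - 1‖ * (A.cb * A.distBound 1 ^ 2) := by
        refine (ContinuousLinearMap.le_opNorm _ _).trans ?_
        refine mul_le_mul ((ContinuousLinearMap.le_opNorm _ _).trans ?_) ?_ (norm_nonneg _)
          (by positivity)
        · gcongr
          refine le_trans (hB₁ ⟨w t, ?_, rfl⟩) (le_abs_self _)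
          exact mem_closedBall_iff_norm.2 hWn.le
        · rw [← ha]
          refine (A.norm_sqsMap_le _).trans ?_
          have := A.cb_pos
          gcongr
          exact haM.1
      have e1 : A.PC (w t) (γ t) = A.sqs (a * W : A.Hg) := by
        rw [← ha, ← hW, PC_apply, PL_sqs, Hg.coe_mul]
      -- The transported part of the velocity keeps its invariant norm, because the dragging element
      -- W is itself a triangular transformation.
      have e2 : A.PE (a * W)⁻¹ (A.PC (w t) (deriv γ t)) = A.PE a⁻¹ (deriv γ t) := by
        rw [← hW, mul_inv_rev, PE_mul]
        have : A.PC (W : A.Up) (deriv γ t) = A.PE W (deriv γ t) := rfl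
        rw [this, ← A.PE_mul W W⁻¹, mul_inv_cancel, PE_one]
      rw [e1, tangentNorm_sqs, map_add, e2, ← ha, tangentNorm_sqs, add_comm]
      refine (enorm_add_le _ _).trans ?_
      gcongr
      rw [← ofReal_norm]
      refine ENNReal.ofReal_le_ofReal ?_
      have h3 : ‖A.PC ((a * W)⁻¹ : A.Hg)‖ ≤ |B₂| := by
        refine le_trans (hB₂ ⟨_, ?_, rfl⟩) (le_abs_self _)
        rw [mem_closedBall_zero_iff]
        exact (A.mul_mem_bddH haM hWM).2
      calc ‖A.PE (a * W)⁻¹ y‖ = ‖A.PC ((a * W)⁻¹ : A.Hg) y‖ := rfl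
        _ ≤ ‖A.PC ((a * W)⁻¹ : A.Hg)‖ * ‖y‖ := ContinuousLinearMap.le_opNorm _ _
        _ ≤ |B₂| * (|B₁| * ‖(u : A.Up) - 1‖ * (A.cb * A.distBound 1 ^ 2)) := by gcongr
        _ = _ := by simp only [B]; ring
    calc _ ≤ ∫⁻ t in Icc (0 : ℝ) 1, (A.tangentNorm (γ t) (deriv γ t) +
          ENNReal.ofReal (B * ‖(u : A.Up) - 1‖)) :=
          setLIntegral_mono' measurableSet_Icc hpt
      _ = _ := by
          rw [lintegral_add_right _ measurable_const, setLIntegral_const]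
          simp [curveLength]

/-- The first bound places small translates inside the disjoint balls of radius 1/2 and gives
separation of the lattice. The second enlarges a ball of radius 1 to one of radius 2 and gives
`exists_near`. -/
theorem exists_ball_radius (hA : A.IsSymmetric) : ∃ ε : ℝ, 0 < ε ∧ ε ≤ A.rad ∧ ∀ u : A.Hg,
    ‖(u : A.Up) - 1‖ < ε → A.invDist A.e (A.sqs u) < ENNReal.ofReal (1 / 2) ∧
      ∀ ξ, A.invDist ξ A.e < ENNReal.ofReal 1 → A.invDist ξ (A.sqs u) < ENNReal.ofReal 2 := by
  obtain ⟨B, hB, h⟩ := exists_perturb hA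
  refine ⟨min A.rad (1 / (2 * (B + 1))), lt_min A.rad_pos (by positivity), min_le_left _ _,
    fun u hu => ?_⟩
  have hu1 := hu.trans_le (min_le_left _ _)
  have hu2 : B * ‖(u : A.Up) - 1‖ < 1 / 2 := by
    have h1 := hu.trans_le (min_le_right _ _)
    rw [lt_div_iff₀ (by positivity)] at h1
    have := norm_nonneg ((u : A.Up) - 1)
    rcases this.eq_or_lt with h0 | h0
    · rw [← h0]; norm_num
    · nlinarith
  have hu3 : ENNReal.ofReal (B * ‖(u : A.Up) - 1‖) < ENNReal.ofReal (1 / 2) :=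
    (ENNReal.ofReal_lt_ofReal_iff (by norm_num)).2 hu2
  constructor
  · have hlen0 : A.curveLength (fun _ => A.e) = 0 := by
      have := A.tangentNorm_sqs 1 0
      rw [Hg.coe_one, sqs_one, map_zero, enorm_zero] at this
      simp [curveLength, this]
    obtain ⟨γ', hγ', h0, h1, hl⟩ := h u hu1 (fun _ => A.e) ⟨contDiff_const, fun _ _ => A.e_mem_cone⟩
      rfl (by rw [hlen0]; simp)
    rw [hlen0, zero_add] at hl
    exact A.invDist_lt_iff.2 ⟨γ', hγ', h0, h1, hl.trans_lt hu3⟩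
  · intro ξ hξ
    obtain ⟨γ, hγ, h0, h1, hl⟩ := A.invDist_lt_iff.1 hξ
    obtain ⟨γ', hγ', h0', h1', hl'⟩ := h u hu1 γ hγ h1 hl
    refine A.invDist_lt_iff.2 ⟨γ', hγ', h0'.trans h0, h1', hl'.trans_lt ?_⟩
    calc _ < ENNReal.ofReal 1 + ENNReal.ofReal (1 / 2) := ENNReal.add_lt_add hl hu3
      _ ≤ _ := by rw [← ENNReal.ofReal_add (by norm_num) (by norm_num)]; gcongr; norm_num

end TAlgebra

end

open MeasureTheory Set
open scoped ENNReal NNReal SchwartzMap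

set_option linter.unusedSectionVars false

noncomputable section

namespace TAlgebra

variable {r : ℕ} {U : Type*} [NormedAddCommGroup U] [InnerProductSpace ℝ U] (A : TAlgebra r U)

variable [FiniteDimensional ℝ U]

open scoped Topology

/-! ### The lattice and the partition of unity -/

namespace LittlewoodPaley

variable {A} (L : A.LittlewoodPaley)

/-- The element of `H` that defines the transformation `g_j`. -/
def wt (j : ℕ) : A.Hg := (A.isTriangular_iff.1 (L.g_triangular j)).choose

theorem g_eq (j : ℕ) : L.g j = A.PE (L.wt j) :=
  (A.isTriangular_iff.1 (L.g_triangular j)).choose_spec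

theorem pt_eq (j : ℕ) : L.pt j = A.sqs (L.wt j) := by rw [← L.g_e, g_eq, PE_e]

theorem phi_eq (j : ℕ) (ξ : A.V) : L.phi j ξ = L.bump (A.PE (L.wt j)⁻¹ ξ) := by
  rw [phi, g_eq, PE_symm]

theorem phi_nonneg (j : ℕ) (ξ : A.V) : 0 ≤ L.phi j ξ := L.bump_nonneg _

theorem continuous_phi (j : ℕ) : Continuous (L.phi j) :=
  L.bump_contDiff.continuous.comp (L.g j).symm.continuous

theorem separated (hA : A.IsSymmetric) {ε : ℝ} (hε : ε ≤ A.rad)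
    (h : ∀ u : A.Hg, ‖(u : A.Up) - 1‖ < ε → A.invDist A.e (A.sqs u) < ENNReal.ofReal (1 / 2)) :
    A.Separated ε L.wt := by
  have key : ∀ j, ∀ u : A.Up, u ∈ Metric.ball (1 : A.Up) ε →
      A.sqs (u * (L.wt j : A.Up)) ∈ A.dBall (L.pt j) (1 / 2) := by
    intro j u hu
    rw [mem_ball_iff_norm] at hu
    obtain ⟨u, rfl⟩ := exists_Hg_eq (A.ball_subset_Hset (hu.trans_le hε))
    have h1 := PE_mem_dBall hA (L.wt j) ⟨hA.mem_cone_iff.2 ⟨u, rfl⟩, h u hu⟩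
    rwa [PE_e, ← pt_eq, PE_sqs] at h1
  intro j k hjk
  rw [Function.onFun, Set.disjoint_left]
  rintro _ ⟨u, hu, rfl⟩ ⟨v, hv, h2⟩
  refine Set.disjoint_left.1 (L.disjoint j k hjk) (key j u hu) ?_
  have := key k v hv
  simp only at h2
  rwa [h2] at this

/-- The covering by balls of radius 1 supplies k. Transported to e by z⁻¹, the gap between the radii
1 and 2 leaves room for a whole ε-neighbourhood, so small pieces of spectrum fit in one ball. -/
theorem exists_near (hA : A.IsSymmetric) {ε : ℝ}
    (h : ∀ u : A.Hg, ‖(u : A.Up) - 1‖ < ε →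
      ∀ ξ, A.invDist ξ A.e < ENNReal.ofReal 1 → A.invDist ξ (A.sqs u) < ENNReal.ofReal 2)
    (z : A.Hg) : ∃ k, z * (L.wt k)⁻¹ ∈ A.bddH (A.distBound 1) ∧
      ∀ u : A.Hg, ‖(u : A.Up) - 1‖ < ε → A.sqs (u * z : A.Hg) ∈ A.dBall (L.pt k) 2 := by
  obtain ⟨k, hk⟩ := mem_iUnion.1 (L.cover (hA.mem_cone_iff.2 ⟨z, rfl⟩))
  refine ⟨k, ?_, fun u hu => ?_⟩
  · refine mul_inv_mem_bddH_of_invDist_lt hA ?_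
    rw [← pt_eq]; exact hk.2
  · have h1 := invDist_PE_lt hA z⁻¹ hk.2
    rw [PE_sqs, Hg.coe_mul_inv, sqs_one] at h1
    have h2 := invDist_PE_lt hA z (h u hu _ h1)
    rw [PE_sqs, ← A.PE_mul z⁻¹ z, inv_mul_cancel, PE_one, ← Hg.coe_mul] at h2
    exact ⟨hA.mem_cone_iff.2 ⟨_, rfl⟩, h2⟩

theorem PE_inv_mem_of_phi_ne_zero {j : ℕ} {ξ : A.V} (h : L.phi j ξ ≠ 0) :
    A.PE (L.wt j)⁻¹ ξ ∈ tsupport L.bump := by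
  rw [phi_eq] at h
  exact subset_tsupport _ h

theorem mem_bddH_of_phi_ne_zero (hA : A.IsSymmetric) {j : ℕ} {u : A.Hg}
    (h : L.phi j (A.sqs u) ≠ 0) : L.wt j * u⁻¹ ∈ A.bddH (A.distBound 2) := by
  have h1 := L.bump_tsupport (L.PE_inv_mem_of_phi_ne_zero h)
  have h2 := PE_mem_dBall hA (L.wt j) h1
  rw [PE_e, ← A.PE_mul, inv_mul_cancel, PE_one] at h2
  have h3 := A.inv_mem_bddH (mul_inv_mem_bddH_of_invDist_lt hA h2.2)
  rwa [mul_inv_rev, inv_inv] at h3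

theorem mem_cone_of_phi_ne_zero (hA : A.IsSymmetric) {j : ℕ} {ξ : A.V} (h : L.phi j ξ ≠ 0) :
    ξ ∈ A.cone := by
  have h1 := hA.PE_mem_cone (L.wt j) (L.bump_tsupport (L.PE_inv_mem_of_phi_ne_zero h)).1
  rwa [← A.PE_mul, inv_mul_cancel, PE_one] at h1

/-- Local finiteness: if φ_j does not vanish at u⋆ u then w_j u⁻¹ lies in a fixed bounded set, and
`exists_card_le` counts such indices. -/
theorem finite_phi_ne_zero (hA : A.IsSymmetric) (ξ : A.V) : {j | L.phi j ξ ≠ 0}.Finite := by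
  by_cases hξ : ξ ∈ A.cone
  · obtain ⟨u, rfl⟩ := hA.mem_cone_iff.1 hξ
    obtain ⟨ε, hε, hε1, h⟩ := exists_ball_radius hA
    obtain ⟨N, hN⟩ := A.exists_card_le hε hε1 (A.distBound 2)
    have := hN L.wt (L.separated hA hε1 fun u hu => (h u hu).1) u⁻¹
    by_contra hinf
    obtain ⟨J, hJ, hc⟩ := Set.Infinite.exists_subset_card_eq hinf (N + 1)
    have := this J fun j hj => L.mem_bddH_of_phi_ne_zero hA (hJ hj)
    omega
  · convert Set.finite_empty
    ext j
    simp only [mem_empty_iff_false, iff_false, mem_ofPred_eq, not_not]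
    by_contra h
    exact hξ (L.mem_cone_of_phi_ne_zero hA h)

theorem summable_phi (hA : A.IsSymmetric) (ξ : A.V) : Summable fun j => L.phi j ξ :=
  summable_of_hasFiniteSupport (L.finite_phi_ne_zero hA ξ)

theorem one_le_tsum_phi (hA : A.IsSymmetric) {ξ : A.V} (hξ : ξ ∈ A.cone) :
    1 ≤ ∑' j, L.phi j ξ := by
  obtain ⟨k, hk⟩ := mem_iUnion.1 (L.cover hξ)
  have h1 := PE_mem_dBall hA (L.wt k)⁻¹ hk
  rw [pt_eq, PE_sqs, Hg.coe_mul_inv, sqs_one] at h1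
  have h2 : L.phi k ξ = 1 := by rw [phi_eq, L.bump_eq_one _ h1]
  rw [← h2]
  exact (L.summable_phi hA ξ).le_tsum k fun j _ => L.phi_nonneg j ξ

/-- The symbol `φ_j / ∑ φ_k`. -/
def chi (j : ℕ) (ξ : A.V) : ℝ := L.phi j ξ / ∑' k, L.phi k ξ

theorem chi_nonneg (j : ℕ) (ξ : A.V) : 0 ≤ L.chi j ξ :=
  div_nonneg (L.phi_nonneg j ξ) (tsum_nonneg fun k => L.phi_nonneg k ξ)

theorem chi_eq_zero {j : ℕ} {ξ : A.V} (h : L.phi j ξ = 0) : L.chi j ξ = 0 := by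
  rw [chi, h, zero_div]

theorem sum_chi_le_one (hA : A.IsSymmetric) (J : Finset ℕ) (ξ : A.V) :
    ∑ j ∈ J, L.chi j ξ ≤ 1 := by
  simp only [chi]
  rw [← Finset.sum_div]
  exact div_le_one_of_le₀ ((L.summable_phi hA ξ).sum_le_tsum _ fun j _ => L.phi_nonneg j ξ)
    (tsum_nonneg fun k => L.phi_nonneg k ξ)

theorem chi_le_one (hA : A.IsSymmetric) (j : ℕ) (ξ : A.V) : L.chi j ξ ≤ 1 := by
  simpa using L.sum_chi_le_one hA {j} ξ

theorem hasSum_chi (hA : A.IsSymmetric) {ξ : A.V} (hξ : ξ ∈ A.cone) :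
    HasSum (fun j => L.chi j ξ) 1 := by
  have h := (L.summable_phi hA ξ).hasSum.div_const (∑' k, L.phi k ξ)
  rwa [div_self (by linarith [L.one_le_tsum_phi hA hξ])] at h

theorem measurable_chi (hA : A.IsSymmetric) (j : ℕ) : Measurable (L.chi j) := by
  refine (L.continuous_phi j).measurable.div ?_
  refine measurable_of_tendsto_metrizable (f := fun n ξ => ∑ k ∈ Finset.range n, L.phi k ξ)
    (fun n => Finset.measurable_fun_sum _ fun k _ => (L.continuous_phi k).measurable) ?_
  rw [tendsto_pi_nhds]
  exact fun ξ => (L.summable_phi hA ξ).hasSum.tendsto_sum_nat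

theorem integrable_chi (hA : A.IsSymmetric) (j : ℕ) : Integrable (L.chi j) := by
  have h : Integrable (L.phi j) := by
    refine (L.continuous_phi j).integrable_of_hasCompactSupport ?_
    exact L.bump_compact.comp_homeomorph (L.g j).symm.toHomeomorph
  have hle : ∀ ξ, L.chi j ξ ≤ L.phi j ξ := by
    intro ξ
    by_cases h0 : L.phi j ξ = 0
    · rw [L.chi_eq_zero h0, h0]
    · exact div_le_self (L.phi_nonneg j ξ) (L.one_le_tsum_phi hA (L.mem_cone_of_phi_ne_zero hA h0))
  refine h.mono' (L.measurable_chi hA j).aestronglyMeasurable (Filter.Eventually.of_forall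
    fun ξ => ?_)
  rw [Real.norm_of_nonneg (L.chi_nonneg j ξ)]
  exact hle ξ

end LittlewoodPaley

end TAlgebra

end

open MeasureTheory Set
open scoped ENNReal NNReal SchwartzMap

set_option linter.unusedSectionVars false

noncomputable section

namespace TAlgebra

open scoped Topology
open Complex (I)

/-! ### Laplace integrals -/

variable {E : Type*} [NormedAddCommGroup E] [InnerProductSpace ℝ E]

/-- The kernel `e^{i (x + i y | ξ)}`. -/
def laplaceKer (x y ξ : E) : ℂ := Complex.exp (I * ((inner ℝ x ξ : ℝ) + I * (inner ℝ y ξ : ℝ)))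

theorem norm_laplaceKer (x y ξ : E) : ‖laplaceKer x y ξ‖ = Real.exp (-inner ℝ y ξ) := by
  rw [laplaceKer, Complex.norm_exp]
  simp

theorem continuous_laplaceKer : Continuous fun z : (E × E) × E => laplaceKer z.1.1 z.1.2 z.2 := by
  unfold laplaceKer
  fun_prop

theorem laplaceKer_zero_right (x ξ : E) :
    laplaceKer x 0 ξ = Complex.exp (I * (inner ℝ x ξ : ℝ)) := by
  simp [laplaceKer]

theorem laplaceKer_sub (x x' y ξ : E) :
    laplaceKer (x - x') y ξ = laplaceKer x y ξ * laplaceKer (-x') 0 ξ := by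
  rw [laplaceKer, laplaceKer, laplaceKer, ← Complex.exp_add]
  congr 1
  simp only [inner_sub_left, inner_neg_left, inner_zero_left]
  push_cast
  ring

variable [MeasurableSpace E] [BorelSpace E] [FiniteDimensional ℝ E]

/-- The Laplace integral `∫ e^{i (x + i y | ξ)} h(ξ) dξ`. -/
def laplaceInt (h : E → ℂ) (x y : E) : ℂ := ∫ ξ, laplaceKer x y ξ * h ξ

theorem norm_laplaceKer_mul_le {h : E → ℂ} {y : E} {a : ℝ}
    (ha : ∀ ξ, h ξ ≠ 0 → a ≤ inner ℝ y ξ) (x ξ : E) :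
    ‖laplaceKer x y ξ * h ξ‖ ≤ Real.exp (-a) * ‖h ξ‖ := by
  rcases eq_or_ne (h ξ) 0 with h0 | h0
  · simp [h0]
  · rw [norm_mul, norm_laplaceKer]
    gcongr
    exact ha ξ h0

theorem integrable_laplaceKer_mul {h : E → ℂ} (hh : Integrable h) {y : E} {a : ℝ}
    (ha : ∀ ξ, h ξ ≠ 0 → a ≤ inner ℝ y ξ) (x : E) :
    Integrable fun ξ => laplaceKer x y ξ * h ξ := by
  refine (hh.norm.const_mul (Real.exp (-a))).mono' ?_
    (Filter.Eventually.of_forall (norm_laplaceKer_mul_le ha x))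
  refine AEStronglyMeasurable.mul ?_ hh.1
  exact (continuous_laplaceKer.comp (Continuous.prodMk_right ((x, y) : E × E))).aestronglyMeasurable

theorem norm_laplaceInt_le {h : E → ℂ} (hh : Integrable h) {y : E} {a : ℝ}
    (ha : ∀ ξ, h ξ ≠ 0 → a ≤ inner ℝ y ξ) (x : E) :
    ‖laplaceInt h x y‖ ≤ Real.exp (-a) * ∫ ξ, ‖h ξ‖ := by
  rw [← integral_const_mul]
  exact norm_integral_le_of_norm_le (hh.norm.const_mul _)
    (Filter.Eventually.of_forall (norm_laplaceKer_mul_le ha x))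

theorem continuous_laplaceInt {h : E → ℂ} (hh : Integrable h) {y : E} {a : ℝ}
    (ha : ∀ ξ, h ξ ≠ 0 → a ≤ inner ℝ y ξ) : Continuous fun x => laplaceInt h x y := by
  refine continuous_of_dominated (bound := fun ξ => Real.exp (-a) * ‖h ξ‖)
    (fun x => (integrable_laplaceKer_mul hh ha x).1)
    (fun x => Filter.Eventually.of_forall (norm_laplaceKer_mul_le ha x))
    (hh.norm.const_mul _) (Filter.Eventually.of_forall fun ξ => ?_)
  exact (continuous_laplaceKer.comp (g := fun z : (E × E) × E => laplaceKer z.1.1 z.1.2 z.2)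
    (f := fun x => ((x, y), ξ)) (by fun_prop)).mul continuous_const

theorem hasFDerivAt_laplaceKer (x y ξ : E) :
    HasFDerivAt (laplaceKer x y) (laplaceKer x y ξ • (I • (Complex.ofRealCLM.comp (innerSL ℝ x) +
      I • Complex.ofRealCLM.comp (innerSL ℝ y)))) ξ := by
  have h1 : HasFDerivAt (fun ξ => I * ((inner ℝ x ξ : ℝ) + I * (inner ℝ y ξ : ℝ)))
      (I • (Complex.ofRealCLM.comp (innerSL ℝ x) +
      I • Complex.ofRealCLM.comp (innerSL ℝ y))) ξ := by
    have := (I • (Complex.ofRealCLM.comp (innerSL ℝ x) +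
      I • Complex.ofRealCLM.comp (innerSL ℝ y))).hasFDerivAt (x := ξ)
    convert this using 1
    ext ξ
    simp [mul_add]
  exact h1.cexp

/-- Integration by parts: the derivative of the kernel in the direction b is multiplication by i(x +
iy | b). -/
theorem mul_laplaceInt (h : 𝓢(E, ℂ)) {y : E} {a : ℝ} (ha : ∀ ξ ∈ tsupport h, a ≤ inner ℝ y ξ)
    (x b : E) : ((inner ℝ x b : ℝ) + I * (inner ℝ y b : ℝ)) * laplaceInt h x y =
      I * laplaceInt (LineDeriv.lineDerivOp b h) x y := by
  have h1 : ∀ g : 𝓢(E, ℂ), tsupport g ⊆ tsupport h →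
      Integrable fun ξ => laplaceKer x y ξ * g ξ := fun g hg =>
    integrable_laplaceKer_mul g.integrable (fun ξ hξ => ha ξ (hg (subset_tsupport _ hξ))) x
  have hd : ∀ ξ, fderiv ℝ (laplaceKer x y) ξ b =
      I * ((inner ℝ x b : ℝ) + I * (inner ℝ y b : ℝ)) * laplaceKer x y ξ := fun ξ => by
    rw [(hasFDerivAt_laplaceKer x y ξ).fderiv]
    simp
    ring
  have h2 := integral_mul_fderiv_eq_neg_fderiv_mul_of_integrable (𝕜 := ℂ) (μ := volume)
    (f := laplaceKer x y) (g := h) (v := b) ?_ ?_ (h1 h subset_rfl)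
    (fun ξ _ => (hasFDerivAt_laplaceKer x y ξ).differentiableAt)
    (fun ξ _ => h.differentiableAt)
  · have h3 : laplaceInt (LineDeriv.lineDerivOp b h) x y =
        -(I * ((inner ℝ x b : ℝ) + I * (inner ℝ y b : ℝ)) * laplaceInt h x y) := by
      simp only [hd] at h2
      rw [laplaceInt, laplaceInt, ← integral_const_mul]
      simp only [SchwartzMap.lineDerivOp_apply_eq_fderiv]
      rw [h2]
      congr 2
      ext ξ
      ring
    rw [h3]
    linear_combination ((inner ℝ x b : ℂ) + I * (inner ℝ y b : ℂ)) * laplaceInt h x y * Complex.I_sq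
  · simp only [hd, mul_assoc]
    exact ((h1 h subset_rfl).const_mul _).const_mul _
  · have := h1 (LineDeriv.lineDerivOp b h) (SchwartzMap.tsupport_lineDerivOp_subset b h)
    simpa only [SchwartzMap.lineDerivOp_apply_eq_fderiv] using this

/-- Each factor 1 + ‖x‖ + ‖y‖ is dominated by the coordinates of x + iy, and a coordinate can be
traded for a derivative of h without enlarging its support. The constant does not depend on y, so
one bound serves all heights. -/
theorem exists_norm_laplaceInt_le (N : ℕ) (h : 𝓢(E, ℂ)) : ∃ C : ℝ, 0 ≤ C ∧ ∀ (a : ℝ) (y : E),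
    (∀ ξ ∈ tsupport h, a ≤ inner ℝ y ξ) → ∀ x,
      (1 + ‖x‖ + ‖y‖) ^ N * ‖laplaceInt h x y‖ ≤ C * Real.exp (-a) := by
  induction N generalizing h with
  | zero =>
    refine ⟨∫ ξ, ‖h ξ‖, integral_nonneg fun _ => norm_nonneg _, fun a y ha x => ?_⟩
    rw [pow_zero, one_mul, mul_comm]
    exact norm_laplaceInt_le h.integrable (fun ξ hξ => ha ξ (subset_tsupport _ hξ)) x
  | succ N ih =>
    set b := stdOrthonormalBasis ℝ E
    choose C hC0 hC using fun i => ih (LineDeriv.lineDerivOp (b i) h)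
    obtain ⟨C', hC0', hC'⟩ := ih h
    refine ⟨C' + 2 * ∑ i, C i, add_nonneg hC0' (mul_nonneg zero_le_two
      (Finset.sum_nonneg fun i _ => hC0 i)), fun a y ha x => ?_⟩
    have hn : ∀ z : E, ‖z‖ ≤ ∑ i, |inner ℝ z (b i)| := fun z => by
      conv_lhs => rw [← b.sum_repr' z]
      refine (norm_sum_le _ _).trans (Finset.sum_le_sum fun i _ => ?_)
      rw [norm_smul, b.norm_eq_one, mul_one, real_inner_comm, Real.norm_eq_abs]
    have hz : 1 + ‖x‖ + ‖y‖ ≤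
        1 + 2 * ∑ i, ‖((inner ℝ x (b i) : ℝ) + I * (inner ℝ y (b i) : ℝ) : ℂ)‖ := by
      have h1 : ∀ i, |inner ℝ x (b i)| ≤
          ‖((inner ℝ x (b i) : ℝ) + I * (inner ℝ y (b i) : ℝ) : ℂ)‖ := fun i => by
        simpa using Complex.abs_re_le_norm
          ((inner ℝ x (b i) : ℝ) + I * (inner ℝ y (b i) : ℝ) : ℂ)
      have h2 : ∀ i, |inner ℝ y (b i)| ≤
          ‖((inner ℝ x (b i) : ℝ) + I * (inner ℝ y (b i) : ℝ) : ℂ)‖ := fun i => by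
        simpa using Complex.abs_im_le_norm
          ((inner ℝ x (b i) : ℝ) + I * (inner ℝ y (b i) : ℝ) : ℂ)
      have h3 := (hn x).trans (Finset.sum_le_sum fun i _ => h1 i)
      have h4 := (hn y).trans (Finset.sum_le_sum fun i _ => h2 i)
      linarith
    have hstep : ∀ i, (1 + ‖x‖ + ‖y‖) ^ N *
        (‖((inner ℝ x (b i) : ℝ) + I * (inner ℝ y (b i) : ℝ) : ℂ)‖ * ‖laplaceInt h x y‖) ≤
        C i * Real.exp (-a) := fun i => by
      rw [← norm_mul, mul_laplaceInt h ha, norm_mul, Complex.norm_I, one_mul]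
      exact hC i a y (fun ξ hξ => ha ξ (SchwartzMap.tsupport_lineDerivOp_subset _ _ hξ)) x
    calc (1 + ‖x‖ + ‖y‖) ^ (N + 1) * ‖laplaceInt h x y‖
        ≤ (1 + ‖x‖ + ‖y‖) ^ N * (1 + 2 * ∑ i, ‖((inner ℝ x (b i) : ℝ) +
            I * (inner ℝ y (b i) : ℝ) : ℂ)‖) * ‖laplaceInt h x y‖ := by
          rw [pow_succ]; gcongr
      _ = (1 + ‖x‖ + ‖y‖) ^ N * ‖laplaceInt h x y‖ + 2 * ∑ i, (1 + ‖x‖ + ‖y‖) ^ N *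
          (‖((inner ℝ x (b i) : ℝ) + I * (inner ℝ y (b i) : ℝ) : ℂ)‖ * ‖laplaceInt h x y‖) := by
          rw [← Finset.mul_sum, ← Finset.sum_mul]; ring
      _ ≤ C' * Real.exp (-a) + 2 * ∑ i, C i * Real.exp (-a) := by
          refine add_le_add (hC' a y ha x) (mul_le_mul_of_nonneg_left
            (Finset.sum_le_sum fun i _ => hstep i) zero_le_two)
      _ = _ := by rw [← Finset.sum_mul]; ring

/-! ### Holomorphy of Laplace integrals -/

theorem exists_hasFDerivAt_integral_cexp {W : Type*} [NormedAddCommGroup W] [NormedSpace ℝ W]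
    (h : 𝓢(E, ℂ)) {T : E → W →L[ℝ] ℂ} (hTc : Continuous T) {c : ℝ} (hTn : ∀ ξ, ‖T ξ‖ ≤ c * ‖ξ‖)
    {S : Set W} (hS : IsOpen S) (hpos : ∀ w ∈ S, ∀ ξ, h ξ ≠ 0 → (I * T ξ w).re ≤ 0) {w : W}
    (hw : w ∈ S) :
    ∃ D : W →L[ℝ] ℂ, HasFDerivAt (fun w => ∫ ξ, Complex.exp (I * T ξ w) * h ξ) D w ∧
      ∀ v v', (∀ ξ, T ξ v = I * T ξ v') → D v = I * D v' := by
  set F' : W → E → W →L[ℝ] ℂ := fun w ξ => (Complex.exp (I * T ξ w) * h ξ * I) • T ξ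
  have hker : ∀ w : W, Continuous fun ξ => Complex.exp (I * T ξ w) := fun w =>
    Complex.continuous_exp.comp (continuous_const.mul (hTc.clm_apply continuous_const))
  have hF'c : ∀ w, Continuous (F' w) := fun w =>
    (((hker w).mul h.continuous).mul continuous_const).smul hTc
  have hb1 : ∀ w ∈ S, ∀ ξ, ‖Complex.exp (I * T ξ w) * h ξ‖ ≤ ‖h ξ‖ := fun w hw ξ => by
    rcases eq_or_ne (h ξ) 0 with h0 | h0
    · simp [h0]
    · rw [norm_mul, Complex.norm_exp]
      exact mul_le_of_le_one_left (norm_nonneg _) (Real.exp_le_one_iff.2 (hpos w hw ξ h0))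
  have hbd : ∀ ξ, ∀ w ∈ S, ‖F' w ξ‖ ≤ c * (‖ξ‖ ^ 1 * ‖h ξ‖) := by
    intro ξ w hw
    simp only [F']
    rw [norm_smul, norm_mul, Complex.norm_I, mul_one]
    calc _ ≤ ‖h ξ‖ * (c * ‖ξ‖) :=
          mul_le_mul (hb1 w hw ξ) (hTn ξ) (norm_nonneg _) (norm_nonneg _)
      _ = _ := by ring
  have hbi : Integrable fun ξ => c * (‖ξ‖ ^ 1 * ‖h ξ‖) :=
    (h.integrable_pow_mul volume 1).const_mul c
  have hD := hasFDerivAt_integral_of_dominated_of_fderiv_le (𝕜 := ℝ) (μ := volume)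
    (F := fun (w : W) ξ => Complex.exp (I * T ξ w) * h ξ) (F' := F') (x₀ := w)
    (s := S) (bound := fun ξ => c * (‖ξ‖ ^ 1 * ‖h ξ‖))
    (hS.mem_nhds hw)
    (Filter.Eventually.of_forall fun w => ((hker w).mul h.continuous).aestronglyMeasurable)
    (h.integrable.mono ((hker w).mul h.continuous).aestronglyMeasurable
      (Filter.Eventually.of_forall (hb1 w hw)))
    (hF'c w).aestronglyMeasurable (Filter.Eventually.of_forall hbd) hbi
    (Filter.Eventually.of_forall fun ξ z _ => ?_)
  · refine ⟨_, hD, fun v v' hv => ?_⟩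
    have hint : Integrable (F' w) :=
      hbi.mono' (hF'c w).aestronglyMeasurable (Filter.Eventually.of_forall fun ξ => hbd ξ _ hw)
    rw [ContinuousLinearMap.integral_apply hint, ContinuousLinearMap.integral_apply hint,
      ← integral_const_mul]
    congr 1
    ext ξ
    simp only [F', smul_apply, hv, smul_eq_mul]
    ring
  · have h1 : HasFDerivAt (fun z => I * T ξ z) (I • T ξ) z := (T ξ).hasFDerivAt.const_mul I
    refine ((h1.cexp).mul_const (h ξ)).congr_fderiv ?_
    simp only [F', smul_smul]
    congr 1
    ring

/-- The phase T_ξ(x, y) = (x|ξ) + i(y|ξ) satisfies T_ξ(0, v) = i T_ξ(v, 0), which passes under the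
integral as the Cauchy–Riemann equations. Nonnegative pairing keeps the exponential bounded by 1, so
‖ξ‖‖h(ξ)‖ dominates the derivative. -/
theorem exists_hasFDerivAt_laplaceInt (h : 𝓢(E, ℂ)) {S : Set E} (hS : IsOpen S)
    (hpos : ∀ y ∈ S, ∀ ξ, h ξ ≠ 0 → 0 ≤ inner ℝ y ξ) (x y : E) (hy : y ∈ S) :
    ∃ D : E × E →L[ℝ] ℂ, HasFDerivAt (fun z : E × E => laplaceInt h z.1 z.2) D (x, y) ∧
      ∀ v, D (0, v) = I * D (v, 0) := by
  set T : E → E × E →L[ℝ] ℂ := fun ξ =>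
    Complex.ofRealCLM.comp ((innerSL ℝ ξ).comp (ContinuousLinearMap.fst ℝ E E)) +
      I • Complex.ofRealCLM.comp ((innerSL ℝ ξ).comp (ContinuousLinearMap.snd ℝ E E))
  have hT : ∀ ξ z, T ξ z = (inner ℝ z.1 ξ : ℝ) + I * (inner ℝ z.2 ξ : ℝ) := fun ξ z => by
    simp [T, real_inner_comm]
  have hTn : ∀ ξ, ‖T ξ‖ ≤ 2 * ‖ξ‖ := fun ξ => by
    refine ContinuousLinearMap.opNorm_le_bound _ (by positivity) fun z => ?_
    rw [hT]
    refine (norm_add_le _ _).trans ?_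
    rw [norm_mul, Complex.norm_I, one_mul, Complex.norm_real, Complex.norm_real]
    have h1 := norm_inner_le_norm (𝕜 := ℝ) z.1 ξ
    have h2 := norm_inner_le_norm (𝕜 := ℝ) z.2 ξ
    have h3 := norm_fst_le z
    have h4 := norm_snd_le z
    have := norm_nonneg ξ
    nlinarith
  have hTc : Continuous T := by
    have : Continuous fun ξ : E => innerSL ℝ ξ := (innerSL ℝ).continuous
    fun_prop
  obtain ⟨D, hD, hD'⟩ := exists_hasFDerivAt_integral_cexp h hTc hTn (hS.preimage continuous_snd)
    (fun w hw ξ hξ => by rw [hT]; simpa using hpos w.2 hw ξ hξ) (w := (x, y)) hy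
  · refine ⟨D, ?_, fun v => hD' _ _ fun ξ => ?_⟩
    · simp only [hT] at hD
      exact hD
    · simp [hT]
/-! ### A continuous Minkowski inequality -/

/-- Hölder after the splitting k = k^{1-1/p} k^{1/p}, that is, Jensen's inequality for the measure k
dm. It serves both for L^p bounds of averages and, with counting measure, for the sums over the
lattice when q > s. -/
theorem lintegral_mul_rpow_le {α : Type*} [MeasurableSpace α] {m : Measure α} {k g : α → ℝ≥0∞}
    (hk : Measurable k) (hg : Measurable g) {p : ℝ} (hp : 1 ≤ p) :
    (∫⁻ t, k t * g t ∂m) ^ p ≤ (∫⁻ t, k t ∂m) ^ (p - 1) * ∫⁻ t, k t * g t ^ p ∂m := by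
  have hp0 : 0 < p := by linarith
  rcases hp.eq_or_lt with rfl | hp1
  · simp
  have hpq : (p / (p - 1)).HolderConjugate p := (Real.HolderConjugate.conjExponent hp1).symm
  have h := ENNReal.lintegral_mul_le_Lp_mul_Lq m hpq
    (f := fun t => k t ^ (1 - 1 / p)) (g := fun t => k t ^ (1 / p) * g t)
    (by fun_prop) (by fun_prop)
  have e1 : ∀ t, k t ^ (1 - 1 / p) * (k t ^ (1 / p) * g t) = k t * g t := fun t => by
    rw [← mul_assoc, ← ENNReal.rpow_add_of_nonneg _ _ (by
      rw [sub_nonneg, div_le_one hp0]; exact hp) (by positivity)]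
    simp
  have e2 : ∀ t, (k t ^ (1 - 1 / p)) ^ (p / (p - 1)) = k t := fun t => by
    rw [← ENNReal.rpow_mul]
    have : (1 - 1 / p) * (p / (p - 1)) = 1 := by
      have : p - 1 ≠ 0 := by linarith
      field_simp
    rw [this, ENNReal.rpow_one]
  have e3 : ∀ t, (k t ^ (1 / p) * g t) ^ p = k t * g t ^ p := fun t => by
    rw [ENNReal.mul_rpow_of_nonneg _ _ hp0.le, ← ENNReal.rpow_mul, one_div_mul_cancel hp0.ne',
      ENNReal.rpow_one]
  simp only [Pi.mul_apply, e1, e2, e3] at h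
  refine (ENNReal.rpow_le_rpow h hp0.le).trans_eq ?_
  rw [ENNReal.mul_rpow_of_nonneg _ _ hp0.le, ← ENNReal.rpow_mul, ← ENNReal.rpow_mul,
    one_div_mul_cancel hp0.ne', ENNReal.rpow_one]
  congr 2
  have : p - 1 ≠ 0 := by linarith
  field_simp

theorem eLpNorm_ofReal_eq {α : Type*} [MeasurableSpace α] {m : Measure α} (f : α → ℂ) {p : ℝ}
    (hp : 1 ≤ p) : eLpNorm f (ENNReal.ofReal p) m = (∫⁻ x, ‖f x‖ₑ ^ p ∂m) ^ (1 / p) := by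
  have hp0 : 0 < p := by linarith
  rw [eLpNorm_eq_lintegral_rpow_enorm_toReal (by simpa using hp0) ENNReal.ofReal_ne_top,
    ENNReal.toReal_ofReal hp0.le]

theorem eLpNorm_integral_comp_sub_le {κ g : E → ℂ} (hκ : Continuous κ) (hg : Continuous g)
    (B : E →L[ℝ] E) {p : ℝ} (hp : 1 ≤ p) :
    eLpNorm (fun x => ∫ t, κ t * g (x - B t)) (ENNReal.ofReal p) volume ≤
      (∫⁻ t, ‖κ t‖ₑ) * eLpNorm g (ENNReal.ofReal p) volume := by
  have hp0 : 0 < p := by linarith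
  set K := ∫⁻ t, ‖κ t‖ₑ
  rw [eLpNorm_ofReal_eq _ hp, eLpNorm_ofReal_eq _ hp]
  have h1 : ∀ x, ‖∫ t, κ t * g (x - B t)‖ₑ ^ p ≤
      K ^ (p - 1) * ∫⁻ t, ‖κ t‖ₑ * ‖g (x - B t)‖ₑ ^ p := by
    intro x
    refine le_trans (ENNReal.rpow_le_rpow ((enorm_integral_le_lintegral_enorm _).trans_eq ?_)
      hp0.le) (lintegral_mul_rpow_le hκ.enorm.measurable
        (g := fun t => ‖g (x - B t)‖ₑ) (Continuous.measurable (by fun_prop)) hp)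
    simp only [enorm_mul]
  have h2 : ∫⁻ x, ∫⁻ t, ‖κ t‖ₑ * ‖g (x - B t)‖ₑ ^ p = K * ∫⁻ x, ‖g x‖ₑ ^ p := by
    rw [lintegral_lintegral_swap (by fun_prop)]
    have : ∀ t, ∫⁻ x, ‖κ t‖ₑ * ‖g (x - B t)‖ₑ ^ p = ‖κ t‖ₑ * ∫⁻ x, ‖g x‖ₑ ^ p := fun t => by
      rw [lintegral_const_mul' _ _ enorm_ne_top,
        lintegral_sub_right_eq_self (fun x => ‖g x‖ₑ ^ p) (B t)]
    simp only [this]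
    rw [lintegral_mul_const _ hκ.enorm.measurable]
  have h3 : ∫⁻ x, ‖∫ t, κ t * g (x - B t)‖ₑ ^ p ≤ K ^ p * ∫⁻ x, ‖g x‖ₑ ^ p := by
    refine (lintegral_mono h1).trans ?_
    rw [lintegral_const_mul _ (by fun_prop), h2, ← mul_assoc]
    gcongr
    conv_lhs => rw [← ENNReal.rpow_one K, ← ENNReal.rpow_mul, one_mul]
    rw [← ENNReal.rpow_add_of_nonneg _ _ (by linarith) zero_le_one, sub_add_cancel]
  refine (ENNReal.rpow_le_rpow h3 (by positivity)).trans_eq ?_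
  rw [ENNReal.mul_rpow_of_nonneg _ _ (by positivity), ← ENNReal.rpow_mul,
    mul_one_div_cancel hp0.ne',
    ENNReal.rpow_one]

end TAlgebra

end

open MeasureTheory Set
open scoped ENNReal NNReal SchwartzMap

set_option linter.unusedSectionVars false

noncomputable section

namespace TAlgebra

open scoped Topology FourierTransform
open Complex (I)

/-! ### Fourier transforms -/

section Fourier

variable {E : Type*} [NormedAddCommGroup E] [InnerProductSpace ℝ E]
  [MeasurableSpace E] [BorelSpace E] [FiniteDimensional ℝ E]

theorem laplaceKer_add_right (x y y' ξ : E) :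
    laplaceKer x (y + y') ξ = laplaceKer x y ξ * laplaceKer 0 y' ξ := by
  rw [laplaceKer, laplaceKer, laplaceKer, ← Complex.exp_add]
  congr 1
  simp only [inner_add_left, inner_zero_left]
  push_cast
  ring

theorem laplaceInt_eq_zero_right (h : E → ℂ) (x y : E) :
    laplaceInt h x y = laplaceInt (fun ξ => laplaceKer 0 y ξ * h ξ) x 0 := by
  simp only [laplaceInt, ← mul_assoc, ← laplaceKer_add_right, zero_add]

theorem laplaceInt_zero_right_eq (h : E → ℂ) (x : E) :
    laplaceInt h x 0 = 𝓕⁻ h ((2 * Real.pi)⁻¹ • x) := by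
  rw [Real.fourierInv_eq', laplaceInt]
  congr 1
  ext ξ
  rw [laplaceKer_zero_right, inner_smul_right, real_inner_comm, smul_eq_mul]
  congr 2
  have := Real.pi_pos.ne'
  rw [mul_comm]
  congr 2
  field_simp

theorem exists_schwartz_laplaceInt (h : 𝓢(E, ℂ)) :
    ∃ g : 𝓢(E, ℂ), ∀ x, g x = laplaceInt h x 0 := by
  have hpi : (2 * Real.pi)⁻¹ ≠ 0 := by positivity
  refine ⟨SchwartzMap.compCLMOfContinuousLinearEquiv ℂ
    (ContinuousLinearEquiv.smulLeft (Units.mk0 _ hpi)) (𝓕⁻ h), fun x => ?_⟩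
  rw [laplaceInt_zero_right_eq, ← SchwartzMap.fourierInv_coe]
  rfl

theorem laplaceInt_laplaceInt {h : E → ℂ} (hc : Continuous h) (hh : Integrable h)
    (hF : Integrable fun x => laplaceInt h x 0) (ξ : E) :
    laplaceInt (fun x => laplaceInt h x 0) (-ξ) 0 =
      (((2 * Real.pi) ^ Module.finrank ℝ E : ℝ) : ℂ) * h ξ := by
  have hpi : (0 : ℝ) < 2 * Real.pi := by positivity
  have h1 : Integrable (𝓕 h) := by
    have h2 : 𝓕 h = fun w => laplaceInt h ((-(2 * Real.pi)) • w) 0 := by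
      ext w
      rw [laplaceInt_zero_right_eq, smul_smul, mul_neg, inv_mul_cancel₀ hpi.ne', neg_one_smul,
        Real.fourierInv_eq_fourier_neg, neg_neg]
    rw [h2]
    exact hF.comp_smul (neg_ne_zero.2 hpi.ne')
  have h3 := congrFun (hc.fourier_fourierInv_eq hh h1) ξ
  rw [← h3, Real.fourier_eq', laplaceInt]
  have h4 := Measure.integral_comp_inv_smul (volume : Measure E) (fun v => Complex.exp
    (↑(-2 * Real.pi * inner ℝ v ξ) * I) • 𝓕⁻ h v) (2 * Real.pi)
  rw [abs_of_pos (by positivity), Complex.real_smul] at h4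
  rw [← h4]
  congr 1
  ext x
  rw [laplaceInt_zero_right_eq, laplaceKer_zero_right, smul_eq_mul]
  congr 2
  rw [inner_neg_left, real_inner_comm, inner_smul_left, mul_comm]
  congr 2
  have := Real.pi_pos.ne'
  simp
  field_simp

/-- By Fubini, averaging the translates by B t against k multiplies the symbol m by the transform of
k at C ξ, where C is the adjoint of B. The linear maps are kept general in order to include
triangular dilations. -/
theorem integral_mul_laplaceInt_sub {k m : E → ℂ} (hk : Integrable k) (hm : Integrable m)
    {B C : E →L[ℝ] E} (hBC : ∀ t ξ, inner ℝ (B t) ξ = inner ℝ t (C ξ)) (x : E) :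
    ∫ t, k t * laplaceInt m (x - B t) 0 =
      laplaceInt (fun ξ => laplaceInt k (-(C ξ)) 0 * m ξ) x 0 := by
  have hint : Integrable (fun z : E × E => k z.1 * (laplaceKer (x - B z.1) 0 z.2 * m z.2))
      (volume.prod volume) := by
    refine (hk.mul_prod hm).mono ?_ (Filter.Eventually.of_forall fun z => ?_)
    · refine hk.1.comp_fst.mul (AEStronglyMeasurable.mul ?_ hm.1.comp_snd)
      exact (continuous_laplaceKer.comp (g := fun z : (E × E) × E => laplaceKer z.1.1 z.1.2 z.2)
        (f := fun z : E × E => ((x - B z.1, 0), z.2)) (by fun_prop)).aestronglyMeasurable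
    · rw [norm_mul, norm_mul, norm_mul, norm_laplaceKer]
      simp
  simp only [laplaceInt, ← integral_const_mul]
  rw [integral_integral_swap hint]
  congr 1
  ext ξ
  rw [← integral_mul_const, ← integral_const_mul]
  congr 1
  ext t
  have : laplaceKer (-(C ξ)) 0 t = laplaceKer (-B t) 0 ξ := by
    rw [laplaceKer_zero_right, laplaceKer_zero_right, inner_neg_left, inner_neg_left, hBC,
      real_inner_comm]
  rw [laplaceKer_sub, this]
  ring

end Fourier

variable {r : ℕ} {U : Type*} [NormedAddCommGroup U] [InnerProductSpace ℝ U] (A : TAlgebra r U)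

variable [FiniteDimensional ℝ U]

theorem fourierInv_eq_laplaceInt (h : A.V → ℂ) (x : A.V) :
    A.fourierInv h x = laplaceInt h x 0 := by
  simp only [fourierInv, laplaceInt, laplaceKer_zero_right]

theorem laplaceInt_neg_eq_fourier (f : A.V → ℂ) (ξ : A.V) :
    laplaceInt f (-ξ) 0 = (((2 * Real.pi) ^ Module.finrank ℝ A.V : ℝ) : ℂ) * A.fourier f ξ := by
  rw [fourier, ← mul_assoc, ← Complex.ofReal_mul, mul_inv_cancel₀ (by positivity),
    Complex.ofReal_one, one_mul, laplaceInt]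
  congr 1
  ext x
  rw [laplaceKer_zero_right, inner_neg_left, real_inner_comm]
  simp

theorem exists_schwartz_fourier (f : 𝓢(A.V, ℂ)) : ∃ h : 𝓢(A.V, ℂ), ⇑h = A.fourier f := by
  obtain ⟨g, hg⟩ := exists_schwartz_laplaceInt f
  refine ⟨(((2 * Real.pi) ^ Module.finrank ℝ A.V)⁻¹ : ℝ) •
    SchwartzMap.compCLMOfContinuousLinearEquiv ℂ (ContinuousLinearEquiv.neg ℝ) g, ?_⟩
  ext ξ
  have h1 : A.fourier f ξ = (((2 * Real.pi) ^ Module.finrank ℝ A.V)⁻¹ : ℝ) *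
      laplaceInt f (-ξ) 0 := by
    rw [laplaceInt_neg_eq_fourier, ← mul_assoc, ← Complex.ofReal_mul,
      inv_mul_cancel₀ (by positivity), Complex.ofReal_one, one_mul]
  rw [h1, ← hg, smul_apply, Complex.real_smul]
  rfl

theorem laplaceInt_fourier (φ : 𝓢(A.V, ℂ)) (ξ : A.V) :
    laplaceInt (A.fourier φ) ξ 0 = φ ξ := by
  obtain ⟨g, hg⟩ := exists_schwartz_laplaceInt φ
  have h1 := laplaceInt_laplaceInt φ.continuous φ.integrable
    (by simpa only [← hg] using g.integrable) ξ
  have hpi : (((2 * Real.pi) ^ Module.finrank ℝ A.V : ℝ) : ℂ) ≠ 0 := by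
    rw [Complex.ofReal_ne_zero]; positivity
  have h2 : laplaceInt (fun x => laplaceInt φ x 0) (-ξ) 0 =
      (((2 * Real.pi) ^ Module.finrank ℝ A.V : ℝ) : ℂ) * laplaceInt (A.fourier φ) ξ 0 := by
    rw [laplaceInt, ← integral_neg_eq_self, laplaceInt, ← integral_const_mul]
    congr 1
    ext x
    rw [laplaceInt_neg_eq_fourier, laplaceKer_zero_right, laplaceKer_zero_right, inner_neg_neg]
    ring
  exact mul_left_cancel₀ hpi (h2.symm.trans h1)

theorem convolution_fourierInv {f m : A.V → ℂ} (hf : Integrable f) (hm : Integrable m) (x : A.V) :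
    convolution f (A.fourierInv m) (ContinuousLinearMap.mul ℝ ℂ) volume x =
      (((2 * Real.pi) ^ Module.finrank ℝ A.V : ℝ) : ℂ) *
        laplaceInt (fun ξ => A.fourier f ξ * m ξ) x 0 := by
  have h := integral_mul_laplaceInt_sub hf hm (B := ContinuousLinearMap.id ℝ A.V)
    (C := ContinuousLinearMap.id ℝ A.V) (fun _ _ => rfl) x
  simp only [convolution, ContinuousLinearMap.mul_apply', fourierInv_eq_laplaceInt]
  refine h.trans ?_
  simp only [laplaceInt, ← integral_const_mul]
  congr 1
  ext ξ
  have := A.laplaceInt_neg_eq_fourier f ξ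
  rw [laplaceInt] at this
  rw [ContinuousLinearMap.id_apply, this]
  ring

/-- Composing with B moves the spectrum by the adjoint C. Pairing with the transform of a test
function φ gives the integral of φ(C ξ) against the symbol, which vanishes when φ is supported off
Z. -/
theorem fourierSupport_laplaceInt_subset {m : A.V → ℂ} {y : A.V}
    (hm : Integrable fun ξ => laplaceKer 0 y ξ * m ξ) {B C : A.V →L[ℝ] A.V}
    (hBC : ∀ t ξ, inner ℝ (B t) ξ = inner ℝ t (C ξ)) {Z : Set A.V} (hZ : IsClosed Z)
    (hmZ : ∀ ξ, m ξ ≠ 0 → C ξ ∈ Z) :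
    A.fourierSupport (fun x => laplaceInt m (B x) y) ⊆ Z := by
  intro ξ₀ hξ₀
  by_contra hn
  obtain ⟨φ, hφ, hne⟩ := hξ₀ Zᶜ (hZ.isOpen_compl.mem_nhds hn)
  refine hne ?_
  obtain ⟨g, hg⟩ := A.exists_schwartz_fourier φ
  have h := integral_mul_laplaceInt_sub (k := A.fourier φ) (hg ▸ g.integrable) hm
    (B := -B) (C := -C) (fun t ξ => by simp [hBC]) 0
  simp only [neg_apply, zero_sub, neg_neg, laplaceInt_fourier] at h
  have h2 : ∀ x, laplaceInt m (B x) y * A.fourier φ x =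
      A.fourier φ x * laplaceInt (fun ξ => laplaceKer 0 y ξ * m ξ) (B x) 0 := fun x => by
    rw [laplaceInt_eq_zero_right m, mul_comm]
  simp only [h2]
  rw [h, laplaceInt]
  refine integral_eq_zero_of_ae (Filter.Eventually.of_forall fun ξ => ?_)
  rcases eq_or_ne (m ξ) 0 with h0 | h0
  · simp [h0]
  · have : φ (C ξ) = 0 := by
      by_contra hc
      exact hφ (subset_tsupport _ hc) (hmZ ξ h0)
    simp [this]

end TAlgebra

end

open MeasureTheory Set
open scoped ENNReal NNReal SchwartzMap

set_option linter.unusedSectionVars false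

noncomputable section

namespace TAlgebra

variable {r : ℕ} {U : Type*} [NormedAddCommGroup U] [InnerProductSpace ℝ U] (A : TAlgebra r U)

variable [FiniteDimensional ℝ U]

open scoped Topology

/-! ### Pieces of a function with spectrum in the cone -/

variable {A}

/-- Cuts the support of the bump into finitely many pieces, each consisting of points (u a)⋆(u a)
with u within ε of 1. The support of φ_j itself, after a triangular dilation, need not fit into one
ball B_2(ξ_k); these pieces do. -/
theorem LittlewoodPaley.exists_partition (hA : A.IsSymmetric) (L : A.LittlewoodPaley) {ε : ℝ}
    (hε : 0 < ε) (hε1 : ε ≤ A.rad) :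
    ∃ (s : Finset A.Hg) (M : ℝ) (θ : A.Hg → 𝓢(A.V, ℂ)), 1 ≤ M ∧ (∀ a ∈ s, a ∈ A.bddH M) ∧
      (∀ a ∈ s, HasCompactSupport (θ a)) ∧
      (∀ a ∈ s, ∀ ξ ∈ tsupport (θ a), ∃ u : A.Hg, ‖(u : A.Up) - 1‖ < ε ∧ ξ = A.sqs (u * a : A.Hg)) ∧
      ∀ ξ ∈ tsupport L.bump, ∑ a ∈ s, θ a ξ = 1 := by
  classical
  set N : Set A.V := interior (A.sqs '' Metric.ball 1 ε)
  have heN : A.e ∈ N := by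
    exact mem_interior_iff_mem_nhds.2 (A.image_sqs_mem_nhds (Metric.ball_mem_nhds _ hε))
  have hO : ∀ a : A.Hg, IsOpen (A.PE a '' N) := fun a =>
    (A.PE a).toHomeomorph.isOpenMap _ isOpen_interior
  have hsub : ∀ a : A.Hg, ∀ ξ ∈ A.PE a '' N, ∃ u : A.Hg, ‖(u : A.Up) - 1‖ < ε ∧
      ξ = A.sqs (u * a : A.Hg) := by
    rintro a _ ⟨_, hη, rfl⟩
    obtain ⟨u, hu, rfl⟩ := interior_subset hη
    rw [mem_ball_iff_norm] at hu
    obtain ⟨u, rfl⟩ := exists_Hg_eq (A.ball_subset_Hset (hu.trans_le hε1))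
    exact ⟨u, hu, by rw [PE_sqs, Hg.coe_mul]⟩
  obtain ⟨s, hs⟩ := L.bump_compact.isCompact.elim_finite_subcover (fun a : A.Hg => A.PE a '' N) hO
    (fun ξ hξ => by
      obtain ⟨a, rfl⟩ := hA.mem_cone_iff.1 (L.bump_tsupport hξ).1
      exact mem_iUnion.2 ⟨a, A.e, heN, A.PE_e a⟩)
  obtain ⟨f, hf⟩ := SmoothPartitionOfUnity.exists_isSubordinate (modelWithCornersSelf ℝ A.V)
    (isClosed_tsupport L.bump) (fun a : s => A.PE (a : A.Hg) '' N) (fun a => hO a)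
    (hs.trans (by
      intro ξ hξ
      simp only [mem_iUnion] at hξ ⊢
      obtain ⟨a, ha, h⟩ := hξ
      exact ⟨⟨a, ha⟩, h⟩))
  have hcomp : ∀ a : s, HasCompactSupport (f a) := by
    intro a
    refine Metric.isCompact_of_isClosed_isBounded (isClosed_tsupport _) ?_
    refine (Metric.isBounded_closedBall (x := (0 : A.V))
      (r := A.cb * (2 * ‖((a : A.Hg) : A.Up)‖) ^ 2)).subset fun ξ hξ => ?_
    obtain ⟨u, hu, rfl⟩ := hsub _ _ (hf a hξ)
    rw [mem_closedBall_zero_iff]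
    refine (A.norm_sqsMap_le _).trans ?_
    have := A.cb_pos
    gcongr
    rw [Hg.coe_mul]
    exact A.norm_mul_le_two_of_ball (hu.trans_le hε1) _
  have hcast : ∀ a : s, tsupport (fun ξ => ((f a ξ : ℝ) : ℂ)) ⊆ tsupport (f a) := fun a =>
    tsupport_comp_subset (g := fun x : ℝ => (x : ℂ)) Complex.ofReal_zero (f a)
  have hcompC : ∀ a : s, HasCompactSupport (fun ξ => ((f a ξ : ℝ) : ℂ)) := fun a =>
    (hcomp a).of_isClosed_subset (isClosed_tsupport _) (hcast a)
  set θ : A.Hg → 𝓢(A.V, ℂ) := fun a => if h : a ∈ s then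
    (hcompC ⟨a, h⟩).toSchwartzMap (Complex.ofRealCLM.contDiff.comp (f ⟨a, h⟩).contMDiff.contDiff)
    else 0
  have hθ : ∀ a (h : a ∈ s), ⇑(θ a) = fun ξ => ((f ⟨a, h⟩ ξ : ℝ) : ℂ) := fun a h => by
    simp only [θ, dif_pos h]; rfl
  refine ⟨s, 1 + ∑ a ∈ s, (‖(a : A.Up)‖ + ‖((a⁻¹ : A.Hg) : A.Up)‖), θ, ?_, fun a ha => ?_,
    fun a ha => ?_, fun a ha ξ hξ => ?_, fun ξ hξ => ?_⟩
  · have : 0 ≤ ∑ a ∈ s, (‖(a : A.Up)‖ + ‖((a⁻¹ : A.Hg) : A.Up)‖) :=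
      Finset.sum_nonneg fun a _ => by positivity
    linarith
  · have h1 : ‖(a : A.Up)‖ + ‖((a⁻¹ : A.Hg) : A.Up)‖ ≤
        ∑ a ∈ s, (‖(a : A.Up)‖ + ‖((a⁻¹ : A.Hg) : A.Up)‖) :=
      Finset.single_le_sum (f := fun a : A.Hg => ‖(a : A.Up)‖ + ‖((a⁻¹ : A.Hg) : A.Up)‖)
        (fun a _ => by positivity) ha
    have h2 := norm_nonneg (a : A.Up)
    have h3 := norm_nonneg ((a⁻¹ : A.Hg) : A.Up)
    exact ⟨by linarith, by linarith⟩
  · rw [hθ a ha]; exact hcompC ⟨a, ha⟩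
  · rw [hθ a ha] at hξ
    exact hsub a ξ (hf ⟨a, ha⟩ (hcast _ hξ))
  · have h1 := f.sum_eq_one hξ
    rw [finsum_eq_sum_of_fintype] at h1
    rw [← Finset.sum_coe_sort s fun a => θ a ξ]
    have h2 : ∀ a : s, θ a ξ = ((f a ξ : ℝ) : ℂ) := fun a => congrFun (hθ a a.2) ξ
    simp only [h2]
    rw [← Complex.ofReal_sum, h1, Complex.ofReal_one]

/-- On the support ξ = (u a)⋆(u a), so (t t⋆ | ξ) = ‖u a t‖² is at least (‖t‖ / (2 `cb` M))²: factor
2 for removing u, factor `cb` M for removing a. The decay of Laplace integrals converts this lower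
bound into the Gaussian factor. -/
theorem exists_lintegral_enorm_laplaceInt_le {ε : ℝ} (hε1 : ε ≤ A.rad) {M : ℝ} (hM : 1 ≤ M)
    {a : A.Hg} (ha : a ∈ A.bddH M) {θ : 𝓢(A.V, ℂ)}
    (hθ : ∀ ξ ∈ tsupport θ, ∃ u : A.Hg, ‖(u : A.Up) - 1‖ < ε ∧ ξ = A.sqs (u * a : A.Hg)) :
    ∃ C : ℝ≥0, ∀ t : A.Up, Integrable (fun x => laplaceInt θ x (A.sq t)) ∧
      ∫⁻ x, ‖laplaceInt θ x (A.sq t)‖ₑ ≤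
        C * ENNReal.ofReal (Real.exp (-((2 * A.cb * M)⁻¹ ^ 2 * ‖t‖ ^ 2))) := by
  set N := Module.finrank ℝ A.V + 1
  obtain ⟨C, hC0, hC⟩ := exists_norm_laplaceInt_le N θ
  have hint : Integrable (fun x : A.V => (1 + ‖x‖) ^ (-(N : ℝ))) :=
    integrable_one_add_norm (by simp [N])
  have hcb := A.cb_pos
  have hlow : ∀ (t : A.Up), ∀ ξ ∈ tsupport θ, (2 * A.cb * M)⁻¹ ^ 2 * ‖t‖ ^ 2 ≤
      inner ℝ (A.sq t) ξ := by
    intro t ξ hξ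
    obtain ⟨u, hu, rfl⟩ := hθ ξ hξ
    rw [inner_sq_sqs, ← mul_pow]
    gcongr
    rw [Hg.coe_mul, mul_assoc (u : A.Up), inv_mul_le_iff₀ (by positivity)]
    have h1 := A.norm_le_two_mul_of_ball (hu.trans_le hε1) ((a : A.Up) * t)
    have h2 := A.norm_le_of_mem_bddH (A.inv_mem_bddH ha) ((a : A.Up) * t)
    rw [← mul_assoc, Hg.coe_inv_mul, one_mul] at h2
    calc ‖t‖ ≤ A.cb * M * ‖(a : A.Up) * t‖ := h2
      _ ≤ A.cb * M * (2 * ‖(u : A.Up) * (a * t)‖) := by gcongr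
      _ = _ := by ring
  have hpt : ∀ (t : A.Up) x, ‖laplaceInt θ x (A.sq t)‖ ≤
      C * Real.exp (-((2 * A.cb * M)⁻¹ ^ 2 * ‖t‖ ^ 2)) * (1 + ‖x‖) ^ (-(N : ℝ)) := by
    intro t x
    have h1 := hC _ _ (hlow t) x
    rw [Real.rpow_neg (by positivity), Real.rpow_natCast, ← div_eq_mul_inv,
      le_div_iff₀ (by positivity), mul_comm]
    refine (mul_le_mul_of_nonneg_right (pow_le_pow_left₀ (by positivity) ?_ _)
      (norm_nonneg _)).trans h1
    exact le_add_of_nonneg_right (norm_nonneg _)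
  refine ⟨(C * ∫ x : A.V, (1 + ‖x‖) ^ (-(N : ℝ))).toNNReal, fun t => ⟨?_, ?_⟩⟩
  · refine (hint.const_mul _).mono' ?_ (Filter.Eventually.of_forall (hpt t))
    exact (continuous_laplaceInt θ.integrable (fun ξ hξ => hlow t ξ
      (subset_tsupport _ hξ))).aestronglyMeasurable
  · have hI : 0 ≤ ∫ x : A.V, (1 + ‖x‖) ^ (-(N : ℝ)) := integral_nonneg fun x => by positivity
    calc _ ≤ ∫⁻ x, ENNReal.ofReal (C * Real.exp (-((2 * A.cb * M)⁻¹ ^ 2 * ‖t‖ ^ 2)) *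
          (1 + ‖x‖) ^ (-(N : ℝ))) := by
          refine lintegral_mono fun x => ?_
          rw [← ofReal_norm]
          exact ENNReal.ofReal_le_ofReal (hpt t x)
      _ = ENNReal.ofReal (C * Real.exp (-((2 * A.cb * M)⁻¹ ^ 2 * ‖t‖ ^ 2)) *
          ∫ x : A.V, (1 + ‖x‖) ^ (-(N : ℝ))) := by
          rw [← ofReal_integral_eq_lintegral_ofReal (hint.const_mul _)
            (Filter.Eventually.of_forall fun x => by positivity), integral_const_mul]
      _ = _ := by
          rw [← ENNReal.ofReal, ← ENNReal.ofReal_mul (by positivity)]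
          congr 1
          ring

theorem laplaceInt_laplaceInt_right {E : Type*} [NormedAddCommGroup E] [InnerProductSpace ℝ E]
    [MeasurableSpace E] [BorelSpace E] [FiniteDimensional ℝ E] (θ : 𝓢(E, ℂ)) {y : E} {b : ℝ}
    (hb : ∀ ξ, θ ξ ≠ 0 → b ≤ inner ℝ y ξ) (hκ : Integrable fun t => laplaceInt θ t y) (ξ : E) :
    laplaceInt (fun t => laplaceInt θ t y) (-ξ) 0 =
      (((2 * Real.pi) ^ Module.finrank ℝ E : ℝ) : ℂ) * (laplaceKer 0 y ξ * θ ξ) := by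
  have hk : (fun t => laplaceInt θ t y) =
      fun t => laplaceInt (fun ξ => laplaceKer 0 y ξ * θ ξ) t 0 :=
    funext fun t => laplaceInt_eq_zero_right _ _ _
  rw [hk] at hκ ⊢
  have hc : Continuous (laplaceKer (0 : E) y) :=
    continuous_laplaceKer.comp (Continuous.prodMk_right ((0 : E), y))
  exact laplaceInt_laplaceInt (h := fun ξ => laplaceKer 0 y ξ * θ ξ) (hc.mul θ.continuous)
    (integrable_laplaceKer_mul θ.integrable hb 0) hκ ξ

/-- Since (y | ξ) = (π(w) y | g_w⁻¹ ξ), the dilated cut-off θ(g_w⁻¹ ξ) at height y is the dilate of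
θ at height π(w) y. Its convolution kernel is a rescaled Laplace integral of θ, and the L¹ norm
depends only on π(w) y. -/
theorem laplaceInt_mul_comp_PE (w : A.Hg) {m : A.V → ℂ} (hm : Integrable m) (θ : 𝓢(A.V, ℂ))
    {y : A.V} {b : ℝ} (hb : ∀ ξ, θ ξ ≠ 0 → b ≤ inner ℝ (A.piE w y) ξ)
    (hκ : Integrable fun t => laplaceInt θ t (A.piE w y)) (x : A.V) :
    ∫ t, laplaceInt θ t (A.piE w y) * laplaceInt m (x - A.piE w⁻¹ t) 0 =
      (((2 * Real.pi) ^ Module.finrank ℝ A.V : ℝ) : ℂ) *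
        laplaceInt (fun ξ => m ξ * θ (A.PE w⁻¹ ξ)) x y := by
  have h := integral_mul_laplaceInt_sub hκ hm (B := (A.piE w⁻¹ : A.V →L[ℝ] A.V))
    (C := (A.PE w⁻¹ : A.V →L[ℝ] A.V)) (fun t ξ => (A.inner_PE w⁻¹ t ξ).symm) x
  refine h.trans ?_
  simp only [ContinuousLinearEquiv.coe_coe]
  have h2 : ∀ ξ, laplaceInt (fun t => laplaceInt θ t (A.piE w y)) (-ξ) 0 =
      (((2 * Real.pi) ^ Module.finrank ℝ A.V : ℝ) : ℂ) * (laplaceKer 0 (A.piE w y) ξ * θ ξ) := by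
    intro ξ
    exact laplaceInt_laplaceInt_right θ hb hκ ξ
  simp only [h2]
  rw [laplaceInt_eq_zero_right (fun ξ => m ξ * _)]
  simp only [laplaceInt, ← integral_const_mul]
  congr 1
  ext ξ
  have h4 : laplaceKer 0 (A.piE w y) (A.PE w⁻¹ ξ) = laplaceKer 0 y ξ := by
    rw [laplaceKer, laplaceKer, ← inner_PE, ← A.PE_mul, inv_mul_cancel, PE_one, inner_zero_left,
      inner_zero_left]
  rw [h4]
  ring

namespace LittlewoodPaley

variable (L : A.LittlewoodPaley)

/-- The part `h χ_j θ(g_j⁻¹ ·)` of a symbol `h`. -/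
def part (h : A.V → ℂ) (θ : A.V → ℂ) (j : ℕ) (ξ : A.V) : ℂ :=
  h ξ * (L.chi j ξ : ℂ) * θ (A.PE (L.wt j)⁻¹ ξ)

theorem integrable_mul_chi (hA : A.IsSymmetric) {h : A.V → ℂ} (hh : Integrable h) (j : ℕ) :
    Integrable fun ξ => h ξ * (L.chi j ξ : ℂ) := by
  refine hh.mul_bdd (c := 1) ?_ (Filter.Eventually.of_forall fun ξ => ?_)
  · exact (Complex.measurable_ofReal.comp (L.measurable_chi hA j)).aestronglyMeasurable
  · rw [Complex.norm_real, Real.norm_of_nonneg (L.chi_nonneg j ξ)]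
    exact L.chi_le_one hA j ξ

theorem integrable_part (hA : A.IsSymmetric) {h : A.V → ℂ} (hh : Integrable h) {θ : A.V → ℂ}
    (hθ : Continuous θ) (hθc : HasCompactSupport θ) (j : ℕ) : Integrable (L.part h θ j) := by
  obtain ⟨C, hC⟩ := hθ.bounded_above_of_compact_support hθc
  exact (L.integrable_mul_chi hA hh j).mul_bdd (c := C)
    (hθ.comp (A.PE _).continuous).aestronglyMeasurable (Filter.Eventually.of_forall fun ξ => hC _)

theorem mem_cone_of_part_ne_zero (hA : A.IsSymmetric) {h θ : A.V → ℂ} {j : ℕ} {ξ : A.V}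
    (hp : L.part h θ j ξ ≠ 0) : ξ ∈ A.cone := by
  refine L.mem_cone_of_phi_ne_zero hA (j := j) fun h0 => hp ?_
  simp [part, L.chi_eq_zero h0]

theorem eLpNorm_part_le (hA : A.IsSymmetric) (f : 𝓢(A.V, ℂ)) {θ : 𝓢(A.V, ℂ)} {p : ℝ} (hp : 1 ≤ p)
    {t : A.Up} {j : ℕ} {b : ℝ} (hb : ∀ ξ, θ ξ ≠ 0 → b ≤ inner ℝ (A.sq (L.wt j * t)) ξ)
    (hκ : Integrable fun x => laplaceInt θ x (A.sq (L.wt j * t))) :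
    eLpNorm (fun x => laplaceInt (L.part (A.fourier f) θ j) x (A.sq t)) (ENNReal.ofReal p) volume ≤
      (∫⁻ x, ‖laplaceInt θ x (A.sq (L.wt j * t))‖ₑ) *
        eLpNorm (convolution f (L.psi j) (ContinuousLinearMap.mul ℝ ℂ) volume)
          (ENNReal.ofReal p) volume := by
  obtain ⟨h, hh⟩ := A.exists_schwartz_fourier f
  have hm : Integrable fun ξ => A.fourier f ξ * (L.chi j ξ : ℂ) :=
    L.integrable_mul_chi hA (hh ▸ h.integrable) j
  -- The powers of 2π left by the normalisations are at least 1 and occur on the larger side, so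
  -- they can be dropped.
  have hpi : 1 ≤ ((2 * Real.pi) ^ Module.finrank ℝ A.V : ℝ) :=
    one_le_pow₀ (by linarith [Real.pi_gt_three])
  have hle : ∀ z : ℂ, ‖z‖ ≤ ‖(((2 * Real.pi) ^ Module.finrank ℝ A.V : ℝ) : ℂ) * z‖ := fun z => by
    rw [norm_mul, Complex.norm_real, Real.norm_of_nonneg (by positivity)]
    exact le_mul_of_one_le_left (norm_nonneg _) hpi
  rw [← piE_sq] at hb hκ ⊢
  have hid := laplaceInt_mul_comp_PE (L.wt j) hm θ hb hκ
  have h1 : eLpNorm (fun x => laplaceInt (L.part (A.fourier f) θ j) x (A.sq t))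
      (ENNReal.ofReal p) volume ≤ eLpNorm (fun x => ∫ s, laplaceInt θ s (A.piE (L.wt j) (A.sq t)) *
        laplaceInt (fun ξ => A.fourier f ξ * (L.chi j ξ : ℂ))
          (x - (A.piE (L.wt j)⁻¹ : A.V →L[ℝ] A.V) s)
          0) (ENNReal.ofReal p) volume := by
    refine eLpNorm_mono fun x => ?_
    rw [ContinuousLinearEquiv.coe_coe, hid x]
    exact hle _
  refine h1.trans ((eLpNorm_integral_comp_sub_le (continuous_laplaceInt θ.integrable hb)
    (continuous_laplaceInt hm (a := 0) (fun ξ _ => by simp)) _ hp).trans ?_)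
  gcongr
  refine eLpNorm_mono fun x => ?_
  have hchi : Integrable fun ξ => ((L.chi j ξ : ℝ) : ℂ) := (L.integrable_chi hA j).ofReal
  have := A.convolution_fourierInv f.integrable hchi x
  change _ ≤ ‖convolution f (A.fourierInv fun ξ => ((L.chi j ξ : ℝ) : ℂ)) _ volume x‖
  rw [this]
  exact hle _

end LittlewoodPaley

end TAlgebra

end

open MeasureTheory Set
open scoped ENNReal NNReal SchwartzMap

set_option linter.unusedSectionVars false

noncomputable section

namespace TAlgebra

variable {r : ℕ} {U : Type*} [NormedAddCommGroup U] [InnerProductSpace ℝ U] (A : TAlgebra r U)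

variable [FiniteDimensional ℝ U]

open scoped Topology

/-! ### The decoupling inequality for the pieces -/

section Aux

variable {E : Type*} [NormedAddCommGroup E] [InnerProductSpace ℝ E]
  [MeasurableSpace E] [BorelSpace E] [FiniteDimensional ℝ E]

theorem exists_eLpNorm_comp_eq (e : E ≃L[ℝ] E) (p : ℝ≥0∞) (hp : p ≠ ∞) : ∃ c : ℝ≥0∞, c ≠ 0 ∧
    c ≠ ∞ ∧ ∀ g : E → ℂ, eLpNorm (fun x => g (e x)) p volume = c * eLpNorm g p volume := by
  obtain ⟨c, hc⟩ := exists_volume_eq_smul_map (volume : Measure E) (volume : Measure E) e.symm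
  have hc0 : c ≠ 0 := by
    rintro rfl
    rw [zero_smul] at hc
    exact NeZero.ne (volume : Measure E) hc
  refine ⟨(c : ℝ≥0∞) ^ (1 / p).toReal, ?_, ?_, fun g => ?_⟩
  · exact (ENNReal.rpow_pos (by simpa using pos_iff_ne_zero.2 hc0) ENNReal.coe_ne_top).ne'
  · exact ENNReal.rpow_ne_top_of_nonneg ENNReal.toReal_nonneg ENNReal.coe_ne_top
  · conv_lhs => rw [hc]
    have h1 : (c • (volume : Measure E).map e.symm) =
        (c : ℝ≥0∞) • (volume : Measure E).map e.symm := rfl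
    have h2 := e.symm.toHomeomorph.measurableEmbedding.eLpNorm_map_measure (μ := volume)
      (g := fun x => g (e x)) (p := p)
    have h3 : (fun x => g (e x)) ∘ e.symm.toHomeomorph = g := by
      ext x
      exact congrArg g (e.apply_symm_apply x)
    rw [h3] at h2
    rw [h1, eLpNorm_smul_measure_of_ne_top hp, smul_eq_mul]
    exact congrArg _ h2

theorem laplaceInt_finset_sum {ι : Type*} (P : Finset ι) {m : ι → E → ℂ} {y : E} {a : ℝ}
    (hm : ∀ i ∈ P, Integrable (m i)) (ha : ∀ i ∈ P, ∀ ξ, m i ξ ≠ 0 → a ≤ inner ℝ y ξ) (x : E) :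
    laplaceInt (fun ξ => ∑ i ∈ P, m i ξ) x y = ∑ i ∈ P, laplaceInt (m i) x y := by
  simp only [laplaceInt, Finset.mul_sum]
  exact integral_finsetSum _ fun i hi => integrable_laplaceKer_mul (hm i hi) (ha i hi) x

/-- Several pieces may be attached to the same lattice point. At most N are, and convexity of the
power s then costs N^{s-1}. -/
theorem sum_fiber_eLpNorm_le {α ι : Type*} [MeasurableSpace α] {μ : Measure α} (P : Finset ι)
    (k : ι → ℕ) {f : ι → α → ℂ} (hf : ∀ i ∈ P, AEStronglyMeasurable (f i) μ) {p : ℝ≥0∞}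
    (hp : 1 ≤ p) {s : ℝ} (hs : 1 ≤ s) {N : ℕ} (hN : ∀ n, (P.filter fun i => k i = n).card ≤ N)
    (b : ℕ → ℝ≥0∞) :
    ∑ n ∈ P.image k, b n * eLpNorm (∑ i ∈ P with k i = n, f i) p μ ^ s ≤
      (N : ℝ≥0∞) ^ (s - 1) * ∑ i ∈ P, b (k i) * eLpNorm (f i) p μ ^ s := by
  have h1 : ∀ n, eLpNorm (∑ i ∈ P with k i = n, f i) p μ ^ s ≤
      (N : ℝ≥0∞) ^ (s - 1) * ∑ i ∈ P with k i = n, eLpNorm (f i) p μ ^ s := by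
    intro n
    refine (ENNReal.rpow_le_rpow (eLpNorm_sum_le (fun i hi => hf i (Finset.mem_filter.1 hi).1) hp)
      (by linarith)).trans ?_
    refine (ENNReal.rpow_sum_le_const_mul_sum_rpow _ _ hs).trans ?_
    exact mul_le_mul_left (ENNReal.rpow_le_rpow (by exact_mod_cast hN n) (by linarith)) _
  rw [Finset.mul_sum, ← Finset.sum_fiberwise_of_maps_to (g := k)
    (fun i hi => Finset.mem_image_of_mem k hi)]
  refine Finset.sum_le_sum fun n _ => ?_
  calc _ ≤ b n * ((N : ℝ≥0∞) ^ (s - 1) * ∑ i ∈ P with k i = n, eLpNorm (f i) p μ ^ s) := by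
        gcongr; exact h1 n
    _ = ∑ i ∈ P with k i = n, (N : ℝ≥0∞) ^ (s - 1) * (b n * eLpNorm (f i) p μ ^ s) := by
        rw [Finset.mul_sum, Finset.mul_sum]
        refine Finset.sum_congr rfl fun i _ => ?_
        ring
    _ = _ := Finset.sum_congr rfl fun i hi => by rw [(Finset.mem_filter.1 hi).2]

end Aux

variable {A}

/-- The hypothesis is applied to the functions composed with π(W), whose spectra are moved by g_W.
The composition multiplies every L^p norm by the same constant c, which cancels, so W may be chosen
freely. -/
theorem LittlewoodPaley.Decoupling.sum_laplaceInt_le {L : A.LittlewoodPaley} {p s : ℝ}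
    (hp : 1 ≤ p) (hs : 1 ≤ s) {μ : Fin r → ℝ} {δ : ℝ} {C : ℝ≥0} (hdec : L.Decoupling p s μ δ C)
    {ι : Type*} (P : Finset ι) (k : ι → ℕ) {m : ι → A.V → ℂ} {y : A.V} {Z : ι → Set A.V}
    (hZ : ∀ i ∈ P, IsCompact (Z i)) (hZb : ∀ i ∈ P, Z i ⊆ A.dBall (L.pt (k i)) 2) (W : A.Hg)
    (hm : ∀ i ∈ P, Integrable (m i)) (hpos : ∀ i ∈ P, ∀ ξ, m i ξ ≠ 0 → 0 ≤ inner ℝ y ξ)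
    (hmZ : ∀ i ∈ P, ∀ ξ, m i ξ ≠ 0 → A.PE W ξ ∈ Z i)
    (hfin : ∀ i ∈ P, eLpNorm (fun x => laplaceInt (m i) x y) (ENNReal.ofReal p) volume < ∞)
    {N : ℕ} (hN : ∀ n, (P.filter fun i => k i = n).card ≤ N) :
    eLpNorm (fun x => ∑ i ∈ P, laplaceInt (m i) x y) (ENNReal.ofReal p) volume ≤
      C * ((N : ℝ≥0∞) ^ (s - 1) * ∑ i ∈ P,
        ENNReal.ofReal (A.Qstarpow (fun i => -μ i) (L.pt (k i)) *
          Real.exp (δ * inner ℝ (L.pt (k i)) A.e)) *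
          eLpNorm (fun x => laplaceInt (m i) x y) (ENNReal.ofReal p) volume ^ s) ^ (1 / s) := by
  have hs0 : 0 < s := by linarith
  have hp' : 1 ≤ ENNReal.ofReal p := by
    rw [← ENNReal.ofReal_one]; exact ENNReal.ofReal_le_ofReal hp
  obtain ⟨c, hc0, hct, hc⟩ := exists_eLpNorm_comp_eq (A.piE W) (ENNReal.ofReal p)
    ENNReal.ofReal_ne_top
  set f : ι → A.V → ℂ := fun i x => laplaceInt (m i) (A.piE W x) y
  have hfc : ∀ i ∈ P, Continuous (f i) := fun i hi =>
    (continuous_laplaceInt (hm i hi) (hpos i hi)).comp (A.piE W).continuous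
  have hfn : ∀ i, eLpNorm (f i) (ENNReal.ofReal p) volume =
      c * eLpNorm (fun x => laplaceInt (m i) x y) (ENNReal.ofReal p) volume := fun i =>
    hc fun x => laplaceInt (m i) x y
  have h1 := hdec (P.image k) (fun n => ∑ i ∈ P with k i = n, f i) (fun n _ => by
    constructor
    · refine memLp_finsetSum' _ fun i hi => ?_
      have hi' := (Finset.mem_filter.1 hi).1
      refine ⟨(hfc i hi').aestronglyMeasurable, ?_⟩
      rw [hfn]
      exact ENNReal.mul_lt_top hct.lt_top (hfin i hi')
    · have hint : ∀ i ∈ P.filter fun i => k i = n, Integrable (m i) :=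
        fun i hi => hm i (Finset.mem_filter.1 hi).1
      have hpos' : ∀ i ∈ P.filter fun i => k i = n, ∀ ξ, m i ξ ≠ 0 → 0 ≤ inner ℝ y ξ :=
        fun i hi => hpos i (Finset.mem_filter.1 hi).1
      have h2 : (∑ i ∈ P with k i = n, f i) =
          fun x => laplaceInt (fun ξ => ∑ i ∈ P with k i = n, m i ξ)
            ((A.piE W : A.V →L[ℝ] A.V) x) y := by
        ext x
        rw [laplaceInt_finset_sum _ hint hpos', Finset.sum_apply]
        rfl
      have hex : ∀ ξ, (∑ i ∈ P with k i = n, m i ξ) ≠ 0 →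
          ∃ i ∈ P.filter fun i => k i = n, m i ξ ≠ 0 := fun ξ hξ =>
        Finset.exists_ne_zero_of_sum_ne_zero hξ
      rw [h2]
      refine (A.fourierSupport_laplaceInt_subset
        (m := fun ξ => ∑ i ∈ P with k i = n, m i ξ) (y := y)
        (Z := ⋃ i ∈ P.filter fun i => k i = n, Z i) ?_ (C := (A.PE W : A.V →L[ℝ] A.V))
        (fun t ξ => (A.inner_PE W t ξ).symm) ?_ fun ξ hξ => ?_).trans ?_
      · refine integrable_laplaceKer_mul (a := 0) (integrable_finsetSum _ hint) (fun ξ hξ => ?_) 0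
        obtain ⟨i, hi, hne⟩ := hex ξ hξ
        exact hpos' i hi ξ hne
      · exact ((P.filter fun i => k i = n).isCompact_biUnion fun i hi =>
          hZ i (Finset.mem_filter.1 hi).1).isClosed
      · obtain ⟨i, hi, hne⟩ := hex ξ hξ
        exact mem_biUnion (x := i) hi (hmZ i (Finset.mem_filter.1 hi).1 ξ hne)
      · refine iUnion₂_subset fun i hi => ?_
        obtain ⟨h3, rfl⟩ := Finset.mem_filter.1 hi
        exact hZb i h3)
  have h4 : eLpNorm (∑ n ∈ P.image k, ∑ i ∈ P with k i = n, f i) (ENNReal.ofReal p) volume =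
      c * eLpNorm (fun x => ∑ i ∈ P, laplaceInt (m i) x y) (ENNReal.ofReal p) volume := by
    rw [Finset.sum_fiberwise_of_maps_to (fun i hi => Finset.mem_image_of_mem k hi),
      ← hc fun x => ∑ i ∈ P, laplaceInt (m i) x y]
    congr 1
    ext x
    rw [Finset.sum_apply]
  rw [h4] at h1
  have h5 := sum_fiber_eLpNorm_le (μ := volume) P k
    (fun i hi => (hfc i hi).aestronglyMeasurable) hp' hs hN
    fun n => ENNReal.ofReal (A.Qstarpow (fun i => -μ i) (L.pt n) *
      Real.exp (δ * inner ℝ (L.pt n) A.e))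
  have h6 := h1.trans (mul_le_mul_right (ENNReal.rpow_le_rpow h5 (by positivity)) _)
  simp only [hfn] at h6
  rw [← ENNReal.mul_le_mul_iff_right hc0 hct]
  refine h6.trans_eq ?_
  rw [mul_left_comm]
  congr 1
  have h7 : ∀ a b : ℝ≥0∞, a * (c * b) ^ s = c ^ s * (a * b ^ s) := fun a b => by
    rw [ENNReal.mul_rpow_of_nonneg _ _ hs0.le]; ring
  simp only [h7]
  rw [← Finset.mul_sum, mul_left_comm, ENNReal.mul_rpow_of_nonneg _ _ (by positivity),
    ← ENNReal.rpow_mul, mul_one_div_cancel hs0.ne', ENNReal.rpow_one]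

end TAlgebra

end

open MeasureTheory Set
open scoped ENNReal NNReal SchwartzMap

set_option linter.unusedSectionVars false

noncomputable section

namespace TAlgebra

variable {r : ℕ} {U : Type*} [NormedAddCommGroup U] [InnerProductSpace ℝ U] (A : TAlgebra r U)

variable [FiniteDimensional ℝ U]

open scoped Topology

/-! ### The norm of a Laplace integral at a fixed height -/

variable {A}

theorem exists_smul_one {c : ℝ} (hc : 0 < c) : ∃ S : A.Hg, ∀ t : A.Up, (S : A.Up) * t = c • t := by
  obtain ⟨S, hS⟩ := exists_Hg_eq (t := c • (1 : A.Up)) fun i => by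
    rw [map_smul, dg_one, smul_eq_mul, mul_one]; exact hc
  exact ⟨S, fun t => by rw [hS, smul_mul_assoc, one_mul]⟩

/-- Since S t v⁻¹ is bounded, v can be replaced by S t in the monomial up to a constant, and ‖v‖ is
at most a multiple of c‖t‖. The smallness of c lets half of the Gaussian e^{-sγ‖t‖²} absorb
e^{δ‖v‖²}. -/
theorem mon_mul_exp_le (κ : Fin r → ℝ) {δ γ B b c s : ℝ} (hδ : 0 ≤ δ) (hb : 0 < b) (hc : 0 ≤ c)
    (hcB : δ * (A.cb * B * c) ^ 2 ≤ s * γ / 2)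
    (hB : ∀ t ∈ A.bddH B, b ≤ A.mon κ t) {S t v : A.Hg} (hS : ∀ t : A.Up, (S : A.Up) * t = c • t)
    (hd : S * t * v⁻¹ ∈ A.bddH B) :
    A.mon κ v * Real.exp (δ * ‖(v : A.Up)‖ ^ 2) * Real.exp (-(γ * ‖(t : A.Up)‖ ^ 2)) ^ s ≤
      b⁻¹ * A.mon κ S * (A.mon κ t * Real.exp (-(s * γ / 2 * ‖(t : A.Up)‖ ^ 2))) := by
  set d := S * t * v⁻¹
  have hdv : d * v = S * t := by simp [d]
  have h1 : A.mon κ v ≤ b⁻¹ * A.mon κ S * A.mon κ t := by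
    have h2 : A.mon κ d * A.mon κ v = A.mon κ S * A.mon κ t := by
      rw [← mon_mul, ← mon_mul, ← Hg.coe_mul, ← Hg.coe_mul, hdv]
    rw [mul_assoc, ← h2, ← mul_assoc, inv_mul_eq_div]
    exact le_mul_of_one_le_left (A.mon_pos κ v).le ((one_le_div hb).2 (hB d hd))
  have h3 : ‖(v : A.Up)‖ ≤ A.cb * B * c * ‖(t : A.Up)‖ := by
    have hv : v = d⁻¹ * (S * t) := by rw [← hdv, inv_mul_cancel_left]
    have h4 := A.norm_le_of_mem_bddH (A.inv_mem_bddH hd) (S * t : A.Hg)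
    rw [← Hg.coe_mul, ← hv, Hg.coe_mul, hS, norm_smul, Real.norm_of_nonneg hc] at h4
    linarith
  rw [← Real.exp_mul, mul_assoc, ← Real.exp_add, ← mul_assoc (b⁻¹ * _)]
  have hm := A.mon_pos κ S
  have hm' := A.mon_pos κ t
  refine mul_le_mul h1 (Real.exp_le_exp.2 ?_) (Real.exp_pos _).le (by positivity)
  have h5 : δ * ‖(v : A.Up)‖ ^ 2 ≤ s * γ / 2 * ‖(t : A.Up)‖ ^ 2 := by
    calc δ * ‖(v : A.Up)‖ ^ 2 ≤ δ * (A.cb * B * c * ‖(t : A.Up)‖) ^ 2 := by gcongr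
      _ = δ * (A.cb * B * c) ^ 2 * ‖(t : A.Up)‖ ^ 2 := by ring
      _ ≤ _ := by gcongr
  linarith

/-- The norms `‖f * ψ_j‖_p`. -/
def LittlewoodPaley.lpNorm (L : A.LittlewoodPaley) (p : ℝ) (f : A.V → ℂ) (j : ℕ) : ℝ≥0∞ :=
  eLpNorm (convolution f (L.psi j) (ContinuousLinearMap.mul ℝ ℂ) volume) (ENNReal.ofReal p) volume

/-- The pieces resum to h: the θ_a add up to 1 wherever φ_j is nonzero, and the χ_j add up to 1 on
the cone. Partial sums of χ_j are at most 1, so |h| dominates. -/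
theorem tendsto_sum_part (hA : A.IsSymmetric) (L : A.LittlewoodPaley) {h : A.V → ℂ}
    (hh : Integrable h) (hcone : ∀ ξ, h ξ ≠ 0 → ξ ∈ A.cone) {s : Finset A.Hg}
    {θ : A.Hg → 𝓢(A.V, ℂ)} (hθc : ∀ a ∈ s, HasCompactSupport (θ a))
    (hθ : ∀ ξ ∈ tsupport L.bump, ∑ a ∈ s, θ a ξ = 1) {y : A.V} (hy : y ∈ A.cone) (x : A.V) :
    Filter.Tendsto (fun n => ∑ i ∈ Finset.range n ×ˢ s, laplaceInt (L.part h (θ i.2) i.1) x y)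
      Filter.atTop (𝓝 (laplaceInt h x y)) := by
  have hpos : ∀ ξ ∈ A.cone, 0 ≤ inner ℝ y ξ := fun ξ hξ => hA.inner_nonneg hy (subset_closure hξ)
  have hint : ∀ n, ∀ i ∈ Finset.range n ×ˢ s, Integrable (L.part h (θ i.2) i.1) := fun n i hi =>
    L.integrable_part hA hh (θ i.2).continuous (hθc _ (Finset.mem_product.1 hi).2) _
  have hsum : ∀ (n : ℕ) ξ, ∑ i ∈ Finset.range n ×ˢ s, L.part h (θ i.2) i.1 ξ =
      h ξ * ((∑ j ∈ Finset.range n, L.chi j ξ : ℝ) : ℂ) := by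
    intro n ξ
    rw [Finset.sum_product, Complex.ofReal_sum, Finset.mul_sum]
    refine Finset.sum_congr rfl fun j _ => ?_
    simp only [LittlewoodPaley.part]
    rw [← Finset.mul_sum]
    by_cases h0 : L.phi j ξ = 0
    · simp [L.chi_eq_zero h0]
    · rw [hθ _ (L.PE_inv_mem_of_phi_ne_zero h0), mul_one]
  have heq : ∀ n, ∑ i ∈ Finset.range n ×ˢ s, laplaceInt (L.part h (θ i.2) i.1) x y =
      ∫ ξ, laplaceKer x y ξ * (h ξ * ((∑ j ∈ Finset.range n, L.chi j ξ : ℝ) : ℂ)) := fun n => by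
    rw [← laplaceInt_finset_sum (a := 0) _ (hint n)
      (fun i _ ξ hξ => hpos ξ (L.mem_cone_of_part_ne_zero hA hξ))]
    simp only [hsum, laplaceInt]
  simp only [heq]
  have hc : Continuous (laplaceKer x y) :=
    continuous_laplaceKer.comp (Continuous.prodMk_right (x, y))
  refine tendsto_integral_of_dominated_convergence (fun ξ => ‖h ξ‖) (fun n => ?_) hh.norm
    (fun n => Filter.Eventually.of_forall fun ξ => ?_) (Filter.Eventually.of_forall fun ξ => ?_)
  · refine hc.aestronglyMeasurable.mul (hh.1.mul ?_)
    exact (Complex.measurable_ofReal.comp (Finset.measurable_fun_sum _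
      fun j _ => L.measurable_chi hA j)).aestronglyMeasurable
  · rcases eq_or_ne (h ξ) 0 with h0 | h0
    · simp [h0]
    · rw [norm_mul, norm_mul, norm_laplaceKer, Complex.norm_real, Real.norm_of_nonneg
        (Finset.sum_nonneg fun j _ => L.chi_nonneg j ξ)]
      have h1 : Real.exp (-inner ℝ y ξ) ≤ 1 :=
        Real.exp_le_one_iff.2 (neg_nonpos.2 (hpos ξ (hcone ξ h0)))
      refine (mul_le_of_le_one_left (mul_nonneg (norm_nonneg _)
        (Finset.sum_nonneg fun j _ => L.chi_nonneg j ξ)) h1).trans ?_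
      exact mul_le_of_le_one_right (norm_nonneg _) (L.sum_chi_le_one hA _ ξ)
  · rcases eq_or_ne (h ξ) 0 with h0 | h0
    · simp [h0]
    · have h1 := (L.hasSum_chi hA (hcone ξ h0)).tendsto_sum_nat
      have h2 := (Complex.continuous_ofReal.tendsto _).comp h1
      have h3 := (h2.const_mul (h ξ)).const_mul (laplaceKer x y ξ)
      simpa using h3

theorem LittlewoodPaley.Decoupling.exists_eLpNorm_laplaceInt_le (hA : A.IsSymmetric)
    {L : A.LittlewoodPaley} {p s : ℝ} (hp : 1 ≤ p) (hs : 1 ≤ s) {μ : Fin r → ℝ} {δ : ℝ}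
    (hδ : 0 < δ) {C : ℝ≥0} (hdec : L.Decoupling p s μ δ C) :
    ∃ (C' : ℝ≥0) (γ : ℝ), 0 < γ ∧ ∀ f ∈ A.schwartzCone, (∀ j, L.lpNorm p f j < ∞) → ∀ t : A.Hg,
      eLpNorm (fun x => laplaceInt (A.fourier f) x (A.sq t)) (ENNReal.ofReal p) volume ≤
        C' * (∑' j, ENNReal.ofReal (A.mon (fun i => 2 * -μ i) ((L.wt j : A.Up) * t) *
          Real.exp (-(γ * ‖(L.wt j : A.Up) * t‖ ^ 2))) * L.lpNorm p f j ^ s) ^ (1 / s) := by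
  classical
  have hs0 : 0 < s := by linarith
  obtain ⟨ε, hε, hε1, hε2⟩ := exists_ball_radius hA
  obtain ⟨G, M, θ, hM, hGM, hθc, hθs, hθ1⟩ := L.exists_partition hA hε hε1
  have hcb := A.cb_pos
  set γ : ℝ := (2 * A.cb * M)⁻¹ ^ 2
  have hγ : 0 < γ := by positivity
  have hK : ∃ K : ℝ≥0, ∀ a ∈ G, ∀ t : A.Up, Integrable (fun x => laplaceInt (θ a) x (A.sq t)) ∧
      ∫⁻ x, ‖laplaceInt (θ a) x (A.sq t)‖ₑ ≤ K * ENNReal.ofReal (Real.exp (-(γ * ‖t‖ ^ 2))) := by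
    have h1 : ∀ a, ∃ K : ℝ≥0, a ∈ G → ∀ t : A.Up,
        Integrable (fun x => laplaceInt (θ a) x (A.sq t)) ∧
        ∫⁻ x, ‖laplaceInt (θ a) x (A.sq t)‖ₑ ≤ K * ENNReal.ofReal (Real.exp (-(γ * ‖t‖ ^ 2))) := by
      intro a
      by_cases ha : a ∈ G
      · obtain ⟨K, hK⟩ := exists_lintegral_enorm_laplaceInt_le hε1 hM (hGM a ha) (hθs a ha)
        exact ⟨K, fun _ => hK⟩
      · exact ⟨0, fun h => absurd h ha⟩
    choose K hK using h1
    refine ⟨∑ a ∈ G, K a, fun a ha t => ⟨(hK a ha t).1, (hK a ha t).2.trans ?_⟩⟩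
    gcongr
    exact Finset.single_le_sum (f := K) (fun _ _ => zero_le) ha
  obtain ⟨K, hK⟩ := hK
  -- Bounds w_j W w_k⁻¹ = a⁻¹ (a w_j W w_k⁻¹), where a is one of the finitely many centres and the
  -- second factor is controlled by `exists_near`.
  set B : ℝ := A.cb * M * A.distBound 1
  obtain ⟨b, hb, hbB⟩ := A.exists_le_mon (fun i => 2 * -μ i) B
  obtain ⟨N, hN⟩ := A.exists_card_le hε hε1 B
  have hN' := hN L.wt (L.separated hA hε1 fun u hu => (hε2 u hu).1)
  -- The dilation factor, small enough that the growth e^{δ(ξ_k|e)} uses at most half of the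
  -- Gaussian exponent s γ.
  set c : ℝ := √(s * γ / 2 / (δ * (A.cb * B) ^ 2 + 1))
  have hc : 0 < c := Real.sqrt_pos.2 (by positivity)
  have hcB : δ * (A.cb * B * c) ^ 2 ≤ s * γ / 2 := by
    rw [mul_pow, Real.sq_sqrt (by positivity), ← mul_assoc, ← mul_div_assoc,
      div_le_iff₀ (by positivity)]
    nlinarith [show (0 : ℝ) ≤ s * γ / 2 by positivity]
  obtain ⟨S, hS⟩ := exists_smul_one (A := A) hc
  set D : ℝ := b⁻¹ * A.mon (fun i => 2 * -μ i) S
  have hD : 0 ≤ D := mul_nonneg (inv_pos.2 hb).le (A.mon_pos _ S).le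
  set R : ℝ≥0∞ := ((N * G.card : ℕ) : ℝ≥0∞) ^ (s - 1) *
    ((G.card : ℝ≥0∞) * (K ^ s * ENNReal.ofReal D))
  have hR : C * R ^ (1 / s) ≠ ∞ := by
    refine ENNReal.mul_ne_top ENNReal.coe_ne_top (ENNReal.rpow_ne_top_of_nonneg (by positivity) ?_)
    refine ENNReal.mul_ne_top (ENNReal.rpow_ne_top_of_nonneg (by linarith)
      (ENNReal.natCast_ne_top _)) (ENNReal.mul_ne_top (ENNReal.natCast_ne_top _)
      (ENNReal.mul_ne_top (ENNReal.rpow_ne_top_of_nonneg hs0.le ENNReal.coe_ne_top)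
      ENNReal.ofReal_ne_top))
  refine ⟨(C * R ^ (1 / s)).toNNReal, s * γ / 2, by positivity, fun f hf hfin t => ?_⟩
  rw [ENNReal.coe_toNNReal hR]
  obtain ⟨h, hh⟩ := A.exists_schwartz_fourier f
  have hhi : Integrable (A.fourier f) := hh ▸ h.integrable
  have hcone : ∀ ξ, A.fourier f ξ ≠ 0 → ξ ∈ A.cone := fun ξ hξ => by
    by_contra hn
    exact hξ (hA.eq_zero_of_notMem_cone (hh ▸ h.continuous) hf hn)
  have hy : A.sq t ∈ A.cone := A.mem_cone_iff.2 ⟨t, rfl⟩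
  have hpos : ∀ ξ ∈ A.cone, 0 ≤ inner ℝ (A.sq t) ξ := fun ξ hξ =>
    hA.inner_nonneg hy (subset_closure hξ)
  set X : ℕ → ℝ≥0∞ := fun j => ENNReal.ofReal (A.mon (fun i => 2 * -μ i) ((L.wt j : A.Up) * t) *
          Real.exp (-(s * γ / 2 * ‖(L.wt j : A.Up) * t‖ ^ 2))) * L.lpNorm p f j ^ s
  set m : ℕ × A.Hg → A.V → ℂ := fun i => L.part (A.fourier f) (θ i.2) i.1
  have hmn : ∀ j, ∀ a ∈ G, eLpNorm (fun x => laplaceInt (m (j, a)) x (A.sq t)) (ENNReal.ofReal p)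
      volume ≤ K * ENNReal.ofReal (Real.exp (-(γ * ‖(L.wt j : A.Up) * t‖ ^ 2))) *
        L.lpNorm p f j := by
    intro j a ha
    refine (L.eLpNorm_part_le hA f hp (b := 0) (fun ξ hξ => ?_) (hK a ha _).1).trans ?_
    · obtain ⟨u, -, rfl⟩ := hθs a ha ξ (subset_tsupport _ hξ)
      rw [inner_sq_sqs]; positivity
    · exact mul_le_mul_left (hK a ha _).2 _
  set W : A.Hg := S * t
  have hW : ∀ w : A.Hg, w * W = S * (w * t) := fun w => Hg.ext (by
    simp only [W, Hg.coe_mul, hS, mul_smul_comm])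
  -- The lattice point near the dilated piece (j, a), whose frequency is centred at a w_j W.
  choose k hk1 hk2 using fun i : ℕ × A.Hg =>
    L.exists_near hA (fun u hu => (hε2 u hu).2) (i.2 * L.wt i.1 * W)
  have hd : ∀ j, ∀ a ∈ G, L.wt j * W * (L.wt (k (j, a)))⁻¹ ∈ A.bddH B := by
    intro j a ha
    have h1 := A.mul_mem_bddH (A.inv_mem_bddH (hGM a ha)) (hk1 (j, a))
    convert h1 using 1
    simp only [mul_assoc, inv_mul_cancel_left]
  have hfinite : ∀ n : ℕ, eLpNorm (fun x => ∑ i ∈ Finset.range n ×ˢ G, laplaceInt (m i) x (A.sq t))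
      (ENNReal.ofReal p) volume ≤ C * R ^ (1 / s) * (∑' j, X j) ^ (1 / s) := by
    intro n
    have h1 := hdec.sum_laplaceInt_le hp hs (Finset.range n ×ˢ G) k (m := m) (y := A.sq t)
      (Z := fun i => A.PE W '' (A.PE (L.wt i.1) '' tsupport (θ i.2)))
      (fun i hi => ((hθc _ (Finset.mem_product.1 hi).2).isCompact.image
        (A.PE _).continuous).image (A.PE _).continuous)
      (fun i hi => ?_) W
      (fun i hi => L.integrable_part hA hhi (θ i.2).continuous
        (hθc _ (Finset.mem_product.1 hi).2) _)
      (fun i hi ξ hξ => hpos ξ (L.mem_cone_of_part_ne_zero hA hξ))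
      (fun i hi ξ hξ => ?_)
      (fun i hi => (hmn i.1 i.2 (Finset.mem_product.1 hi).2).trans_lt
        (ENNReal.mul_lt_top (ENNReal.mul_lt_top ENNReal.coe_lt_top ENNReal.ofReal_lt_top)
          (hfin _)))
      (N := N * G.card) (fun n' => ?_)
    · refine h1.trans ?_
      rw [mul_assoc, ← ENNReal.mul_rpow_of_nonneg _ _ (by positivity)]
      simp only [R]
      rw [mul_assoc (((N * G.card : ℕ) : ℝ≥0∞) ^ (s - 1))]
      gcongr
      calc _ ≤ ∑ i ∈ Finset.range n ×ˢ G, (K ^ s * ENNReal.ofReal D) * X i.1 := by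
            refine Finset.sum_le_sum fun i hi => ?_
            have hi2 := (Finset.mem_product.1 hi).2
            rw [L.pt_eq, Qstarpow_sqs, real_inner_comm, ← norm_sq_eq_inner_e_sqs]
            have h2 := mon_mul_exp_le (fun i => 2 * -μ i) hδ.le hb hc.le hcB hbB
              (t := L.wt i.1 * t) (v := L.wt (k i)) hS (by rw [← hW]; exact hd i.1 i.2 hi2)
            refine (mul_le_mul_right (ENNReal.rpow_le_rpow (hmn i.1 i.2 hi2) hs0.le) _).trans ?_
            rw [ENNReal.mul_rpow_of_nonneg _ _ hs0.le, ENNReal.mul_rpow_of_nonneg _ _ hs0.le,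
              ENNReal.ofReal_rpow_of_pos (Real.exp_pos _)]
            rw [← Hg.coe_mul]
            have h3 := ENNReal.ofReal_le_ofReal h2
            rw [ENNReal.ofReal_mul hD, ENNReal.ofReal_mul (mul_nonneg (A.mon_pos _ _).le
              (Real.exp_pos _).le)] at h3
            simp only [X]
            rw [← Hg.coe_mul]
            calc _ = K ^ s * (ENNReal.ofReal (A.mon (fun i => 2 * -μ i) (L.wt (k i)) *
                  Real.exp (δ * ‖(L.wt (k i) : A.Up)‖ ^ 2)) * ENNReal.ofReal
                  (Real.exp (-(γ * ‖((L.wt i.1 * t : A.Hg) : A.Up)‖ ^ 2)) ^ s)) *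
                  L.lpNorm p f i.1 ^ s := by ring
              _ ≤ K ^ s * (ENNReal.ofReal D * ENNReal.ofReal (A.mon (fun i => 2 * -μ i)
                  (L.wt i.1 * t : A.Hg) * Real.exp (-(s * γ / 2 *
                  ‖((L.wt i.1 * t : A.Hg) : A.Up)‖ ^ 2)))) * L.lpNorm p f i.1 ^ s := by
                  gcongr
              _ = _ := by ring
        _ = (G.card : ℝ≥0∞) * (K ^ s * ENNReal.ofReal D) * ∑ j ∈ Finset.range n, X j := by
            rw [Finset.sum_product, Finset.mul_sum]
            refine Finset.sum_congr rfl fun j _ => ?_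
            simp only [Finset.sum_const, nsmul_eq_mul]
            ring
        _ ≤ _ := by
            gcongr
            exact ENNReal.sum_le_tsum _
    · rintro _ ⟨_, ⟨ξ, hξ, rfl⟩, rfl⟩
      obtain ⟨u, hu, rfl⟩ := hθs _ (Finset.mem_product.1 hi).2 ξ hξ
      have h2 := hk2 i u hu
      rw [PE_sqs, PE_sqs, ← Hg.coe_mul, ← Hg.coe_mul]
      simpa only [mul_assoc] using h2
    · refine ⟨ξ, ⟨A.PE (L.wt i.1)⁻¹ ξ, subset_tsupport _ fun h0 => hξ ?_, ?_⟩, rfl⟩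
      · simp only [m, LittlewoodPaley.part, h0, mul_zero]
      · rw [← A.PE_mul, inv_mul_cancel, PE_one]
    · set J := ((Finset.range n ×ˢ G).filter fun i => k i = n').image Prod.fst
      have hJ : J.card ≤ N := by
        refine hN' (W * (L.wt n')⁻¹) J fun j hj => ?_
        obtain ⟨i, hi, rfl⟩ := Finset.mem_image.1 hj
        obtain ⟨hi1, rfl⟩ := Finset.mem_filter.1 hi
        rw [← mul_assoc]
        exact hd i.1 i.2 (Finset.mem_product.1 hi1).2
      calc _ ≤ (J ×ˢ G).card := by
            refine Finset.card_le_card fun i hi => ?_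
            exact Finset.mem_product.2 ⟨Finset.mem_image_of_mem _ hi,
              (Finset.mem_product.1 (Finset.mem_filter.1 hi).1).2⟩
        _ ≤ _ := by rw [Finset.card_product]; gcongr
  -- The decoupling bound holds for finite sums, uniformly in n; Fatou's lemma passes to the
  -- pointwise limit.
  refine (Lp.eLpNorm_lim_le_liminf_eLpNorm (f := fun (n : ℕ) x => ∑ i ∈ Finset.range n ×ˢ G,
    laplaceInt (m i) x (A.sq t)) (fun n => ?_) _ (Filter.Eventually.of_forall fun x =>
    tendsto_sum_part hA L hhi hcone hθc hθ1 hy x)).trans ?_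
  · refine Continuous.aestronglyMeasurable (continuous_finsetSum _ fun i hi => ?_)
    exact continuous_laplaceInt (L.integrable_part hA hhi (θ i.2).continuous
      (hθc _ (Finset.mem_product.1 hi).2) _)
      (fun ξ hξ => hpos ξ (L.mem_cone_of_part_ne_zero hA hξ))
  · exact (Filter.liminf_le_liminf (Filter.Eventually.of_forall hfinite)).trans_eq
      (Filter.liminf_const _)

end TAlgebra

end

open MeasureTheory Set
open scoped ENNReal NNReal SchwartzMap

set_option linter.unusedSectionVars false

noncomputable section

namespace TAlgebra

variable {r : ℕ} {U : Type*} [NormedAddCommGroup U] [InnerProductSpace ℝ U] (A : TAlgebra r U)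

variable [FiniteDimensional ℝ U]

open scoped Topology

/-! ### Integration over the cone -/

theorem ENNReal_rpow_tsum_le {a : ℕ → ℝ≥0∞} {x : ℝ} (hx0 : 0 < x) (hx1 : x ≤ 1) :
    (∑' j, a j) ^ x ≤ ∑' j, a j ^ x := by
  refine le_of_tendsto' ((ENNReal.continuous_rpow_const.tendsto _).comp
    (ENNReal.summable (f := a)).hasSum.tendsto_sum_nat) fun n => ?_
  refine le_trans ?_ (ENNReal.sum_le_tsum (Finset.range n))
  exact Finset.le_sum_of_subadditive (fun b : ℝ≥0∞ => b ^ x)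
    (ENNReal.zero_rpow_of_pos hx0).le (fun b c => ENNReal.rpow_add_le_add_rpow b c hx0.le hx1) _ _

variable {A}

/-- Exchanges the exponent s for q. The condition on ρ is the one needed to integrate in t
afterwards. For q ≤ s, subadditivity gives ρ = 2μ q/s. For q > s, Hölder with the weight mon α ·
e^{-γ‖·‖²}, α = n + η, replaces 2μ by 2μ + α at the rate q/s and returns α. Letting η approach 0
produces the terms n_j/2 in condition (ii). -/
theorem exists_rpow_tsum_le {ν μ : Fin r → ℝ} {q s : ℝ} (hs : 1 ≤ s) (hμ : ∀ j, 0 < μ j)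
    (hq : (1 ≤ q ∧ q ≤ s ∧ ∀ j, q < s * ((ν j - A.mm j / 2) / μ j)) ∨
      (s < q ∧ ∀ j, q < s * ((ν j - A.mm j / 2 + A.nn j / 2) / (μ j + A.nn j / 2))))
    {ε : ℝ} (hε : 0 < ε) (hε1 : ε ≤ A.rad) {γ : ℝ} (hγ : 0 < γ) :
    ∃ (C : ℝ≥0) (ρ : Fin r → ℝ) (γ' : ℝ), 0 < γ' ∧ (∀ i, A.mm i < 2 * ν i - ρ i) ∧
      ∀ v : ℕ → A.Hg, A.Separated ε v → ∀ a : ℕ → ℝ≥0∞,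
        (∑' j, ENNReal.ofReal (A.mon (fun i => 2 * -μ i) (v j) *
          Real.exp (-(γ * ‖(v j : A.Up)‖ ^ 2))) * a j ^ s) ^ (q / s) ≤
        C * ∑' j, ENNReal.ofReal (A.mon (fun i => -ρ i) (v j) *
          Real.exp (-(γ' * ‖(v j : A.Up)‖ ^ 2))) * a j ^ q := by
  have hs0 : 0 < s := by linarith
  rcases hq with ⟨hq1, hqs, hq⟩ | ⟨hsq, hq⟩
  · have hx0 : 0 < q / s := by positivity
    refine ⟨1, fun i => 2 * μ i * (q / s), γ * (q / s), by positivity, fun i => ?_,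
      fun v _ a => ?_⟩
    · have h := hq i
      rw [← mul_div_assoc, lt_div_iff₀ (hμ i)] at h
      have h2 : q / s * μ i < ν i - A.mm i / 2 := by
        rw [div_mul_eq_mul_div, div_lt_iff₀ hs0]; linarith
      linarith
    · rw [ENNReal.coe_one, one_mul]
      refine (ENNReal_rpow_tsum_le hx0 ((div_le_one hs0).2 hqs)).trans_eq (tsum_congr fun j => ?_)
      rw [ENNReal.mul_rpow_of_nonneg _ _ hx0.le, ← ENNReal.rpow_mul, mul_div_cancel₀ _ hs0.ne',
        ENNReal.ofReal_rpow_of_pos (mul_pos (A.mon_pos _ _) (Real.exp_pos _)),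
        Real.mul_rpow (A.mon_pos _ _).le (Real.exp_pos _).le, mon_rpow, ← Real.exp_mul]
      congr 4
      · ext i; ring
      · ring
  · have hx1 : 1 ≤ q / s := (one_le_div hs0).2 hsq.le
    have hnn : ∀ i, 0 ≤ A.nn i := fun i => Finset.sum_nonneg fun j _ => Nat.cast_nonneg _
    -- The strict inequality on q leaves room for an excess η over the threshold n_i, simultaneously
    -- for all i.
    obtain ⟨η, hη, hη0⟩ : ∃ η : ℝ, (∀ i, η * (q / s) < 2 * ν i - A.mm i + A.nn i -
        q / s * (2 * μ i + A.nn i)) ∧ 0 < η := by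
      have h1 : ∀ᶠ η : ℝ in 𝓝[>] 0, ∀ i, η * (q / s) < 2 * ν i - A.mm i + A.nn i -
          q / s * (2 * μ i + A.nn i) := by
        rw [Filter.eventually_all]
        intro i
        have hgap : 0 * (q / s) < 2 * ν i - A.mm i + A.nn i - q / s * (2 * μ i + A.nn i) := by
          have h := hq i
          have hpos : 0 < μ i + A.nn i / 2 := by linarith [hμ i, hnn i]
          rw [← mul_div_assoc, lt_div_iff₀ hpos] at h
          have h2 : q / s * (μ i + A.nn i / 2) < ν i - A.mm i / 2 + A.nn i / 2 := by
            rw [div_mul_eq_mul_div, div_lt_iff₀ hs0]; linarith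
          linarith
        exact (((continuous_id.mul continuous_const).tendsto (0 : ℝ)).eventually_lt_const
          hgap).filter_mono nhdsWithin_le_nhds
      exact (h1.and self_mem_nhdsWithin).exists
    set α : Fin r → ℝ := fun i => A.nn i + η
    obtain ⟨C, hC⟩ := A.exists_tsum_mon_exp_le hε hε1 (α := α)
      (fun i => by simp only [α]; linarith) hγ
    refine ⟨C ^ (q / s - 1), fun i => -(α i + (2 * -μ i - α i) * (q / s)), γ, hγ, fun i => ?_,
      fun v hv a => ?_⟩
    · have := hη i
      simp only [α]
      nlinarith
    · have h := lintegral_mul_rpow_le (m := (Measure.count : Measure ℕ))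
        (k := fun j => ENNReal.ofReal (A.mon α (v j) * Real.exp (-(γ * ‖(v j : A.Up)‖ ^ 2))))
        (g := fun j => ENNReal.ofReal (A.mon (fun i => 2 * -μ i - α i) (v j)) * a j ^ s)
        (measurable_of_countable _) (measurable_of_countable _) hx1
      simp only [lintegral_count] at h
      have e1 : ∀ j, ENNReal.ofReal (A.mon (fun i => 2 * -μ i) (v j) *
          Real.exp (-(γ * ‖(v j : A.Up)‖ ^ 2))) * a j ^ s =
          ENNReal.ofReal (A.mon α (v j) * Real.exp (-(γ * ‖(v j : A.Up)‖ ^ 2))) *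
          (ENNReal.ofReal (A.mon (fun i => 2 * -μ i - α i) (v j)) * a j ^ s) := fun j => by
        rw [← mul_assoc, ← ENNReal.ofReal_mul (mul_nonneg (A.mon_pos _ _).le (Real.exp_pos _).le),
          mul_right_comm, ← mon_add]
        congr 4
        ext i
        ring
      have e2 : ∀ j, ENNReal.ofReal (A.mon α (v j) * Real.exp (-(γ * ‖(v j : A.Up)‖ ^ 2))) *
          (ENNReal.ofReal (A.mon (fun i => 2 * -μ i - α i) (v j)) * a j ^ s) ^ (q / s) =
          ENNReal.ofReal (A.mon (fun i => - -(α i + (2 * -μ i - α i) * (q / s))) (v j) *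
          Real.exp (-(γ * ‖(v j : A.Up)‖ ^ 2))) * a j ^ q := fun j => by
        rw [ENNReal.mul_rpow_of_nonneg _ _ (by linarith), ← ENNReal.rpow_mul,
          mul_div_cancel₀ _ hs0.ne', ENNReal.ofReal_rpow_of_pos (A.mon_pos _ _), mon_rpow,
          ← mul_assoc, ← ENNReal.ofReal_mul (mul_nonneg (A.mon_pos _ _).le (Real.exp_pos _).le),
          mul_right_comm, ← mon_add]
        simp only [neg_neg]
      simp only [← e1, e2] at h
      refine h.trans ?_
      rw [ENNReal.coe_rpow_of_nonneg _ (by linarith)]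
      exact mul_le_mul_left (ENNReal.rpow_le_rpow (hC v hv) (by linarith)) _

-- The exponent 2(ν_i - τ_i) of the compound weight and the exponent 1 + n_i of the Jacobian add up
-- to 2ν_i - 1 - m_i.
variable (A) in
theorem exists_mixedNorm_eq (ν : Fin r → ℝ) : ∃ c : ℝ≥0, ∀ (p q : ℝ) (F : A.V → A.V → ℂ),
    A.mixedNorm ν p q F = (c * ∫⁻ t in A.Hset,
      eLpNorm (fun x => F x (A.sq t)) (ENNReal.ofReal p) volume ^ q *
        ENNReal.ofReal (A.mon (fun i => 2 * ν i - 1 - A.mm i) t)) ^ (1 / q) := by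
  obtain ⟨c, hc⟩ := A.exists_lintegral_cone_eq
  refine ⟨c, fun p q F => ?_⟩
  rw [mixedNorm, hc]
  congr 2
  refine setLIntegral_congr_fun A.measurableSet_Hset fun t ht => ?_
  obtain ⟨t, rfl⟩ := exists_Hg_eq ht
  rw [Qpow_sq, mul_left_comm, ← ENNReal.ofReal_mul (A.mon_pos _ _).le, ← mon_add]
  congr 4
  ext i
  rw [tau]
  ring

/-! ### The operator C on S_Ω: holomorphy and finiteness of the Bergman norm -/

theorem opC_eq (hA : A.IsSymmetric) {f : 𝓢(A.V, ℂ)} (hf : f ∈ A.schwartzCone) (x y : A.V) :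
    A.opC f x y = ((2 * Real.pi) ^ (-(Module.finrank ℝ A.V : ℝ) / 2) : ℝ) *
      laplaceInt (A.fourier f) x y := by
  obtain ⟨h, hh⟩ := A.exists_schwartz_fourier f
  rw [opC, laplaceInt]
  congr 1
  refine setIntegral_eq_integral_of_forall_compl_eq_zero fun ξ hξ => ?_
  rw [hA.eq_zero_of_notMem_cone (hh ▸ h.continuous) hf hξ, mul_zero]

theorem holomorphicOnTube_opC (hA : A.IsSymmetric) {f : 𝓢(A.V, ℂ)} (hf : f ∈ A.schwartzCone) :
    A.HolomorphicOnTube (A.opC f) := by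
  obtain ⟨h, hh⟩ := A.exists_schwartz_fourier f
  intro x y hy
  obtain ⟨D, hD, hD'⟩ := exists_hasFDerivAt_laplaceInt h hA.isOpen_cone
    (fun y hy ξ hξ => hA.inner_nonneg hy (hf (hh ▸ subset_tsupport _ hξ))) x y hy
  refine ⟨(((2 * Real.pi) ^ (-(Module.finrank ℝ A.V : ℝ) / 2) : ℝ) : ℂ) • D, ?_, fun v => ?_⟩
  · simp only [opC_eq hA hf]
    rw [← hh]
    exact hD.const_mul _
  · rw [smul_apply, smul_apply, hD', smul_eq_mul, smul_eq_mul]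
    ring

theorem eLpNorm_opC_eq (hA : A.IsSymmetric) {f : 𝓢(A.V, ℂ)} (hf : f ∈ A.schwartzCone)
    (p : ℝ≥0∞) (y : A.V) : eLpNorm (fun x => A.opC f x y) p volume =
      ENNReal.ofReal ((2 * Real.pi) ^ (-(Module.finrank ℝ A.V : ℝ) / 2)) *
        eLpNorm (fun x => laplaceInt (A.fourier f) x y) p volume := by
  have h : (fun x => A.opC f x y) =
      (((2 * Real.pi) ^ (-(Module.finrank ℝ A.V : ℝ) / 2) : ℝ) : ℂ) •
        fun x => laplaceInt (A.fourier f) x y := funext fun x => opC_eq hA hf x y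
  rw [h, eLpNorm_const_smul, ← ofReal_norm, Complex.norm_real,
    Real.norm_of_nonneg (by positivity)]

theorem eLpNorm_one_add_norm_lt_top {E : Type*} [NormedAddCommGroup E] [InnerProductSpace ℝ E]
    [MeasurableSpace E] [BorelSpace E] [FiniteDimensional ℝ E] {p : ℝ} (hp : 1 ≤ p) {N : ℝ}
    (hN : Module.finrank ℝ E < N) :
    eLpNorm (fun x : E => (((1 + ‖x‖) ^ (-N) : ℝ) : ℂ)) (ENNReal.ofReal p) volume < ∞ := by
  have hN0 : 0 < N := (Nat.cast_nonneg _).trans_lt hN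
  have hint : Integrable (fun x : E => (((1 + ‖x‖) ^ (-N) : ℝ) : ℂ)) :=
    (integrable_one_add_norm hN).ofReal
  rw [eLpNorm_ofReal_eq _ hp]
  refine ENNReal.rpow_lt_top_of_nonneg (by positivity) (ne_top_of_le_ne_top hint.2.ne
    (lintegral_mono fun x => ?_))
  conv_rhs => rw [← ENNReal.rpow_one ‖_‖ₑ]
  refine ENNReal.rpow_le_rpow_of_exponent_ge ?_ hp
  rw [← ofReal_norm, Complex.norm_real, Real.norm_of_nonneg (by positivity),
    ← ENNReal.ofReal_one]
  refine ENNReal.ofReal_le_ofReal (Real.rpow_le_one_of_one_le_of_nonpos ?_ (by linarith))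
  linarith [norm_nonneg x]

/-- Of the d + N powers of decay in x + iy, d make the p-th power integrable in x and N remain for
the height. Since ‖t‖² = (t t⋆ | e) ≤ ‖t t⋆‖‖e‖, decay in y = t t⋆ is decay in t. -/
theorem exists_eLpNorm_laplaceInt_le_rpow (hA : A.IsSymmetric) {f : 𝓢(A.V, ℂ)}
    (hf : f ∈ A.schwartzCone) {p : ℝ} (hp : 1 ≤ p) (N : ℕ) : ∃ C : ℝ≥0, ∀ t : A.Hg,
      eLpNorm (fun x => laplaceInt (A.fourier f) x (A.sq t)) (ENNReal.ofReal p) volume ≤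
        C * ENNReal.ofReal ((1 + ‖(t : A.Up)‖) ^ (-(N : ℝ))) := by
  obtain ⟨h, hh⟩ := A.exists_schwartz_fourier f
  set d := Module.finrank ℝ A.V + 1
  obtain ⟨C, hC0, hC⟩ := exists_norm_laplaceInt_le (d + N) h
  set D : ℝ := 2 * (1 + ‖A.e‖)
  have hD : 0 < D := by positivity
  set Ep := eLpNorm (fun x : A.V => (((1 + ‖x‖) ^ (-(d : ℝ)) : ℝ) : ℂ)) (ENNReal.ofReal p) volume
  have hEp : Ep < ∞ := eLpNorm_one_add_norm_lt_top hp (by simp [d])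
  have hfin : ENNReal.ofReal (C * D ^ N) * Ep ≠ ∞ :=
    (ENNReal.mul_lt_top ENNReal.ofReal_lt_top hEp).ne
  refine ⟨(ENNReal.ofReal (C * D ^ N) * Ep).toNNReal, fun t => ?_⟩
  rw [ENNReal.coe_toNNReal hfin]
  have hy : A.sq t ∈ A.cone := A.mem_cone_iff.2 ⟨t, rfl⟩
  have h1 : (1 + ‖(t : A.Up)‖) ≤ D * (1 + ‖A.sq t‖) := by
    have h2 := real_inner_le_norm (A.sq (t : A.Up)) A.e
    rw [← norm_sq_eq_inner_sq_e] at h2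
    have h3 := norm_nonneg (A.sq (t : A.Up))
    have h4 := norm_nonneg A.e
    simp only [D]
    nlinarith [sq_nonneg (‖(t : A.Up)‖ - 1), mul_nonneg h3 h4]
  have hpt : ∀ x, ‖laplaceInt (A.fourier f) x (A.sq t)‖ ≤
      ‖(((C * D ^ N * (1 + ‖(t : A.Up)‖) ^ (-(N : ℝ)) : ℝ) : ℂ) •
        fun x : A.V => (((1 + ‖x‖) ^ (-(d : ℝ)) : ℝ) : ℂ)) x‖ := by
    intro x
    have h2 := hC 0 (A.sq t) (fun ξ hξ => hA.inner_nonneg hy (hf (hh ▸ hξ))) x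
    rw [neg_zero, Real.exp_zero, mul_one, hh] at h2
    rw [Pi.smul_apply, smul_eq_mul, ← Complex.ofReal_mul, Complex.norm_real,
      Real.norm_of_nonneg (by positivity), Real.rpow_neg (by positivity),
      Real.rpow_neg (by positivity), Real.rpow_natCast, Real.rpow_natCast, mul_assoc (C * D ^ N),
      ← mul_inv, ← div_eq_mul_inv, le_div_iff₀ (by positivity)]
    have hx := norm_nonneg x
    have hyn := norm_nonneg (A.sq (t : A.Up))
    calc _ ≤ ‖laplaceInt (A.fourier f) x (A.sq t)‖ *
          ((D * (1 + ‖x‖ + ‖A.sq t‖)) ^ N * (1 + ‖x‖ + ‖A.sq t‖) ^ d) := by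
          refine mul_le_mul_of_nonneg_left (mul_le_mul (pow_le_pow_left₀ (by positivity)
            (h1.trans (mul_le_mul_of_nonneg_left (by linarith) hD.le)) _)
            (pow_le_pow_left₀ (by positivity) (by linarith) _) (by positivity) (by positivity))
            (norm_nonneg _)
      _ = D ^ N * ((1 + ‖x‖ + ‖A.sq t‖) ^ (d + N) * ‖laplaceInt (A.fourier f) x (A.sq t)‖) := by
          rw [mul_pow, pow_add]; ring
      _ ≤ D ^ N * C := by gcongr
      _ = _ := mul_comm _ _
  refine (eLpNorm_mono hpt).trans_eq ?_
  rw [eLpNorm_const_smul, ← ofReal_norm, Complex.norm_real, Real.norm_of_nonneg (by positivity),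
    ENNReal.ofReal_mul (by positivity)]
  ring

/-- Finiteness comes from Schwartz decay alone, whether or not the Besov norm is finite. Decay
handles large t, and ν_j > m_j/2 says that the exponents 2ν_j - 1 - m_j exceed -1, which gives
integrability at the boundary of the cone. -/
theorem mixedNorm_opC_lt_top (hA : A.IsSymmetric) {ν : Fin r → ℝ} (hν : ∀ j, A.mm j / 2 < ν j)
    {p q : ℝ} (hp : 1 ≤ p) (hq : 1 ≤ q) {f : 𝓢(A.V, ℂ)} (hf : f ∈ A.schwartzCone) :
    A.mixedNorm ν p q (A.opC f) < ∞ := by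
  have hq0 : 0 < q := by linarith
  obtain ⟨c, hc⟩ := A.exists_mixedNorm_eq ν
  obtain ⟨M, hM, hint⟩ := A.exists_integrableOn_mon_mul_one_add
    (κ := fun i => 2 * ν i - 1 - A.mm i) (fun i => by linarith [hν i])
  obtain ⟨N, hN⟩ := exists_nat_ge M
  obtain ⟨C, hC⟩ := exists_eLpNorm_laplaceInt_le_rpow hA hf hp N
  rw [hc]
  refine ENNReal.rpow_lt_top_of_nonneg (by positivity) (ENNReal.mul_ne_top ENNReal.coe_ne_top ?_)
  set b := ENNReal.ofReal ((2 * Real.pi) ^ (-(Module.finrank ℝ A.V : ℝ) / 2)) * C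
  have hb : b ^ q ≠ ∞ := ENNReal.rpow_ne_top_of_nonneg hq0.le
    (ENNReal.mul_ne_top ENNReal.ofReal_ne_top ENNReal.coe_ne_top)
  refine ne_top_of_le_ne_top (b := b ^ q * ∫⁻ t in A.Hset,
    ‖A.mon (fun i => 2 * ν i - 1 - A.mm i) t * (1 + ‖t‖) ^ (-M)‖ₑ)
    (ENNReal.mul_ne_top hb hint.2.ne) ?_
  rw [← lintegral_const_mul' _ _ hb]
  refine setLIntegral_mono' A.measurableSet_Hset fun t ht => ?_
  obtain ⟨t, rfl⟩ := exists_Hg_eq ht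
  have h1 : 1 ≤ 1 + ‖(t : A.Up)‖ := by linarith [norm_nonneg (t : A.Up)]
  have hm := (A.mon_pos (fun i => 2 * ν i - 1 - A.mm i) t).le
  rw [eLpNorm_opC_eq hA hf, ← ofReal_norm, Real.norm_of_nonneg (mul_nonneg hm (by positivity)),
    mul_comm (A.mon _ _), ENNReal.ofReal_mul (by positivity), ← mul_assoc]
  gcongr
  calc _ ≤ (b * ENNReal.ofReal ((1 + ‖(t : A.Up)‖) ^ (-(N : ℝ)))) ^ q := by
        refine ENNReal.rpow_le_rpow ?_ hq0.le
        simp only [b]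
        rw [mul_assoc]
        gcongr
        exact hC t
    _ = b ^ q * ENNReal.ofReal (((1 + ‖(t : A.Up)‖) ^ (-(N : ℝ))) ^ q) := by
        rw [ENNReal.mul_rpow_of_nonneg _ _ hq0.le, ENNReal.ofReal_rpow_of_pos (by positivity)]
    _ ≤ _ := by
        gcongr
        rw [← Real.rpow_mul (by positivity)]
        refine Real.rpow_le_rpow_of_exponent_le h1 ?_
        nlinarith

/-! ### The estimate by the Besov norm -/

theorem besovNorm_eq (L : A.LittlewoodPaley) (ν : Fin r → ℝ) (p q : ℝ) (f : A.V → ℂ) :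
    L.besovNorm ν p q f = (∑' j, ENNReal.ofReal (A.mon (fun i => -(2 * ν i)) (L.wt j)) *
      L.lpNorm p f j ^ q) ^ (1 / q) := by
  rw [LittlewoodPaley.besovNorm]
  congr 2
  ext j
  rw [L.pt_eq, Qstarpow_sqs]
  congr 4
  ext i
  ring

/-- Decoupling concerns functions in L^p, so each block must have finite norm. The positive weights
make this follow from a finite Besov norm. -/
theorem lpNorm_lt_top {L : A.LittlewoodPaley} {ν : Fin r → ℝ} {p q : ℝ} (hq : 1 ≤ q) {f : A.V → ℂ}
    (hf : L.besovNorm ν p q f < ∞) (j : ℕ) : L.lpNorm p f j < ∞ := by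
  have hq0 : 0 < q := by linarith
  rw [besovNorm_eq] at hf
  have h1 := (ENNReal.rpow_lt_top_iff_of_pos (by positivity)).1 hf
  have h2 := (ENNReal.le_tsum j).trans_lt h1
  have h3 := ENNReal.lt_top_of_mul_ne_top_right h2.ne
    (by simpa using A.mon_pos (fun i => -(2 * ν i)) (L.wt j))
  exact (ENNReal.rpow_lt_top_iff_of_pos hq0).1 h3

/-- The q-th power of the fixed-height estimate is bounded by a sum over j and integrated in t term
by term. The j-th integral is at most a constant times mon(-2ν)(w_j), the weight of the j-th block
in the Besov norm. -/
theorem exists_mixedNorm_opC_le (hA : A.IsSymmetric) (L : A.LittlewoodPaley)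
    {ν : Fin r → ℝ} {p s : ℝ} (hp : 1 ≤ p) (hs : 1 ≤ s) {δ : ℝ} (hδ : 0 < δ)
    {μ : Fin r → ℝ} (hμ : ∀ j, 0 < μ j) {C : ℝ≥0} (hdec : L.Decoupling p s μ δ C) {q : ℝ}
    (hq : (1 ≤ q ∧ q ≤ s ∧ ∀ j, q < s * ((ν j - A.mm j / 2) / μ j)) ∨
      (s < q ∧ ∀ j, q < s * ((ν j - A.mm j / 2 + A.nn j / 2) / (μ j + A.nn j / 2)))) :
    ∃ K : ℝ≥0, ∀ f ∈ A.schwartzCone,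
      A.mixedNorm ν p q (A.opC f) ≤ K * L.besovNorm ν p q f := by
  have hs0 : 0 < s := by linarith
  have hq1 : 1 ≤ q := by
    rcases hq with h | h
    · exact h.1
    · linarith [h.1]
  have hq0 : 0 < q := by linarith
  obtain ⟨c, hc⟩ := A.exists_mixedNorm_eq ν
  obtain ⟨C₁, γ, hγ, h1⟩ := hdec.exists_eLpNorm_laplaceInt_le hA hp hs hδ
  obtain ⟨ε, hε, hε1, hε2⟩ := exists_ball_radius hA
  have hsep := L.separated hA hε1 fun u hu => (hε2 u hu).1
  obtain ⟨C₂, ρ, γ', hγ', hρ, h2⟩ := exists_rpow_tsum_le hs hμ hq hε hε1 hγ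
  obtain ⟨C₃, h3⟩ := A.exists_lintegral_mon_exp_le (ν := fun i => 2 * ν i) hρ hγ'
  set b := ENNReal.ofReal ((2 * Real.pi) ^ (-(Module.finrank ℝ A.V : ℝ) / 2)) * C₁
  set K : ℝ≥0∞ := (c * (b ^ q * (C₂ * C₃))) ^ (1 / q)
  have hb : b ^ q * C₂ ≠ ∞ := ENNReal.mul_ne_top (ENNReal.rpow_ne_top_of_nonneg hq0.le
    (ENNReal.mul_ne_top ENNReal.ofReal_ne_top ENNReal.coe_ne_top)) ENNReal.coe_ne_top
  have hK : K ≠ ∞ := by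
    refine ENNReal.rpow_ne_top_of_nonneg (by positivity) (ENNReal.mul_ne_top ENNReal.coe_ne_top ?_)
    rw [← mul_assoc]
    exact ENNReal.mul_ne_top hb ENNReal.coe_ne_top
  -- The added 1 makes the constant positive, so that its product with an infinite Besov norm is ∞
  -- rather than 0.
  refine ⟨K.toNNReal + 1, fun f hf => ?_⟩
  by_cases hB : L.besovNorm ν p q f = ∞
  · rw [hB, ENNReal.mul_top (by simp)]
    exact le_top
  have hfin := lpNorm_lt_top hq1 (lt_top_iff_ne_top.2 hB)
  have hmain : A.mixedNorm ν p q (A.opC f) ≤ K * L.besovNorm ν p q f := by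
    rw [hc, besovNorm_eq, ← ENNReal.mul_rpow_of_nonneg _ _ (by positivity)]
    refine ENNReal.rpow_le_rpow ?_ (by positivity)
    rw [mul_assoc]
    gcongr
    have hpt : ∀ t ∈ A.Hset,
        eLpNorm (fun x => A.opC f x (A.sq t)) (ENNReal.ofReal p) volume ^ q *
          ENNReal.ofReal (A.mon (fun i => 2 * ν i - 1 - A.mm i) t) ≤
        b ^ q * C₂ * ∑' j, L.lpNorm p f j ^ q * (ENNReal.ofReal (A.mon (fun i => -ρ i)
          ((L.wt j : A.Up) * t) * Real.exp (-(γ' * ‖(L.wt j : A.Up) * t‖ ^ 2))) *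
          ENNReal.ofReal (A.mon (fun i => 2 * ν i - 1 - A.mm i) t)) := by
      intro t ht
      obtain ⟨t, rfl⟩ := exists_Hg_eq ht
      -- The family w_j t is separated with the same ε, so `C₂` does not depend on t.
      have h4 := h2 _ (hsep.mul_right t) (L.lpNorm p f)
      simp only [Hg.coe_mul] at h4
      have h5 : eLpNorm (fun x => A.opC f x (A.sq t)) (ENNReal.ofReal p) volume ^ q ≤
          b ^ q * (C₂ * ∑' j, ENNReal.ofReal (A.mon (fun i => -ρ i) ((L.wt j : A.Up) * t) *
            Real.exp (-(γ' * ‖(L.wt j : A.Up) * t‖ ^ 2))) * L.lpNorm p f j ^ q) := by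
        have h6 : eLpNorm (fun x => A.opC f x (A.sq t)) (ENNReal.ofReal p) volume ≤
            b * (∑' j, ENNReal.ofReal (A.mon (fun i => 2 * -μ i) ((L.wt j : A.Up) * t) *
            Real.exp (-(γ * ‖(L.wt j : A.Up) * t‖ ^ 2))) * L.lpNorm p f j ^ s) ^ (1 / s) := by
          rw [eLpNorm_opC_eq hA hf]
          simp only [b]
          rw [mul_assoc]
          gcongr
          exact h1 f hf hfin t
        refine (ENNReal.rpow_le_rpow h6 hq0.le).trans ?_
        rw [ENNReal.mul_rpow_of_nonneg _ _ hq0.le, ← ENNReal.rpow_mul, one_div_mul_eq_div]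
        exact mul_le_mul_right h4 _
      refine (mul_le_mul_left h5 _).trans_eq ?_
      rw [← mul_assoc, mul_assoc, ← ENNReal.tsum_mul_right]
      congr 1
      refine tsum_congr fun j => ?_
      ring
    refine (setLIntegral_mono' A.measurableSet_Hset hpt).trans ?_
    rw [lintegral_const_mul' _ _ hb, lintegral_tsum fun j => ?_]
    · rw [← mul_assoc (b ^ q), mul_assoc (b ^ q * C₂)]
      gcongr
      rw [← ENNReal.tsum_mul_left]
      refine ENNReal.tsum_le_tsum fun j => ?_
      rw [lintegral_const_mul' _ _ (ENNReal.rpow_ne_top_of_nonneg hq0.le (hfin j).ne), mul_comm,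
        ← mul_assoc]
      gcongr
      exact h3 (L.wt j)
    · have hm1 : Measurable fun t : A.Up => A.mon (fun i => -ρ i) ((L.wt j : A.Up) * t) :=
        (A.measurable_mon _).comp (A.mulL (L.wt j)).continuous_of_finiteDimensional.measurable
      have hm2 : Measurable fun t : A.Up => ‖(L.wt j : A.Up) * t‖ :=
        ((A.mulL (L.wt j)).continuous_of_finiteDimensional.measurable).norm
      have hm3 := A.measurable_mon fun i => 2 * ν i - 1 - A.mm i
      exact Measurable.aemeasurable (by fun_prop)
  refine hmain.trans ?_
  gcongr
  rw [ENNReal.coe_add, ENNReal.coe_toNNReal hK]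
  exact le_self_add

end TAlgebra

end

theorem theorem6p3 {r : ℕ} {U : Type*} [NormedAddCommGroup U] [InnerProductSpace ℝ U]
    [FiniteDimensional ℝ U] (A : TAlgebra r U) (hA : A.IsSymmetric) (L : A.LittlewoodPaley)
    (ν : Fin r → ℝ) (hν : ∀ j, A.mm j / 2 < ν j)
    (p s : ℝ) (hp : 1 ≤ p) (hs : 1 ≤ s)
    (δ : ℝ) (hδ : 0 < δ) (μ : Fin r → ℝ) (hμ : ∀ j, 0 < μ j) (C : ℝ≥0)
    (hdec : L.Decoupling p s μ δ C)
    (q : ℝ)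
    (hq : (1 ≤ q ∧ q ≤ s ∧ ∀ j, q < s * ((ν j - A.mm j / 2) / μ j)) ∨
      (s < q ∧ (∀ j, q < s * ((ν j - A.mm j / 2 + A.nn j / 2) / (μ j + A.nn j / 2))) ∧
        ENNReal.ofReal q < A.qTilde ν p)) :
    ∃ K : ℝ≥0, ∀ f ∈ A.schwartzCone,
      A.MemBergman ν p q (A.opC f) ∧
        A.mixedNorm ν p q (A.opC f) ≤ K * L.besovNorm ν p q f := by
  have hq' : (1 ≤ q ∧ q ≤ s ∧ ∀ j, q < s * ((ν j - A.mm j / 2) / μ j)) ∨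
      (s < q ∧ ∀ j, q < s * ((ν j - A.mm j / 2 + A.nn j / 2) / (μ j + A.nn j / 2))) :=
    hq.imp_right fun h => ⟨h.1, h.2.1⟩
  have hq1 : 1 ≤ q := by
    rcases hq' with h | h
    · exact h.1
    · linarith [h.1]
  obtain ⟨K, hK⟩ := TAlgebra.exists_mixedNorm_opC_le hA L hp hs hδ hμ hdec hq'
  exact ⟨K, fun f hf => ⟨⟨TAlgebra.holomorphicOnTube_opC hA hf,
    TAlgebra.mixedNorm_opC_lt_top hA hν hp hq1 hf⟩, hK f hf⟩⟩
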